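/- Let $p$ be a prime and let $R$ be a finite extension of $\mathbb{Z}_p$, i.e. a discrete valuation ring of characteristic zero that is a finitely generated $\mathbb{Z}_p$-module, with its $\mathfrak m$-adic topology, where $\mathfrak m$ is its maximal ideal. Let $f=[R/\mathfrak m:\mathbb{F}_p]$ be its inertia degree and $e$ its ramification index, given by $pR=\mathfrak m^e$, and set $n=ef$. Let $H(R)$ be the Heisenberg group of upper unitriangular $3\times 3$ matrices over $R$. For a topological group $G$ let $\zeta^{\triangleleft}_G(s)=\sum_{m\ge 1}a^{\triangleleft}_m(G)m^{-s}$, where $a^{\triangleleft}_m(G)$ is the number of open normal subgroups of index $m$ in $G$, and write $\zeta_{\mathbb{Z}_p^{2n}}=\zeta^{\triangleleft}_{\mathbb{Z}_p^{2n}}$. Let $S_n$ be the symmetric group on $\{1,\dots,n\}$ with Coxeter generators $s_i=(i\ \,i{+}1)$, $1\le i\le n-1$, and Coxeter length $\ell$ (the length of a shortest word in the $s_i$). Let $\mathrm{Des}(w)=\{i\in\{1,\dots,n-1\} : \ell(ws_i)<\ell(w)\}$, let $\ell^{[n-2]}(w)$ be the minimum of $\ell$ on the coset $w\langle s_1,\dots,s_{n-2}\rangle$,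 and put $S_n^{(f)}=\{w\in S_n : w(1)\le f\}$. For $0\le i\le n-1$ set $x_i=p^{(2n+i)(n-i)-(3n-i)s}$. Then all the numbers $a^{\triangleleft}_m(H(R))$ and $a^{\triangleleft}_m(\mathbb{Z}_p^{2n})$, $m\ge 1$, are finite, and for every $s\in\mathbb{C}$ with $\mathrm{Re}(s)>2n-1$ both zeta functions converge absolutely, the denominator below is non-zero, and $$\zeta^{\triangleleft}_{H(R)}(s)=\zeta_{\mathbb{Z}_p^{2n}}(s)\,\frac{\displaystyle\sum_{w\in S_n^{(f)}}p^{-\ell(w)+2f\left\lfloor \ell^{[n-2]}(w)/f\right\rfloor s}\prod_{j\in\mathrm{Des}(w)}x_j}{\displaystyle(1-p^{f(2n-3s)})\prod_{i=1}^{n-1}(1-x_i)}.$$ -/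

import Mathlib

open Equiv (Perm)

noncomputable section

/-! ### Normal zeta functions of topological groups -/

/-- `a_m(G)`: the number of open normal subgroups of index `m` in the topological group `G`. -/
def openNormalCount (G : Type*) [Group G] [TopologicalSpace G] (m : ℕ) : ℕ :=
  Nat.card {N : OpenNormalSubgroup G // (N : Subgroup G).index = m}

/-- The coefficient sequence of the normal zeta function. -/
def normalZetaCoeff (G : Type*) [Group G] [TopologicalSpace G] (m : ℕ) : ℂ :=
  (openNormalCount G m : ℂ)

/-- The normal zeta function `ζ_G(s) = ∑_{m ≥ 1} a_m(G) m^{-s}`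
(Mathlib's `LSeries` ignores the coefficient at `0`). -/
def normalZeta (G : Type*) [Group G] [TopologicalSpace G] (s : ℂ) : ℂ :=
  LSeries (normalZetaCoeff G) s

/-! ### The Heisenberg group -/

/-- The Heisenberg group over `R`: upper unitriangular `3 × 3` matrices over `R`,
as a subgroup of `SL₃(R)`. If `R` carries a topology, it has the topology of the matrix entries. -/
def heisenbergGroup (R : Type*) [CommRing R] :
    Subgroup (Matrix.SpecialLinearGroup (Fin 3) R) where
  carrier := {g | ∃ a b c : R, (g : Matrix (Fin 3) (Fin 3) R) = !![1, a, c; 0, 1, b; 0, 0, 1]}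
  one_mem' := ⟨0, 0, 0, by
    ext i j; fin_cases i <;> fin_cases j <;> simp⟩
  mul_mem' := by
    rintro g h ⟨a, b, c, hg⟩ ⟨a', b', c', hh⟩
    refine ⟨a + a', b + b', c + a * b' + c', ?_⟩
    rw [Matrix.SpecialLinearGroup.coe_mul, hg, hh]
    ext i j; fin_cases i <;> fin_cases j <;>
      simp [Matrix.mul_apply, Fin.sum_univ_three] <;> ring
  inv_mem' := by
    rintro g ⟨a, b, c, hg⟩
    refine ⟨-a, -b, a * b - c, ?_⟩
    rw [Matrix.SpecialLinearGroup.coe_inv, hg, Matrix.adjugate_fin_three]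
    ext i j; fin_cases i <;> fin_cases j <;> simp

/-- The free abelian pro-`p` group `ℤ_p^d` of rank `d`, written multiplicatively. -/
abbrev FreeAbelianProP (p : ℕ) [Fact p.Prime] (d : ℕ) : Type :=
  Multiplicative (Fin d → ℤ_[p])

/-! ### Coxeter statistics on the symmetric group

`S_n` is `Perm (Fin n)`; the letter `k ∈ {1, …, n}` is the element of `Fin n` with value `k - 1`.
The Coxeter generators `s_1, …, s_{n-1}` are indexed by `Fin (n - 1)`, where `i : Fin (n - 1)`
stands for the index `i + 1 ∈ {1, …, n - 1}`. -/

/-- The adjacent transposition `s_{i+1} = (i+1  i+2)`. -/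
def simpleTransposition (n : ℕ) (i : Fin (n - 1)) : Perm (Fin n) :=
  Equiv.swap ⟨i, by omega⟩ ⟨i + 1, by omega⟩

/-- The Coxeter length: the length of a shortest word in the generators representing `w`. -/
def coxeterLength {n : ℕ} (w : Perm (Fin n)) : ℕ :=
  sInf {k | ∃ ω : List (Fin (n - 1)), ω.length = k ∧ (ω.map (simpleTransposition n)).prod = w}

/-- The parabolic subgroup `W_I` generated by the `s_i` with `i ∈ I`. -/
def parabolicSubgroup {n : ℕ} (I : Set (Fin (n - 1))) : Subgroup (Perm (Fin n)) :=
  Subgroup.closure (simpleTransposition n '' I)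

/-- The right parabolic length `len^I(w)`: the length of a shortest element of `w W_I`. -/
def parabolicLength {n : ℕ} (I : Set (Fin (n - 1))) (w : Perm (Fin n)) : ℕ :=
  sInf {k | ∃ v ∈ parabolicSubgroup I, coxeterLength (w * v) = k}

/-- The set `[n-2] = {1, …, n-2}` of indices of generators. -/
def initialIndices (n : ℕ) : Set (Fin (n - 1)) := {i | (i : ℕ) + 1 ≤ n - 2}

open Classical in
/-- The right descent set `{i | len(w s_i) < len(w)}`. -/
def descentSet {n : ℕ} (w : Perm (Fin n)) : Finset (Fin (n - 1)) :=
  {i | coxeterLength (w * simpleTransposition n i) < coxeterLength w}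

open Classical in
/-- `S_n^{(f)} = {w ∈ S_n | w(1) ≤ f}`. -/
def firstLetterLE (n f : ℕ) : Finset (Perm (Fin n)) :=
  {w | ∀ k : Fin n, (k : ℕ) + 1 = 1 → (w k : ℕ) + 1 ≤ f}

/-! ### The explicit formula -/

/-- The numerical datum `x_i = p^{(2n+i)(n-i) - (3n-i)s}`. -/
def numericalDatum (p n : ℕ) (s : ℂ) (i : ℕ) : ℂ :=
  (p : ℂ) ^ ((2 * (n : ℂ) + i) * ((n : ℂ) - i) - (3 * (n : ℂ) - i) * s)

/-- `∑ p^{-len(w) + 2f⌊len^{[n-2]}(w)/f⌋s} ∏_{j ∈ Des(w)} x_j`, summed over `w ∈ S_n^{(f)}`;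
the quotient is the floor division of natural numbers. -/
def cancelledNumerator (p n f : ℕ) (s : ℂ) : ℂ :=
  ∑ w ∈ firstLetterLE n f,
    (p : ℂ) ^ (-(coxeterLength w : ℂ)
        + 2 * (f : ℂ) * ((parabolicLength (initialIndices n) w / f : ℕ) : ℂ) * s)
      * ∏ j ∈ descentSet w, numericalDatum p n s ((j : ℕ) + 1)

/-- `(1 - p^{f(2n-3s)}) ∏_{i=1}^{n-1} (1 - x_i)`. -/
def cancelledDenominator (p n f : ℕ) (s : ℂ) : ℂ :=
  (1 - (p : ℂ) ^ ((f : ℂ) * (2 * (n : ℂ) - 3 * s)))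
    * ∏ i ∈ Finset.Icc 1 (n - 1), (1 - numericalDatum p n s i)

end

/-!
A normal subgroup `N` of the Heisenberg group `H(R)` has an image `M` in `H(R) / Z = R × R` and an
intersection `L` with the centre `Z = R`. Normality means that `L` contains the ideal generated by
the coordinates of the elements of `M`, that is `M ≤ 𝔠 × 𝔠`, where `𝔠 = 𝔪^k` is the largest ideal
contained in `L`. Given such `L` and `M`, the subgroups `N` correspond to the homomorphisms
`M → R / L`, of which there are `|R : L|^{2n}` (`Heisenberg.card_normal_subgroups`,
`card_hom_quotient`). Writing `M = π^k M'` with a uniformizer `π`, the subgroup `M'` of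
`R × R ≅ ℤ_p^{2n}` is arbitrary, and `|H(R) : N| = |R : L| |R² : M'| p^{2fk}`. So the zeta function
of `H(R)` is that of `ℤ_p^{2n}` times `Z = ∑_L |R : L|^{2n - s} p^{-2f k(L) s}`, the sum being over
the finite-index subgroups `L` of `R` (`tsum_heisenberg`).

To compute `Z`, refine the chain of the powers of `𝔪` to a chain `F 0 > F 1 > ⋯` of subgroups with
steps of index `p` and `F (m + n) = p F m` (`PeriodicFlag`). A subgroup `L` has a set of gaps: the
`m` with `L ∩ F m = L ∩ F (m + 1)`. The gaps in the residue class `i` modulo `n` are the `n b + i`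
with `b < a i`, and the tuple `a` is the type of `L`. The type determines the index
`p^{a 1 + ⋯ + a n}` of `L`, and also `k(L)`, since `F (f k) = 𝔪^k` is contained in `L` exactly when
all gaps are smaller than `f k`. The number of `L` of type `a` is a power of `p` whose exponent
counts the pairs `(g, h)` of a non-gap `g` and a gap `h` with `g < h < g + n`
(`PeriodicFlag.card_withGaps`, proved by building `L` from the intersections with the `F m`).

Multiplication by `π` multiplies the contribution of `L` to `Z` by `p^{f(2n - 3s)}` and has as its
image the subgroups contained in `𝔪 = F f`. Hence `(1 - p^{f(2n - 3s)}) Z` is the sum over the `L`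
not contained in `𝔪`, which are those whose type has an entry `0` among the first `f`. Sort the type
by the unique stable sorting permutation `w`. The entry `0` makes `w` an element of `S_n^{(f)}`, and
the increments of the sorted type are arbitrary natural numbers, positive at the descents of `w`
(`bijective_sortedTuple`). The increment at `j` contributes a power of `x_j`, up to the corrections
`-ℓ(w)`, the number of inversions of `w`, in the number of lattices, and
`-⌊(n - w(n)) / f⌋ = -⌊ℓ^{[n-2]}(w) / f⌋` in the conductor exponent (`term_sortedTuple`). Summing
geometric series over the increments gives the formula.
-/

/-! ### Lattices in a group with a periodic flag -/

/-- A periodic flag of subgroups in an additive group `A`: a decreasing chain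
`A = F 0 > F 1 > F 2 > ⋯` with steps of index `p` and `F (m + n) = p • F m`, where `p` acts
injectively on `A` and the chain is cofinal among the subgroups of finite index.
For `A = ℤ_p^n` this is the lattice chain of an Iwahori subgroup. -/
structure PeriodicFlag (A : Type*) [AddCommGroup A] (p n : ℕ) where
  F : ℕ → AddSubgroup A
  zero : F 0 = ⊤
  succ_le : ∀ m, F (m + 1) ≤ F m
  relIndex_succ : ∀ m, (F (m + 1)).relIndex (F m) = p
  period : ∀ m, F (m + n) = (F m).map (nsmulAddMonoidHom p)
  nsmul_injective : Function.Injective (nsmulAddMonoidHom (α := A) p)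
  cofinal : ∀ L : AddSubgroup A, L.FiniteIndex → ∃ m, F m ≤ L

/-- For a set `G` of natural numbers `≥ m`, the number of pairs `(g, h)` with `g ∉ G`, `h ∈ G` and
`m ≤ g < h < g + n`. -/
def gapExponent (n m : ℕ) (G : Finset ℕ) : ℕ :=
  ∑ h ∈ G, ((Finset.Ico m h).filter fun g => g ∉ G ∧ h < g + n).card

namespace PeriodicFlag

variable {A : Type*} [AddCommGroup A] {p n : ℕ} (Φ : PeriodicFlag A p n)

/-- The jumps of a subgroup `L` along the flag: the `m` such that `L` has an element in `F m` that
is not in `F (m + 1)`. -/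
def jumps (L : AddSubgroup A) : Set ℕ := {m | ∃ x ∈ L, x ∈ Φ.F m ∧ x ∉ Φ.F (m + 1)}

lemma antitone : Antitone Φ.F := antitone_nat_of_succ_le Φ.succ_le

lemma relIndex_ne_zero (hp : p.Prime) (m k : ℕ) : (Φ.F (m + k)).relIndex (Φ.F m) ≠ 0 := by
  induction k with
  | zero => simp
  | succ k ih =>
    have h := AddSubgroup.relIndex_mul_relIndex _ _ _ (Φ.succ_le (m + k))
      (Φ.antitone (Nat.le_add_right m k))
    rw [Φ.relIndex_succ] at h
    rw [← add_assoc, ← h]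
    exact mul_ne_zero hp.ne_zero ih

lemma exists_mem_notMem (hp : p.Prime) (m : ℕ) : ∃ x ∈ Φ.F m, x ∉ Φ.F (m + 1) := by
  by_contra! h
  have := AddSubgroup.relIndex_eq_one.2 (show Φ.F m ≤ Φ.F (m + 1) from h)
  rw [Φ.relIndex_succ] at this
  exact hp.one_lt.ne' this

lemma mem_jumps_of_le (hp : p.Prime) {L : AddSubgroup A} {k h : ℕ} (hk : Φ.F k ≤ L) (hh : k ≤ h) :
    h ∈ Φ.jumps L := by
  obtain ⟨x, hx, hx'⟩ := Φ.exists_mem_notMem hp h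
  exact ⟨x, hk (Φ.antitone hh hx), hx, hx'⟩

/-- An element of `F m` outside `F (m + 1)` generates `F m` modulo `F (m + 1)`. -/
lemma exists_sub_zsmul_mem (hp : p.Prime) {m : ℕ} {v x : A} (hv : v ∈ Φ.F m)
    (hv' : v ∉ Φ.F (m + 1)) (hx : x ∈ Φ.F m) : ∃ k : ℤ, x - k • v ∈ Φ.F (m + 1) := by
  set S := Φ.F (m + 1) ⊔ AddSubgroup.zmultiples v with hS
  have hSle : S ≤ Φ.F m := sup_le (Φ.succ_le m) (by simpa using hv)
  have hmul := AddSubgroup.relIndex_mul_relIndex (Φ.F (m + 1)) S (Φ.F m) le_sup_left hSle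
  rw [Φ.relIndex_succ] at hmul
  have h1 : (Φ.F (m + 1)).relIndex S ≠ 1 := by
    intro h
    exact hv' (AddSubgroup.relIndex_eq_one.1 h
      (AddSubgroup.mem_sup_right (AddSubgroup.mem_zmultiples v)))
  have h2 : S.relIndex (Φ.F m) = 1 := by
    have := (Nat.dvd_prime hp).1 (Dvd.intro _ hmul)
    rcases this with h | h
    · exact absurd h h1
    · rw [h] at hmul
      exact Nat.eq_of_mul_eq_mul_left hp.pos (by simpa using hmul)
  have hx2 : x ∈ S := AddSubgroup.relIndex_eq_one.1 h2 hx
  obtain ⟨y, hy, z, hz, rfl⟩ := AddSubgroup.mem_sup.1 hx2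
  obtain ⟨k, rfl⟩ := AddSubgroup.mem_zmultiples_iff.1 hz
  exact ⟨k, by simpa using hy⟩

lemma nsmul_mem_succ (hn : 0 < n) {m : ℕ} {v : A} (hv : v ∈ Φ.F m) : p • v ∈ Φ.F (m + 1) := by
  have : p • v ∈ Φ.F (m + n) := by
    rw [Φ.period]
    exact ⟨v, hv, rfl⟩
  exact Φ.antitone (by omega) this

lemma dvd_of_zsmul_mem (hp : p.Prime) (hn : 0 < n) {m : ℕ} {v : A} (hv : v ∈ Φ.F m)
    (hv' : v ∉ Φ.F (m + 1)) {k : ℤ} (hk : k • v ∈ Φ.F (m + 1)) : (p : ℤ) ∣ k := by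
  by_contra h
  have hc : IsCoprime (p : ℤ) k := (Nat.prime_iff_prime_int.1 hp).coprime_iff_not_dvd.2 h
  obtain ⟨a, b, hab⟩ := hc
  apply hv'
  have h1 : v = a • (p • v) + b • (k • v) := by
    conv_lhs => rw [← one_zsmul v, ← hab]
    rw [add_zsmul, mul_zsmul, mul_zsmul, natCast_zsmul]
  rw [h1]
  exact add_mem (zsmul_mem (Φ.nsmul_mem_succ hn hv) _) (zsmul_mem hk _)

/-- At a jump `m`, passing from `F m` to `F (m + 1)` does not change the relative index of `L`. -/
lemma relIndex_of_mem_jumps (hp : p.Prime) {L : AddSubgroup A} {m : ℕ} (h : m ∈ Φ.jumps L) :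
    L.relIndex (Φ.F m) = L.relIndex (Φ.F (m + 1)) := by
  obtain ⟨v, hvL, hv, hv'⟩ := h
  have h0 := AddSubgroup.relIndex_inf_mul_relIndex L (Φ.F (m + 1)) (Φ.F m)
  have h1 := AddSubgroup.relIndex_inf_mul_relIndex (Φ.F (m + 1)) L (Φ.F m)
  rw [inf_eq_left.2 (Φ.succ_le m), Φ.relIndex_succ, inf_comm] at h0
  have h2 : (Φ.F (m + 1)).relIndex (L ⊓ Φ.F m) = p := by
    rw [← AddSubgroup.relIndex_sup_left]
    have : Φ.F (m + 1) ⊔ L ⊓ Φ.F m = Φ.F m := by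
      refine le_antisymm (sup_le (Φ.succ_le m) inf_le_right) fun x hx => ?_
      obtain ⟨k, hk⟩ := Φ.exists_sub_zsmul_mem hp hv hv' hx
      have : x = (x - k • v) + k • v := by abel
      rw [this]
      exact add_mem (AddSubgroup.mem_sup_left hk)
        (AddSubgroup.mem_sup_right (zsmul_mem (show v ∈ L ⊓ Φ.F m from ⟨hvL, hv⟩) k))
    rw [this, Φ.relIndex_succ]
  rw [h2, ← h0, mul_comm] at h1
  exact Nat.eq_of_mul_eq_mul_right hp.pos (by linarith)

lemma relIndex_of_notMem_jumps {L : AddSubgroup A} {m : ℕ}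
    (h : m ∉ Φ.jumps L) : L.relIndex (Φ.F m) = p * L.relIndex (Φ.F (m + 1)) := by
  have h0 := AddSubgroup.relIndex_inf_mul_relIndex L (Φ.F (m + 1)) (Φ.F m)
  have h1 := AddSubgroup.relIndex_inf_mul_relIndex (Φ.F (m + 1)) L (Φ.F m)
  rw [inf_eq_left.2 (Φ.succ_le m), Φ.relIndex_succ, inf_comm] at h0
  have h2 : (Φ.F (m + 1)).relIndex (L ⊓ Φ.F m) = 1 := by
    rw [AddSubgroup.relIndex_eq_one]
    rintro x ⟨hxL, hx⟩
    by_contra hx'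
    exact h ⟨x, hxL, hx, hx'⟩
  rw [h2, ← h0, one_mul] at h1
  rw [h1, mul_comm]

/-- The index of `L ∩ F m` in `F m` is `p` to the number of gaps of `L` that are at least `m`. -/
lemma relIndex_eq_pow (hp : p.Prime) {L : AddSubgroup A} {k : ℕ} (hk : Φ.F k ≤ L) {G : Finset ℕ}
    {m : ℕ} (hG : ∀ h, m ≤ h → (h ∈ Φ.jumps L ↔ h ∉ G)) :
    L.relIndex (Φ.F m) = p ^ (G.filter (m ≤ ·)).card := by
  by_cases hmk : k ≤ m
  · rw [AddSubgroup.relIndex_eq_one.2 ((Φ.antitone hmk).trans hk)]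
    rw [Finset.filter_false_of_mem, Finset.card_empty, pow_zero]
    intro h hh hm
    exact (hG h hm).1 (Φ.mem_jumps_of_le hp hk (hmk.trans hm)) hh
  · have ih := relIndex_eq_pow hp hk (m := m + 1) (G := G) fun h hh => hG h (by omega)
    by_cases hm : m ∈ G
    · rw [Φ.relIndex_of_notMem_jumps (fun h => (hG m le_rfl).1 h hm), ih, ← pow_succ']
      congr 1
      have : G.filter (m ≤ ·) = insert m (G.filter (m + 1 ≤ ·)) := by
        ext x
        simp only [Finset.mem_filter, Finset.mem_insert]
        constructor
        · rintro ⟨h1, h2⟩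
          rcases h2.eq_or_lt with h | h
          · exact Or.inl h.symm
          · exact Or.inr ⟨h1, h⟩
        · rintro (rfl | ⟨h1, h2⟩)
          · exact ⟨hm, le_rfl⟩
          · exact ⟨h1, by omega⟩
      rw [this, Finset.card_insert_of_notMem (by simp)]
    · rw [Φ.relIndex_of_mem_jumps hp ((hG m le_rfl).2 hm), ih]
      congr 2
      refine Finset.filter_congr fun x hx => ?_
      have : x ≠ m := fun h => hm (h ▸ hx)
      omega
termination_by k - m

lemma mem_of_sub_zsmul {L : AddSubgroup A} {x v : A} {k : ℤ} (hv : v ∈ L) (h : x - k • v ∈ L) :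
    x ∈ L := by
  have : x = (x - k • v) + k • v := by abel
  rw [this]
  exact add_mem h (zsmul_mem hv k)

lemma sup_zmultiples_inf (hp : p.Prime) (hn : 0 < n) {m : ℕ} {L' : AddSubgroup A} {v : A}
    (hL' : L' ≤ Φ.F (m + 1)) (hv : v ∈ Φ.F m) (hv' : v ∉ Φ.F (m + 1)) (hpv : p • v ∈ L') :
    (L' ⊔ AddSubgroup.zmultiples v) ⊓ Φ.F (m + 1) = L' := by
  refine le_antisymm ?_ (le_inf le_sup_left hL')
  rintro x ⟨hx, hx'⟩
  obtain ⟨y, hy, z, hz, rfl⟩ := AddSubgroup.mem_sup.1 hx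
  obtain ⟨k, rfl⟩ := AddSubgroup.mem_zmultiples_iff.1 hz
  have hk : k • v ∈ Φ.F (m + 1) := (AddSubgroup.add_mem_cancel_left _ (hL' hy)).1 hx'
  obtain ⟨c, rfl⟩ := Φ.dvd_of_zsmul_mem hp hn hv hv' hk
  refine add_mem hy ?_
  rw [mul_comm, mul_zsmul, natCast_zsmul]
  exact zsmul_mem hpv c

/-- Given `L' ≤ F (m + 1)` with a jump at `m + n`, the number of `L ≤ F m` not contained in
`F (m + 1)` with `L ∩ F (m + 1) = L'`. Such an `L` is `L' + ℤ v` for a `v` with `p v ∈ L'`, and the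
admissible `v` modulo `L'` form a torsor under `{y ∈ F (m + 1) | p y ∈ L'} / L'`. -/
lemma card_extensions (hp : p.Prime) (hn : 0 < n) {m : ℕ} {L' : AddSubgroup A}
    (hL' : L' ≤ Φ.F (m + 1)) (hj : m + n ∈ Φ.jumps L') :
    Nat.card {L : AddSubgroup A // L ≤ Φ.F m ∧ L ⊓ Φ.F (m + 1) = L' ∧ ¬ L ≤ Φ.F (m + 1)} =
      L'.relIndex (Φ.F (m + 1) ⊓ L'.comap (nsmulAddMonoidHom p)) := by
  obtain ⟨x, hxL, hx, hx'⟩ := hj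
  rw [Φ.period] at hx
  obtain ⟨v, hv, rfl⟩ := hx
  change p • v ∈ L' at hxL
  have hv' : v ∉ Φ.F (m + 1) := by
    intro h
    apply hx'
    rw [show m + n + 1 = (m + 1) + n by omega, Φ.period]
    exact ⟨v, h, rfl⟩
  set T := Φ.F (m + 1) ⊓ L'.comap (nsmulAddMonoidHom p) with hT
  have hvT : ∀ t : T, v + t ∈ Φ.F m ∧ v + t ∉ Φ.F (m + 1) ∧ p • (v + t) ∈ L' := by
    rintro ⟨t, ht1, ht2⟩
    refine ⟨add_mem hv (Φ.succ_le m ht1), fun h => hv' ?_, ?_⟩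
    · exact (AddSubgroup.add_mem_cancel_right _ ht1).1 h
    · rw [nsmul_add]
      exact add_mem hxL ht2
  have hsup : ∀ t : T, (L' ⊔ AddSubgroup.zmultiples (v + (t : A))) ⊓ Φ.F (m + 1) = L' := fun t =>
    Φ.sup_zmultiples_inf hp hn hL' (hvT t).1 (hvT t).2.1 (hvT t).2.2
  let φ : T ⧸ L'.addSubgroupOf T →
      {L : AddSubgroup A // L ≤ Φ.F m ∧ L ⊓ Φ.F (m + 1) = L' ∧ ¬ L ≤ Φ.F (m + 1)} :=
    Quotient.lift (s := QuotientAddGroup.leftRel _)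
      (fun t => ⟨L' ⊔ AddSubgroup.zmultiples (v + (t : A)), by
        refine ⟨sup_le (hL'.trans (Φ.succ_le m)) (by simpa using (hvT t).1), hsup t, fun h => ?_⟩
        exact (hvT t).2.1 (h (AddSubgroup.mem_sup_right (AddSubgroup.mem_zmultiples _)))⟩)
      (by
        intro t t' htt
        have htt : -t + t' ∈ L'.addSubgroupOf T := QuotientAddGroup.leftRel_apply.1 htt
        rw [AddSubgroup.mem_addSubgroupOf] at htt
        simp only [AddSubgroup.coe_add, AddSubgroup.coe_neg] at htt
        apply Subtype.ext
        apply le_antisymm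
        · refine sup_le le_sup_left ?_
          rw [AddSubgroup.zmultiples_le]
          have : v + (t : A) = (v + t') - (-t + t') := by abel
          rw [this]
          exact sub_mem (AddSubgroup.mem_sup_right (AddSubgroup.mem_zmultiples _))
            (AddSubgroup.mem_sup_left htt)
        · refine sup_le le_sup_left ?_
          rw [AddSubgroup.zmultiples_le]
          have : v + (t' : A) = (v + t) + (-t + t') := by abel
          rw [this]
          exact add_mem (AddSubgroup.mem_sup_right (AddSubgroup.mem_zmultiples _))
            (AddSubgroup.mem_sup_left htt))
  have hφ : Function.Bijective φ := by
    constructor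
    · intro a b
      refine Quotient.inductionOn₂' a b fun t t' h => ?_
      have h' : L' ⊔ AddSubgroup.zmultiples (v + (t : A)) =
        L' ⊔ AddSubgroup.zmultiples (v + (t' : A)) := congrArg Subtype.val h
      apply Quotient.sound'
      rw [QuotientAddGroup.leftRel_apply, AddSubgroup.mem_addSubgroupOf]
      simp only [AddSubgroup.coe_add, AddSubgroup.coe_neg]
      rw [← hsup t']
      refine AddSubgroup.mem_inf.2 ⟨?_, ?_⟩
      · have : -(t : A) + t' = (v + t') - (v + t) := by abel
        rw [this]
        refine sub_mem (AddSubgroup.mem_sup_right (AddSubgroup.mem_zmultiples _)) ?_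
        rw [← h']
        exact AddSubgroup.mem_sup_right (AddSubgroup.mem_zmultiples _)
      · exact add_mem (neg_mem t.2.1) t'.2.1
    · rintro ⟨L, hL1, hL2, hL3⟩
      obtain ⟨x, hx1, hx⟩ := SetLike.not_le_iff_exists.1 hL3
      obtain ⟨k, hk⟩ := Φ.exists_sub_zsmul_mem hp (hL1 hx1) hx hv
      have hpx : p • x ∈ L' := by
        rw [← hL2]
        exact AddSubgroup.mem_inf.2 ⟨nsmul_mem hx1 p, Φ.nsmul_mem_succ hn (hL1 hx1)⟩
      have htT : -(v - k • x) ∈ T := by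
        refine AddSubgroup.mem_inf.2 ⟨neg_mem hk, ?_⟩
        change p • -(v - k • x) ∈ L'
        have : p • -(v - k • x) = k • (p • x) - p • v := by
          rw [smul_comm k p x, neg_sub, nsmul_sub]
        rw [this]
        exact sub_mem (zsmul_mem hpx k) hxL
      refine ⟨Quotient.mk'' ⟨_, htT⟩, ?_⟩
      apply Subtype.ext
      change L' ⊔ AddSubgroup.zmultiples (v + -(v - k • x)) = L
      have hw := hvT ⟨_, htT⟩
      have e : v + -(v - k • x) = k • x := by abel
      simp only [e] at hw ⊢
      apply le_antisymm
      · refine sup_le (hL2 ▸ inf_le_left) ?_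
        rw [AddSubgroup.zmultiples_le]
        exact zsmul_mem hx1 k
      · intro z hz
        obtain ⟨c, hc⟩ := Φ.exists_sub_zsmul_mem hp hw.1 hw.2.1 (hL1 hz)
        refine mem_of_sub_zsmul (AddSubgroup.mem_sup_right (AddSubgroup.mem_zmultiples _))
          (AddSubgroup.mem_sup_left (?_ : z - c • k • x ∈ L'))
        rw [← hL2]
        exact AddSubgroup.mem_inf.2 ⟨sub_mem hz (zsmul_mem (zsmul_mem hx1 k) c), hc⟩
  rw [← Nat.card_congr (Equiv.ofBijective φ hφ)]
  rfl

/-- The number of extensions in `card_extensions` in terms of the gaps: multiplication by `p`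
carries `F (m + 1) ∩ p⁻¹ L'` onto `F (m + 1 + n) ∩ L'`, so the relative index is `p` to the number
of gaps of `L'` in the window from `m + 1` to `m + n`. -/
lemma relIndex_extensions (hp : p.Prime) {m k : ℕ} {L' : AddSubgroup A}
    (hL' : L' ≤ Φ.F (m + 1)) (hk : Φ.F k ≤ L') {G : Finset ℕ}
    (hG : ∀ h, m + 1 ≤ h → (h ∈ Φ.jumps L' ↔ h ∉ G)) :
    L'.relIndex (Φ.F (m + 1) ⊓ L'.comap (nsmulAddMonoidHom p)) =
      p ^ (G.filter fun h => m + 1 ≤ h ∧ h ≤ m + n).card := by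
  set T := Φ.F (m + 1) ⊓ L'.comap (nsmulAddMonoidHom p) with hT
  have hLT : L' ≤ T := le_inf hL' fun x hx => nsmul_mem hx p
  have h1 := AddSubgroup.relIndex_mul_relIndex L' T _ hLT inf_le_left
  have h2 : T.relIndex (Φ.F (m + 1)) = L'.relIndex (Φ.F (m + 1 + n)) := by
    rw [← AddSubgroup.relIndex_map_map_of_injective T _ Φ.nsmul_injective, ← Φ.period,
      ← AddSubgroup.inf_relIndex_right L']
    congr 1
    rw [Φ.period]
    ext y
    constructor
    · rintro ⟨x, ⟨hx1, hx2⟩, rfl⟩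
      exact ⟨hx2, x, hx1, rfl⟩
    · rintro ⟨h, ⟨x, hx, rfl⟩⟩
      exact ⟨x, ⟨hx, h⟩, rfl⟩
  rw [h2, Φ.relIndex_eq_pow hp hk (m := m + 1 + n) fun h hh => hG h (by omega),
    Φ.relIndex_eq_pow hp hk hG] at h1
  have h3 : (G.filter (m + 1 ≤ ·)).card = (G.filter fun h => m + 1 ≤ h ∧ h ≤ m + n).card +
      (G.filter (m + 1 + n ≤ ·)).card := by
    rw [← Finset.card_union_of_disjoint]
    · congr 1
      ext x
      simp only [Finset.mem_filter, Finset.mem_union]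
      constructor
      · rintro ⟨h, h'⟩
        by_cases x ≤ m + n
        · exact Or.inl ⟨h, h', by assumption⟩
        · exact Or.inr ⟨h, by omega⟩
      · rintro (⟨h, h', -⟩ | ⟨h, h'⟩)
        · exact ⟨h, h'⟩
        · exact ⟨h, by omega⟩
    · rw [Finset.disjoint_filter]
      intro x _ h
      omega
  rw [h3, pow_add] at h1
  exact Nat.eq_of_mul_eq_mul_right (pow_pos hp.pos _) h1

/-- The subgroups of `F m` containing some `F k` whose set of gaps above `m` is `G`. -/
abbrev WithGaps (m : ℕ) (G : Finset ℕ) : Type _ :=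
  {L : AddSubgroup A // L ≤ Φ.F m ∧ (∃ k, Φ.F k ≤ L) ∧ ∀ h, m ≤ h → (h ∈ Φ.jumps L ↔ h ∉ G)}

end PeriodicFlag

/-- If all fibres of a map have the same cardinality, the cardinality of the source is the
product. -/
lemma Nat.card_eq_mul_of_fiber {X Y : Type*} (f : X → Y) (c : ℕ) (hc : c ≠ 0)
    (h : ∀ y, Nat.card {x // f x = y} = c) : Nat.card X = Nat.card Y * c := by
  have hfin : ∀ y, Finite {x // f x = y} := fun y =>
    (Nat.card_ne_zero.1 (by rw [h]; exact hc)).2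
  have e : ∀ y, {x // f x = y} ≃ Fin c := fun y =>
    Classical.choice (Finite.card_eq.1 (by rw [h, Nat.card_fin]))
  rw [← Nat.card_congr (Equiv.sigmaFiberEquiv f),
    Nat.card_congr (Equiv.sigmaCongrRight e), Nat.card_congr (Equiv.sigmaEquivProd _ _),
    Nat.card_prod, Nat.card_fin]

namespace PeriodicFlag

variable {A : Type*} [AddCommGroup A] {p n : ℕ} (Φ : PeriodicFlag A p n)

lemma card_withGaps_empty (hp : p.Prime) (m : ℕ) : Nat.card (Φ.WithGaps m ∅) = 1 := by
  rw [Nat.card_eq_one_iff_unique]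
  refine ⟨⟨?_⟩, ⟨⟨Φ.F m, le_rfl, ⟨m, le_rfl⟩, fun h hh => ?_⟩⟩⟩
  · have key : ∀ L : Φ.WithGaps m ∅, L.1 = Φ.F m := by
      rintro ⟨L, hL, ⟨k, hk⟩, hG⟩
      refine le_antisymm hL ?_
      rw [← AddSubgroup.relIndex_eq_one, Φ.relIndex_eq_pow hp hk hG]
      simp
    exact fun a b => Subtype.ext ((key a).trans (key b).symm)
  · simpa using Φ.mem_jumps_of_le hp le_rfl hh

lemma gapExponent_erase {m : ℕ} {G : Finset ℕ} (hm : m ∈ G) :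
    gapExponent n m G = gapExponent n (m + 1) (G.erase m) := by
  unfold gapExponent
  rw [← Finset.add_sum_erase _ _ hm]
  simp only [Finset.Ico_self, Finset.filter_empty, Finset.card_empty, zero_add]
  refine Finset.sum_congr rfl fun h hh => ?_
  congr 1
  ext g
  simp only [Finset.mem_filter, Finset.mem_Ico, Finset.mem_erase]
  constructor
  · rintro ⟨⟨h1, h2⟩, h3, h4⟩
    have : g ≠ m := fun h => h3 (h ▸ hm)
    exact ⟨⟨by omega, h2⟩, fun h => h3 h.2, h4⟩
  · rintro ⟨⟨h1, h2⟩, h3, h4⟩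
    exact ⟨⟨by omega, h2⟩, fun h => h3 ⟨by omega, h⟩, h4⟩

lemma gapExponent_of_notMem {m : ℕ} {G : Finset ℕ} (hm : m ∉ G) (hG : ∀ h ∈ G, m ≤ h) :
    gapExponent n m G = gapExponent n (m + 1) G +
      (G.filter fun h => m + 1 ≤ h ∧ h < m + n).card := by
  unfold gapExponent
  rw [Finset.card_filter, ← Finset.sum_add_distrib]
  refine Finset.sum_congr rfl fun h hh => ?_
  have h1 : m + 1 ≤ h := by
    have := hG h hh
    have : h ≠ m := fun e => hm (e ▸ hh)
    omega
  rw [← Finset.insert_Ico_add_one_left_eq_Ico (show m < h by omega), Finset.filter_insert]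
  simp only [hm, not_false_eq_true, true_and, h1]
  split_ifs with h2
  · rw [Finset.card_insert_of_notMem (by simp)]
  · rfl

/-- The number of lattices with a prescribed set of gaps. Induction on the length of the part of
the flag that the gaps occupy: if `m` is a gap, the lattice lies in `F (m + 1)`; otherwise
it is one of the extensions of its intersection with `F (m + 1)`. -/
theorem card_withGaps (hp : p.Prime) (hn : 0 < n) (N m : ℕ) (G : Finset ℕ)
    (hG : ∀ h ∈ G, m ≤ h ∧ h < m + N) (hper : ∀ h ∈ G, m + n ≤ h → h - n ∈ G) :
    Nat.card (Φ.WithGaps m G) = p ^ gapExponent n m G := by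
  induction N generalizing m G with
  | zero =>
    have : G = ∅ := Finset.eq_empty_of_forall_notMem fun h hh => by have := hG h hh; omega
    subst this
    rw [Φ.card_withGaps_empty hp]
    simp [gapExponent]
  | succ N ih =>
    by_cases hm : m ∈ G
    -- `m` is a gap: `L ≤ F m` means `L ≤ F (m + 1)`
    · have h1 := ih (m + 1) (G.erase m) (fun h hh => by
          rw [Finset.mem_erase] at hh
          have := hG h hh.2
          omega) (fun h hh hle => by
          rw [Finset.mem_erase] at hh ⊢
          exact ⟨by omega, hper h hh.2 (by omega)⟩)
      rw [gapExponent_erase hm, ← h1]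
      refine Nat.card_congr (Equiv.subtypeEquivRight fun L => ?_)
      constructor
      · rintro ⟨hL, hk, h⟩
        refine ⟨fun x hx => ?_, hk, fun i hi => ?_⟩
        · by_contra hx'
          exact (h m le_rfl).1 ⟨x, hx, hL hx, hx'⟩ hm
        · rw [h i (by omega), Finset.mem_erase]
          simp [show i ≠ m by omega]
      · rintro ⟨hL, hk, h⟩
        refine ⟨hL.trans (Φ.succ_le m), hk, fun i hi => ?_⟩
        rcases hi.eq_or_lt with rfl | hi
        · simp only [hm, not_true_eq_false, iff_false]
          rintro ⟨x, hx, -, hx'⟩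
          exact hx' (hL hx)
        · rw [h i hi, Finset.mem_erase]
          simp [show i ≠ m by omega]
    -- `m` is a jump: map `L` to `L ∩ F (m + 1)` and count the fibres
    · have hG' : ∀ h ∈ G, m + 1 ≤ h := fun h hh => by
        have := hG h hh
        have : h ≠ m := fun e => hm (e ▸ hh)
        omega
      have hmn : m + n ∉ G := fun h => hm (by simpa using hper _ h le_rfl)
      have h1 := ih (m + 1) G (fun h hh => by
          have := hG h hh
          have := hG' h hh
          omega) (fun h hh hle => hper h hh (by omega))
      have hj : ∀ (L L' : AddSubgroup A), L ⊓ Φ.F (m + 1) = L' → ∀ i, m + 1 ≤ i →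
          (i ∈ Φ.jumps L ↔ i ∈ Φ.jumps L') := by
        rintro L L' rfl i hi
        constructor
        · rintro ⟨x, hx, h, h'⟩
          exact ⟨x, ⟨hx, Φ.antitone hi h⟩, h, h'⟩
        · rintro ⟨x, hx, h, h'⟩
          exact ⟨x, hx.1, h, h'⟩
      let r : Φ.WithGaps m G → Φ.WithGaps (m + 1) G := fun L =>
        ⟨L.1 ⊓ Φ.F (m + 1), inf_le_right, by
          obtain ⟨k, hk⟩ := L.2.2.1
          exact ⟨max k (m + 1), le_inf ((Φ.antitone (le_max_left _ _)).trans hk)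
            (Φ.antitone (le_max_right _ _))⟩, fun i hi => by
          rw [← hj L.1 _ rfl i hi]
          exact L.2.2.2 i (by omega)⟩
      rw [gapExponent_of_notMem hm (fun h hh => (hG h hh).1), pow_add, ← h1]
      refine Nat.card_eq_mul_of_fiber r _ (pow_ne_zero _ hp.ne_zero) ?_
      rintro ⟨L', hL', ⟨k, hk⟩, hLG⟩
      have hjmn : m + n ∈ Φ.jumps L' := (hLG _ (by omega)).2 hmn
      have hfilt : (G.filter fun h => m + 1 ≤ h ∧ h < m + n) =
          G.filter fun h => m + 1 ≤ h ∧ h ≤ m + n := by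
        refine Finset.filter_congr fun x hx => ?_
        have : x ≠ m + n := fun e => hmn (e ▸ hx)
        omega
      rw [hfilt, ← Φ.relIndex_extensions hp hL' hk hLG, ← Φ.card_extensions hp hn hL' hjmn]
      refine Nat.card_congr ?_
      refine (Equiv.subtypeSubtypeEquivSubtypeExists _ _).trans
        (Equiv.subtypeEquivRight fun L => ?_)
      constructor
      · rintro ⟨⟨h1, h2, h3⟩, h4⟩
        refine ⟨h1, congrArg Subtype.val h4, fun h5 => ?_⟩
        obtain ⟨x, hx, -, hx'⟩ := (h3 m le_rfl).2 hm
        exact hx' (h5 hx)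
      · rintro ⟨h1, h2, h3⟩
        refine ⟨⟨h1, ⟨k, hk.trans (h2 ▸ inf_le_left)⟩, fun i hi => ?_⟩, Subtype.ext h2⟩
        rcases hi.eq_or_lt with rfl | hi
        · simp only [hm, not_false_eq_true, iff_true]
          obtain ⟨x, hx, hx'⟩ := SetLike.not_le_iff_exists.1 h3
          exact ⟨x, hx, h1 hx, hx'⟩
        · rw [hj L L' h2 i hi]
          exact hLG i hi

end PeriodicFlag

/-! ### The type of a lattice -/

/-- The set `{n b + i | i < n, b < a i}`. For every `a`, it is closed under subtraction of `n`
from its elements `≥ n`, and all finite sets with this property are of this form. -/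
def gapSet {n : ℕ} (a : Fin n → ℕ) : Finset ℕ :=
  (Finset.univ.sigma fun i => Finset.range (a i)).image fun x => n * x.2 + x.1

lemma mul_add_fin_inj {n b b' : ℕ} {i i' : Fin n} (h : n * b + i = n * b' + i') :
    b = b' ∧ i = i' := by
  have hn : 0 < n := i.pos
  have h1 := congrArg (· / n) h
  have h2 := congrArg (· % n) h
  simp only [Nat.mul_add_mod, Nat.mod_eq_of_lt i.2, Nat.mod_eq_of_lt i'.2, Nat.mul_add_div hn,
    Nat.div_eq_of_lt i.2, Nat.div_eq_of_lt i'.2, add_zero] at h1 h2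
  exact ⟨h1, Fin.ext h2⟩

lemma exists_eq_mul_add_fin {n : ℕ} (hn : 0 < n) (h : ℕ) :
    ∃ (b : ℕ) (i : Fin n), h = n * b + i :=
  ⟨h / n, ⟨h % n, Nat.mod_lt _ hn⟩, (Nat.div_add_mod h n).symm⟩

@[simp]
lemma mem_gapSet {n : ℕ} (a : Fin n → ℕ) (b : ℕ) (i : Fin n) :
    n * b + i ∈ gapSet a ↔ b < a i := by
  unfold gapSet
  simp only [Finset.mem_image, Finset.mem_sigma, Finset.mem_univ, true_and, Finset.mem_range,
    Sigma.exists]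
  constructor
  · rintro ⟨i', b', h, e⟩
    obtain ⟨rfl, rfl⟩ := mul_add_fin_inj e
    exact h
  · exact fun h => ⟨i, b, h, rfl⟩

lemma sum_gapSet {n : ℕ} (a : Fin n → ℕ) {M : Type*} [AddCommMonoid M] (g : ℕ → M) :
    ∑ h ∈ gapSet a, g h = ∑ i, ∑ b ∈ Finset.range (a i), g (n * b + i) := by
  unfold gapSet
  rw [Finset.sum_image, Finset.sum_sigma]
  rintro ⟨i, b⟩ - ⟨i', b'⟩ - e
  obtain ⟨rfl, rfl⟩ := mul_add_fin_inj (i := i) (i' := i') e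
  rfl

lemma card_gapSet {n : ℕ} (a : Fin n → ℕ) : (gapSet a).card = ∑ i, a i := by
  rw [Finset.card_eq_sum_ones, sum_gapSet]
  simp

/-- For a gap `h = n b + j`, each residue class `i` contains at most one `g` with
`g < h < g + n`, namely `n b + i` if `i < j` and `n (b - 1) + i` if `j < i`. -/
lemma card_window {n : ℕ} (a : Fin n → ℕ) {b : ℕ} {j : Fin n} (hb : b < a j) :
    ((Finset.Ico 0 (n * b + j)).filter fun g => g ∉ gapSet a ∧ n * b + j < g + n).card =
      ∑ i, if a i + (if j < i then 1 else 0) ≤ b then 1 else 0 := by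
  have hn : 0 < n := j.pos
  rw [← Finset.card_filter]
  refine Finset.card_bij' (fun g _ => ⟨g % n, Nat.mod_lt _ hn⟩)
    (fun i _ => n * (b - if j < i then 1 else 0) + i) ?_ ?_ ?_ ?_
  · intro g hg
    obtain ⟨c, i, rfl⟩ := exists_eq_mul_add_fin hn g
    simp only [Finset.mem_filter, Finset.mem_Ico, mem_gapSet, Nat.mul_add_mod,
      Nat.mod_eq_of_lt i.2, Finset.mem_univ, true_and, Fin.eta] at hg ⊢
    have h1 : c ≤ b := by
      by_contra h
      have := Nat.mul_le_mul_left n (show b + 1 ≤ c by omega)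
      rw [mul_add] at this
      omega
    have h2 : b ≤ c + 1 := by
      by_contra h
      have := Nat.mul_le_mul_left n (show c + 2 ≤ b by omega)
      rw [mul_add] at this
      omega
    rcases h1.eq_or_lt with rfl | h1
    · have : ¬ j < i := by rw [Fin.lt_def]; omega
      rw [if_neg this]
      omega
    · split_ifs <;> omega
  · intro i hi
    simp only [Finset.mem_filter, Finset.mem_univ, true_and, Finset.mem_Ico, mem_gapSet] at hi ⊢
    have hij : i ≠ j := by
      rintro rfl
      simp at hi
      omega
    have hij' : (i : ℕ) ≠ j := fun h => hij (Fin.ext h)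
    split_ifs at hi ⊢ with h
    · obtain ⟨c, rfl⟩ : ∃ c, b = c + 1 := ⟨b - 1, by omega⟩
      rw [Fin.lt_def] at h
      rw [Nat.add_sub_cancel, mul_add]
      omega
    · rw [Fin.lt_def] at h
      simp only [Nat.sub_zero]
      omega
  · intro g hg
    obtain ⟨c, i, rfl⟩ := exists_eq_mul_add_fin hn g
    simp only [Finset.mem_filter, Finset.mem_Ico, mem_gapSet, Nat.mul_add_mod,
      Nat.mod_eq_of_lt i.2, Fin.eta] at hg ⊢
    have h1 : c ≤ b := by
      by_contra h
      have := Nat.mul_le_mul_left n (show b + 1 ≤ c by omega)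
      rw [mul_add] at this
      omega
    have h2 : b ≤ c + 1 := by
      by_contra h
      have := Nat.mul_le_mul_left n (show c + 2 ≤ b by omega)
      rw [mul_add] at this
      omega
    rcases h1.eq_or_lt with rfl | h1
    · have : ¬ j < i := by rw [Fin.lt_def]; omega
      rw [if_neg this, Nat.sub_zero]
    · obtain rfl : b = c + 1 := by omega
      rw [mul_add] at hg
      have : j < i := by rw [Fin.lt_def]; omega
      rw [if_pos this, Nat.add_sub_cancel]
  · intro i hi
    simp [Nat.mod_eq_of_lt i.2]

lemma sum_range_ite_le (x y : ℕ) : (∑ b ∈ Finset.range y, if x ≤ b then 1 else 0) = y - x := by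
  induction y with
  | zero => simp
  | succ y ih =>
    rw [Finset.sum_range_succ, ih]
    split_ifs <;> omega

lemma gapExponent_gapSet {n : ℕ} (a : Fin n → ℕ) :
    gapExponent n 0 (gapSet a) = ∑ j, ∑ i, (a j - (a i + if j < i then 1 else 0)) := by
  unfold gapExponent
  rw [sum_gapSet]
  refine Finset.sum_congr rfl fun j _ => ?_
  rw [Finset.sum_congr rfl fun b hb => card_window a (Finset.mem_range.1 hb), Finset.sum_comm]
  exact Finset.sum_congr rfl fun i _ => sum_range_ite_le _ _

/-- For each of the `n` values `a j`, at most `n - 1` residue classes contribute at most `a j`. -/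
lemma gapExponent_gapSet_le {n : ℕ} (a : Fin n → ℕ) :
    gapExponent n 0 (gapSet a) ≤ (n - 1) * ∑ i, a i := by
  rw [gapExponent_gapSet, Finset.mul_sum]
  refine Finset.sum_le_sum fun j _ => ?_
  rw [← Finset.sum_erase _ (a := j) (by simp)]
  refine (Finset.sum_le_card_nsmul _ _ (a j) fun i _ => Nat.sub_le _ _).trans ?_
  simp

namespace PeriodicFlag

variable {A : Type*} [AddCommGroup A] {p n : ℕ} (Φ : PeriodicFlag A p n)

/-- The jumps are closed under adding `n`, since `L` is closed under multiplication by `p`. -/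
lemma add_mem_jumps {L : AddSubgroup A} {m : ℕ} (h : m ∈ Φ.jumps L) : m + n ∈ Φ.jumps L := by
  obtain ⟨x, hxL, hx, hx'⟩ := h
  refine ⟨p • x, _root_.nsmul_mem hxL p, ?_, ?_⟩
  · rw [Φ.period]
    exact ⟨x, hx, rfl⟩
  · rw [show m + n + 1 = m + 1 + n by omega, Φ.period]
    rintro ⟨y, hy, e⟩
    exact hx' (Φ.nsmul_injective e ▸ hy)

lemma finiteIndex_iff (hp : p.Prime) {L : AddSubgroup A} : L.FiniteIndex ↔ ∃ k, Φ.F k ≤ L := by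
  refine ⟨Φ.cofinal L, fun ⟨k, hk⟩ => ?_⟩
  have h := Φ.relIndex_ne_zero hp 0 k
  rw [zero_add, Φ.zero, AddSubgroup.relIndex_top_right] at h
  have : (Φ.F k).FiniteIndex := ⟨h⟩
  exact AddSubgroup.finiteIndex_of_le hk

/-- The type of `L`: for each residue class `i` modulo `n`, the least `b` such that `n b + i` is a
jump of `L`. -/
noncomputable def latticeType (L : AddSubgroup A) (i : Fin n) : ℕ :=
  sInf {b | n * b + i ∈ Φ.jumps L}

lemma mem_jumps_iff (hp : p.Prime) {L : AddSubgroup A} (hL : L.FiniteIndex) (b : ℕ) (i : Fin n) :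
    n * b + i ∈ Φ.jumps L ↔ Φ.latticeType L i ≤ b := by
  constructor
  · exact fun h => Nat.sInf_le h
  · intro h
    obtain ⟨k, hk⟩ := (Φ.finiteIndex_iff hp).1 hL
    have hne : {b | n * b + i ∈ Φ.jumps L}.Nonempty :=
      ⟨k, Φ.mem_jumps_of_le hp hk (by nlinarith [i.pos])⟩
    induction b, h using Nat.le_induction with
    | base => exact Nat.sInf_mem hne
    | succ b _ ih => exact (by ring : n * b + i + n = n * (b + 1) + i) ▸ Φ.add_mem_jumps ih

lemma mem_jumps_iff_notMem (hp : p.Prime) (hn : 0 < n) {L : AddSubgroup A} (hL : L.FiniteIndex)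
    (h : ℕ) : h ∈ Φ.jumps L ↔ h ∉ gapSet (Φ.latticeType L) := by
  obtain ⟨b, i, rfl⟩ := exists_eq_mul_add_fin hn h
  rw [Φ.mem_jumps_iff hp hL, mem_gapSet, not_lt]

lemma latticeType_eq_iff (hp : p.Prime) (hn : 0 < n) {L : AddSubgroup A} (hL : L.FiniteIndex)
    (a : Fin n → ℕ) :
    Φ.latticeType L = a ↔ ∀ h, h ∈ Φ.jumps L ↔ h ∉ gapSet a := by
  constructor
  · rintro rfl
    exact Φ.mem_jumps_iff_notMem hp hn hL
  · intro h
    funext i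
    refine eq_of_forall_ge_iff fun b => ?_
    rw [← Φ.mem_jumps_iff hp hL, h, mem_gapSet, not_lt]

/-- The number of lattices of a given type. -/
theorem card_latticeType_fiber (hp : p.Prime) (hn : 0 < n) (a : Fin n → ℕ) :
    Nat.card {L : {L : AddSubgroup A // L.FiniteIndex} // Φ.latticeType L.1 = a} =
      p ^ gapExponent n 0 (gapSet a) := by
  rw [← Φ.card_withGaps hp hn ((gapSet a).sup id + 1) 0 (gapSet a)]
  · refine Nat.card_congr ?_
    refine (Equiv.subtypeSubtypeEquivSubtypeInter _ (fun L => Φ.latticeType L = a)).trans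
      (Equiv.subtypeEquivRight fun L => ?_)
    constructor
    · rintro ⟨hL, h⟩
      exact ⟨by simp [Φ.zero], Φ.cofinal L hL, fun i _ =>
        (Φ.latticeType_eq_iff hp hn hL a).1 h i⟩
    · rintro ⟨-, h, h'⟩
      have hL := (Φ.finiteIndex_iff hp).2 h
      exact ⟨hL, (Φ.latticeType_eq_iff hp hn hL a).2 fun i => h' i (Nat.zero_le _)⟩
  · intro h hh
    have : h ≤ (gapSet a).sup id := Finset.le_sup (f := id) hh
    omega
  · intro h hh hle
    obtain ⟨b, i, rfl⟩ := exists_eq_mul_add_fin hn h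
    rw [mem_gapSet] at hh
    have hb : b ≠ 0 := by
      rintro rfl
      have := i.2
      omega
    obtain ⟨c, rfl⟩ := Nat.exists_eq_succ_of_ne_zero hb
    have : n * (c + 1) + i - n = n * c + i := by rw [mul_add]; omega
    rw [Nat.succ_eq_add_one, this, mem_gapSet]
    omega

lemma index_eq_pow (hp : p.Prime) (hn : 0 < n) {L : AddSubgroup A} (hL : L.FiniteIndex) :
    L.index = p ^ ∑ i, Φ.latticeType L i := by
  obtain ⟨k, hk⟩ := Φ.cofinal L hL
  have := Φ.relIndex_eq_pow hp hk (m := 0) fun h _ => Φ.mem_jumps_iff_notMem hp hn hL h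
  rw [Φ.zero, AddSubgroup.relIndex_top_right] at this
  rw [this, ← card_gapSet]
  simp

/-- `L` contains `F m` exactly when all its gaps are smaller than `m`. -/
lemma F_le_iff (hp : p.Prime) (hn : 0 < n) {L : AddSubgroup A} (hL : L.FiniteIndex) (m : ℕ) :
    Φ.F m ≤ L ↔ ∀ h ∈ gapSet (Φ.latticeType L), h < m := by
  obtain ⟨k, hk⟩ := Φ.cofinal L hL
  rw [← AddSubgroup.relIndex_eq_one,
    Φ.relIndex_eq_pow hp hk (m := m) fun h _ => Φ.mem_jumps_iff_notMem hp hn hL h,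
    Nat.pow_eq_one, or_iff_right hp.one_lt.ne', Finset.card_eq_zero, Finset.filter_eq_empty_iff]
  simp

/-- `L` is contained in `F m` exactly when all numbers smaller than `m` are gaps. -/
lemma le_F_iff (hp : p.Prime) (hn : 0 < n) {L : AddSubgroup A} (hL : L.FiniteIndex) (m : ℕ) :
    L ≤ Φ.F m ↔ ∀ h < m, h ∈ gapSet (Φ.latticeType L) := by
  have h0 : ∀ h, h ∈ gapSet (Φ.latticeType L) ↔ h ∉ Φ.jumps L := fun h => by
    rw [Φ.mem_jumps_iff_notMem hp hn hL, not_not]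
  simp only [h0]
  induction m with
  | zero => simp [Φ.zero]
  | succ m ih =>
    constructor
    · rintro hle h hh ⟨x, hx, -, hx'⟩
      exact hx' (Φ.antitone hh (hle hx))
    · intro h x hx
      by_contra hx'
      exact h m (by omega) ⟨x, hx, ih.2 (fun i hi => h i (by omega)) hx, hx'⟩

end PeriodicFlag

/-! ### Inversions and the Coxeter length -/

/-- The inversions of `w`: the pairs of positions `x < y` with `w y < w x`. -/
def inversions {n : ℕ} (w : Perm (Fin n)) : Finset (Fin n × Fin n) :=
  {x | x.1 < x.2 ∧ w x.2 < w x.1}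

lemma mem_inversions {n : ℕ} {w : Perm (Fin n)} {x : Fin n × Fin n} :
    x ∈ inversions w ↔ x.1 < x.2 ∧ w x.2 < w x.1 := by
  simp [inversions]

section SimpleTransposition

variable {n : ℕ} (i : Fin (n - 1))

/-- The position `i`, the first of the two that the `i`-th simple transposition exchanges. -/
def leftPos : Fin n := ⟨i, by omega⟩

/-- The position `i + 1`, the second of the two that the `i`-th simple transposition exchanges. -/
def rightPos : Fin n := ⟨i + 1, by omega⟩

lemma simpleTransposition_eq : simpleTransposition n i = Equiv.swap (leftPos i) (rightPos i) := rfl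

lemma leftPos_lt_rightPos : leftPos i < rightPos i := by
  simp [leftPos, rightPos, Fin.lt_def]

@[simp]
lemma simpleTransposition_leftPos : simpleTransposition n i (leftPos i) = rightPos i :=
  Equiv.swap_apply_left _ _

@[simp]
lemma simpleTransposition_rightPos : simpleTransposition n i (rightPos i) = leftPos i :=
  Equiv.swap_apply_right _ _

@[simp]
lemma simpleTransposition_mul_self : simpleTransposition n i * simpleTransposition n i = 1 :=
  Equiv.swap_mul_self _ _

lemma simpleTransposition_lt {x y : Fin n} (hxy : x < y) (h : (x, y) ≠ (leftPos i, rightPos i)) :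
    simpleTransposition n i x < simpleTransposition n i y := by
  have hl : (leftPos i : ℕ) = i := rfl
  have hr : (rightPos i : ℕ) = i + 1 := rfl
  rw [Ne, Prod.ext_iff] at h
  simp only [simpleTransposition_eq, Equiv.swap_apply_def, Fin.ext_iff, Fin.lt_def, hl, hr]
    at hxy h ⊢
  split_ifs <;> omega

/-- Relabelling positions by `s_i` maps the inversions of `w` other than `(i, i + 1)` injectively to
those of `w s_i`. -/
lemma card_inversions_erase_le (w : Perm (Fin n)) :
    ((inversions w).erase (leftPos i, rightPos i)).card ≤
      ((inversions (w * simpleTransposition n i)).erase (leftPos i, rightPos i)).card := by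
  refine Finset.card_le_card_of_injOn
    (fun x => (simpleTransposition n i x.1, simpleTransposition n i x.2)) ?_ ?_
  · rintro ⟨x, y⟩ h
    rw [Finset.mem_coe, Finset.mem_erase, mem_inversions] at h ⊢
    obtain ⟨h1, h2, h3⟩ := h
    refine ⟨?_, simpleTransposition_lt i h2 h1, ?_⟩
    · intro e
      rw [Prod.ext_iff] at e
      have e1 := congrArg (simpleTransposition n i) e.1
      have e2 := congrArg (simpleTransposition n i) e.2
      simp only [← Perm.mul_apply, simpleTransposition_mul_self, Perm.one_apply] at e1 e2
      simp only [simpleTransposition_leftPos, simpleTransposition_rightPos] at e1 e2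
      simp only [e1, e2] at h2
      exact lt_asymm h2 (leftPos_lt_rightPos i)
    · simpa [← Perm.mul_apply, mul_assoc] using h3
  · rintro ⟨x, y⟩ - ⟨x', y'⟩ - h
    simpa using h

lemma card_inversions_erase (w : Perm (Fin n)) :
    ((inversions (w * simpleTransposition n i)).erase (leftPos i, rightPos i)).card =
      ((inversions w).erase (leftPos i, rightPos i)).card := by
  refine le_antisymm ?_ (card_inversions_erase_le i w)
  simpa [mul_assoc] using card_inversions_erase_le i (w * simpleTransposition n i)

lemma card_inversions_mul_of_lt {w : Perm (Fin n)} (h : w (leftPos i) < w (rightPos i)) :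
    (inversions (w * simpleTransposition n i)).card = (inversions w).card + 1 := by
  have h1 : (leftPos i, rightPos i) ∈ inversions (w * simpleTransposition n i) := by
    simpa [mem_inversions, leftPos_lt_rightPos i] using h
  have h2 : (leftPos i, rightPos i) ∉ inversions w := by
    simp [mem_inversions, h.le]
  rw [← Finset.card_erase_add_one h1, card_inversions_erase, Finset.erase_eq_of_notMem h2]

lemma card_inversions_mul_of_gt {w : Perm (Fin n)} (h : w (rightPos i) < w (leftPos i)) :
    (inversions (w * simpleTransposition n i)).card + 1 = (inversions w).card := by
  have := card_inversions_mul_of_lt i (w := w * simpleTransposition n i) (by simpa using h)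
  rw [← this, mul_assoc, simpleTransposition_mul_self, mul_one]

end SimpleTransposition

lemma card_inversions_mul_le {n : ℕ} (w : Perm (Fin n)) (i : Fin (n - 1)) :
    (inversions (w * simpleTransposition n i)).card ≤ (inversions w).card + 1 := by
  rcases lt_trichotomy (w (leftPos i)) (w (rightPos i)) with h | h | h
  · exact (card_inversions_mul_of_lt i h).le
  · exact absurd (w.injective h) (leftPos_lt_rightPos i).ne
  · have := card_inversions_mul_of_gt i h
    omega

lemma strictMono_of_leftPos_lt_rightPos {n : ℕ} {w : Fin n → Fin n}
    (h : ∀ i, w (leftPos i) < w (rightPos i)) : StrictMono w := by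
  cases n with
  | zero => exact fun x => x.elim0
  | succ n => exact Fin.strictMono_iff_lt_succ.2 h

lemma eq_one_of_strictMono {n : ℕ} {w : Perm (Fin n)} (h : StrictMono w) : w = 1 := by
  have := Subsingleton.elim (h.orderIsoOfSurjective _ w.surjective) (OrderIso.refl (Fin n))
  ext x
  exact congrArg Fin.val (congrArg (fun e : Fin n ≃o Fin n => e x) this)

@[simp]
lemma inversions_one {n : ℕ} : inversions (1 : Perm (Fin n)) = ∅ := by
  ext x
  simp only [mem_inversions, Perm.one_apply, Finset.notMem_empty, iff_false, not_and, not_lt]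
  exact fun h => h.le

/-- Bubble sort: `w` is a product of as many simple transpositions as it has inversions. -/
lemma exists_word {n : ℕ} (w : Perm (Fin n)) : ∃ ω : List (Fin (n - 1)),
    ω.length = (inversions w).card ∧ (ω.map (simpleTransposition n)).prod = w := by
  induction hk : (inversions w).card generalizing w with
  | zero =>
    refine ⟨[], rfl, ?_⟩
    rw [List.map_nil, List.prod_nil, eq_comm]
    refine eq_one_of_strictMono (strictMono_of_leftPos_lt_rightPos fun i => ?_)
    by_contra h
    rw [not_lt] at h
    have hlt := leftPos_lt_rightPos i
    have : (leftPos i, rightPos i) ∈ inversions w :=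
      mem_inversions.2 ⟨hlt, h.lt_of_ne fun e => hlt.ne' (w.injective e)⟩
    rw [Finset.card_eq_zero] at hk
    simp [hk] at this
  | succ k ih =>
    obtain ⟨i, hi⟩ : ∃ i, w (rightPos i) < w (leftPos i) := by
      by_contra! h
      have : w = 1 := eq_one_of_strictMono (strictMono_of_leftPos_lt_rightPos fun i =>
        (h i).lt_of_ne fun e => (leftPos_lt_rightPos i).ne (w.injective e))
      simp [this] at hk
    have h1 := card_inversions_mul_of_gt i hi
    obtain ⟨ω, h2, h3⟩ := ih (w * simpleTransposition n i) (by omega)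
    refine ⟨ω ++ [i], by simp [h2], ?_⟩
    simp [h3, mul_assoc]

/-- The Coxeter length is the number of inversions: bubble sort gives `≤`, and `≥` holds because a
simple transposition changes the number of inversions by one. -/
theorem coxeterLength_eq_card_inversions {n : ℕ} (w : Perm (Fin n)) :
    coxeterLength w = (inversions w).card := by
  apply le_antisymm
  · exact Nat.sInf_le (exists_word w)
  · refine le_csInf ⟨_, exists_word w⟩ ?_
    rintro k ⟨ω, rfl, rfl⟩
    induction ω using List.reverseRecOn with
    | nil => simp
    | append_singleton ω i ih =>
      rw [List.map_append, List.prod_append, List.map_singleton, List.prod_singleton,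
        List.length_append, List.length_singleton]
      exact (card_inversions_mul_le _ i).trans (by omega)

lemma mem_descentSet {n : ℕ} {w : Perm (Fin n)} {i : Fin (n - 1)} :
    i ∈ descentSet w ↔ w (rightPos i) < w (leftPos i) := by
  simp only [descentSet, Finset.mem_filter, Finset.mem_univ, true_and,
    coxeterLength_eq_card_inversions]
  rcases lt_trichotomy (w (leftPos i)) (w (rightPos i)) with h | h | h
  · simp [card_inversions_mul_of_lt i h, h.le]
  · exact absurd (w.injective h) (leftPos_lt_rightPos i).ne
  · simp only [h, iff_true]
    have := card_inversions_mul_of_gt i h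
    omega

lemma apply_last_of_mem_parabolicSubgroup {n : ℕ} (hn : 0 < n) {v : Perm (Fin n)}
    (hv : v ∈ parabolicSubgroup (initialIndices n)) :
    v ⟨n - 1, by omega⟩ = ⟨n - 1, by omega⟩ := by
  induction hv using Subgroup.closure_induction with
  | mem x hx =>
    obtain ⟨i, hi, rfl⟩ := hx
    have hi : (i : ℕ) + 1 ≤ n - 2 := hi
    apply Equiv.swap_apply_of_ne_of_ne <;> simp only [Ne, Fin.mk.injEq] <;> omega
  | one => rfl
  | mul x y _ _ hx hy => rw [Perm.mul_apply, hy, hx]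
  | inv x _ hx => rw [Perm.inv_eq_iff_eq, hx]

/-- Every letter larger than the last one forms an inversion with it. -/
lemma sub_le_card_inversions {n : ℕ} (hn : 0 < n) (u : Perm (Fin n)) :
    n - 1 - u ⟨n - 1, by omega⟩ ≤ (inversions u).card := by
  have h : (Finset.Ioi (u ⟨n - 1, by omega⟩)).card = n - 1 - u ⟨n - 1, by omega⟩ := by
    rw [Fin.card_Ioi]
  rw [← h]
  refine Finset.card_le_card_of_injOn (fun y => (u⁻¹ y, ⟨n - 1, by omega⟩)) ?_ ?_
  · intro y hy
    rw [Finset.mem_coe, Finset.mem_Ioi] at hy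
    rw [Finset.mem_coe, mem_inversions]
    refine ⟨?_, by simpa using hy⟩
    rw [Fin.lt_def]
    have h1 : u⁻¹ y ≠ ⟨n - 1, by omega⟩ := fun e => by
      rw [← e] at hy
      simp at hy
    have h2 := (u⁻¹ y).2
    have h3 : ((u⁻¹ y : Fin n) : ℕ) ≠ n - 1 := fun e => h1 (Fin.ext e)
    simp only
    omega
  · intro y _ y' _ h
    simpa using h

/-- If `u` increases on the first `n - 1` positions, every inversion involves the last position. -/
lemma card_inversions_of_increasing {n : ℕ} (hn : 0 < n) {u : Perm (Fin n)}
    (hu : ∀ i ∈ initialIndices n, u (leftPos i) < u (rightPos i)) :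
    (inversions u).card = n - 1 - u ⟨n - 1, by omega⟩ := by
  refine le_antisymm ?_ (sub_le_card_inversions hn u)
  have hmono : ∀ k : ℕ, ∀ x : Fin n, ∀ hk : x + k + 1 < n,
      u x ≤ u ⟨x + k, by omega⟩ := by
    intro k
    induction k with
    | zero => intros; exact le_rfl
    | succ k ih =>
      intro x hk
      have h := hu ⟨x + k, by omega⟩ (by simp only [initialIndices, Set.mem_ofPred_eq]; omega)
      exact (ih x (by omega)).trans h.le
  have h : (Finset.Ioi (u ⟨n - 1, by omega⟩)).card = n - 1 - u ⟨n - 1, by omega⟩ := by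
    rw [Fin.card_Ioi]
  have hlast : ∀ x ∈ inversions u, x.2 = ⟨n - 1, by omega⟩ := by
    rintro ⟨x, y⟩ hxy
    rw [mem_inversions] at hxy
    obtain ⟨h1, h2⟩ : x < y ∧ u y < u x := hxy
    by_contra hy
    have hy' : (y : ℕ) ≠ n - 1 := fun e => hy (Fin.ext e)
    have := y.2
    rw [Fin.lt_def] at h1
    have h3 := hmono (y - x) x (by omega)
    have h4 : (⟨x + (y - x), by omega⟩ : Fin n) = y := Fin.ext (by simp; omega)
    rw [h4] at h3
    exact absurd h2 (not_lt.2 h3)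
  rw [← h]
  refine Finset.card_le_card_of_injOn (fun x => u x.1) ?_ ?_
  · intro x hx
    rw [Finset.mem_coe, Finset.mem_Ioi, ← hlast x hx]
    exact (mem_inversions.1 hx).2
  · intro x hx y hy hxy
    exact Prod.ext (u.injective hxy) ((hlast x hx).trans (hlast y hy).symm)

/-- The shortest element of the coset `w ⟨s_1, …, s_{n-2}⟩` is increasing on the first `n - 1`
positions and has the same last value as `w`. -/
theorem parabolicLength_initialIndices {n : ℕ} (hn : 0 < n) (w : Perm (Fin n)) :
    parabolicLength (initialIndices n) w = n - 1 - w ⟨n - 1, by omega⟩ := by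
  have hmul : ∀ v ∈ parabolicSubgroup (initialIndices n),
      (w * v) ⟨n - 1, by omega⟩ = w ⟨n - 1, by omega⟩ := fun v hv => by
    rw [Perm.mul_apply, apply_last_of_mem_parabolicSubgroup hn hv]
  have hne : {k | ∃ v ∈ parabolicSubgroup (initialIndices n),
      coxeterLength (w * v) = k}.Nonempty := ⟨_, 1, one_mem _, rfl⟩
  apply le_antisymm
  · obtain ⟨v, hv, hmin⟩ := Nat.sInf_mem hne
    have hle : ∀ v' ∈ parabolicSubgroup (initialIndices n),
        (inversions (w * v)).card ≤ (inversions (w * v')).card := fun v' hv' => by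
      rw [← coxeterLength_eq_card_inversions, ← coxeterLength_eq_card_inversions, hmin]
      exact Nat.sInf_le ⟨v', hv', rfl⟩
    have hinc : ∀ i ∈ initialIndices n, (w * v) (leftPos i) < (w * v) (rightPos i) := by
      intro i hi
      by_contra h
      have h' := (not_lt.1 h).lt_of_ne fun e =>
        (leftPos_lt_rightPos i).ne' ((w * v).injective e)
      have h1 := card_inversions_mul_of_gt i h'
      have h2 := hle (v * simpleTransposition n i)
        (mul_mem hv (Subgroup.subset_closure ⟨i, hi, rfl⟩))
      rw [← mul_assoc] at h2
      omega
    have h1 := card_inversions_of_increasing hn hinc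
    rw [hmul v hv, ← coxeterLength_eq_card_inversions, hmin] at h1
    exact h1.le
  · refine le_csInf hne ?_
    rintro k ⟨v, hv, rfl⟩
    have h1 := sub_le_card_inversions hn (w * v)
    rwa [hmul v hv, ← coxeterLength_eq_card_inversions] at h1

/-! ### Sorting tuples -/

section PartialSum

variable {n : ℕ}

/-- The partial sums `v ↦ ∑_{j < v} D j`, a tuple of length `n` with increments `D`. -/
def partialSum (D : Fin (n - 1) → ℕ) (v : Fin n) : ℕ :=
  ∑ j, if leftPos j < v then D j else 0

lemma partialSum_zero (D : Fin (n - 1) → ℕ) (hn : 0 < n) : partialSum D ⟨0, hn⟩ = 0 := by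
  simp [partialSum, Fin.lt_def]

lemma partialSum_rightPos (D : Fin (n - 1) → ℕ) (j : Fin (n - 1)) :
    partialSum D (rightPos j) = partialSum D (leftPos j) + D j := by
  unfold partialSum
  rw [← Finset.sum_ite_eq' Finset.univ j D |>.trans (if_pos (Finset.mem_univ j)),
    ← Finset.sum_add_distrib]
  refine Finset.sum_congr rfl fun i _ => ?_
  have h1 : leftPos i < rightPos j ↔ (i : ℕ) < j + 1 := Iff.rfl
  have h2 : leftPos i < leftPos j ↔ (i : ℕ) < j := Iff.rfl
  simp only [h1, h2, Fin.ext_iff]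
  split_ifs <;> omega

lemma partialSum_last (D : Fin (n - 1) → ℕ) (hn : 0 < n) :
    partialSum D ⟨n - 1, by omega⟩ = ∑ j, D j :=
  Finset.sum_congr rfl fun j _ => if_pos j.2

lemma partialSum_mono (D : Fin (n - 1) → ℕ) : Monotone (partialSum D) := fun x y hxy =>
  Finset.sum_le_sum fun j _ => by
    by_cases h : leftPos j < x
    · rw [if_pos h, if_pos (h.trans_le hxy)]
    · rw [if_neg h]
      exact Nat.zero_le _

lemma eq_partialSum (hn : 0 < n) {b : Fin n → ℕ} {D : Fin (n - 1) → ℕ} (h0 : b ⟨0, hn⟩ = 0)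
    (h : ∀ j, b (rightPos j) = b (leftPos j) + D j) : b = partialSum D := by
  have : ∀ k (hk : k < n), b ⟨k, hk⟩ = partialSum D ⟨k, hk⟩ := by
    intro k
    induction k with
    | zero => intro; rw [h0, partialSum_zero]
    | succ k ih =>
      intro hk
      have h1 := h ⟨k, by omega⟩
      have h2 := partialSum_rightPos D ⟨k, by omega⟩
      rw [show b (leftPos ⟨k, _⟩) = partialSum D (leftPos ⟨k, by omega⟩) from ih _, ← h2] at h1
      exact h1
  exact funext fun x => this x x.2

lemma partialSum_sub (D : Fin (n - 1) → ℕ) (x y : Fin n) :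
    partialSum D y - partialSum D x =
      ∑ j, if x ≤ leftPos j ∧ leftPos j < y then D j else 0 := by
  rcases le_or_gt x y with hxy | hxy
  · rw [Nat.sub_eq_iff_eq_add (partialSum_mono D hxy)]
    unfold partialSum
    rw [← Finset.sum_add_distrib]
    refine Finset.sum_congr rfl fun j _ => ?_
    by_cases h1 : leftPos j < x
    · simp [h1, h1.trans_le hxy, not_le.2 h1]
    · simp [h1, not_lt.1 h1]
  · rw [Nat.sub_eq_zero_of_le (partialSum_mono D hxy.le), eq_comm]
    refine Finset.sum_eq_zero fun j _ => if_neg ?_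
    rintro ⟨h1, h2⟩
    exact absurd (h1.trans_lt h2) (not_lt.2 hxy.le)

lemma card_Iic_leftPos (j : Fin (n - 1)) : (Finset.Iic (leftPos j)).card = j + 1 := by
  rw [Fin.card_Iic]
  rfl

lemma card_Ioi_leftPos (j : Fin (n - 1)) : (Finset.Ioi (leftPos j)).card = n - (j + 1) := by
  rw [Fin.card_Ioi]
  change n - 1 - (j : ℕ) = _
  omega

lemma sum_partialSum (D : Fin (n - 1) → ℕ) :
    ∑ v, partialSum D v = ∑ j, (n - (j + 1)) * D j := by
  unfold partialSum
  rw [Finset.sum_comm]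
  refine Finset.sum_congr rfl fun j _ => ?_
  rw [← card_Ioi_leftPos, ← Finset.sum_filter, Finset.sum_const, smul_eq_mul]
  congr 2
  ext
  simp

/-- The increment `D j` occurs in the difference of the partial sums at `x < y` when `x ≤ j < y`,
for `(j + 1) (n - (j + 1))` pairs. -/
lemma sum_partialSum_sub (D : Fin (n - 1) → ℕ) :
    ∑ y, ∑ x, (partialSum D y - partialSum D x) = ∑ j, (j + 1) * (n - (j + 1)) * D j := by
  have h : ∀ y x : Fin n, partialSum D y - partialSum D x = ∑ j, (if x ≤ leftPos j then 1 else 0) *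
      (if leftPos j < y then 1 else 0) * D j := fun y x => by
    rw [partialSum_sub]
    refine Finset.sum_congr rfl fun j _ => ?_
    split_ifs <;> simp_all
  simp only [h]
  rw [Finset.sum_congr rfl fun y _ => Finset.sum_comm, Finset.sum_comm]
  refine Finset.sum_congr rfl fun j _ => ?_
  rw [← card_Ioi_leftPos, ← card_Iic_leftPos]
  simp only [← Finset.sum_mul, ← Finset.mul_sum]
  congr 2
  · rw [← Finset.card_filter]
    congr 1
    ext
    simp
  · rw [← Finset.card_filter]
    congr 1
    ext
    simp

end PartialSum

section Sorting

variable {n : ℕ}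

open Classical in
/-- The increments `d j + [j ∈ Des w]`: arbitrary natural numbers, made positive at the descents
of `w`. -/
noncomputable def descentIncrements (w : Perm (Fin n)) (d : Fin (n - 1) → ℕ) (j : Fin (n - 1)) :
    ℕ :=
  d j + if j ∈ descentSet w then 1 else 0

/-- The tuple `a` for which `a ∘ w` starts at `0` and has the increments `d j + [j ∈ Des w]`. The
increments are positive at the descents of `w`, which is what makes `w` the stable sorting
permutation of `a` (`sort_sortedTuple`). -/
noncomputable def sortedTuple (w : Perm (Fin n)) (d : Fin (n - 1) → ℕ) (i : Fin n) : ℕ :=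
  partialSum (descentIncrements w d) (w⁻¹ i)

variable (w : Perm (Fin n)) (d : Fin (n - 1) → ℕ)

@[simp]
lemma sortedTuple_apply (x : Fin n) :
    sortedTuple w d (w x) = partialSum (descentIncrements w d) x := by
  simp [sortedTuple]

lemma sortedTuple_comp : sortedTuple w d ∘ w = partialSum (descentIncrements w d) :=
  funext fun x => sortedTuple_apply w d x

/-- On a stretch where the sorted tuple is constant, `w` has no descents. -/
lemma apply_lt_of_partialSum_eq {x y : Fin n} (hxy : x < y)
    (h : partialSum (descentIncrements w d) x = partialSum (descentIncrements w d) y) :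
    w x < w y := by
  have key : ∀ k (hk : x + (k + 1) < n),
      partialSum (descentIncrements w d) x =
        partialSum (descentIncrements w d) ⟨x + (k + 1), hk⟩ → w x < w ⟨x + (k + 1), hk⟩ := by
    intro k
    have step : ∀ k (hk : x + (k + 1) < n),
      partialSum (descentIncrements w d) x =
        partialSum (descentIncrements w d) ⟨x + (k + 1), hk⟩ →
      partialSum (descentIncrements w d) x =
        partialSum (descentIncrements w d) ⟨x + k, by omega⟩ ∧
      w ⟨x + k, by omega⟩ < w ⟨x + (k + 1), hk⟩ := by
      intro k hk h
      have h1 : partialSum (descentIncrements w d) x ≤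
          partialSum (descentIncrements w d) ⟨x + k, by omega⟩ :=
        partialSum_mono _ (by simp [Fin.le_def])
      have h2 := partialSum_rightPos (descentIncrements w d) ⟨x + k, by omega⟩
      change partialSum (descentIncrements w d) ⟨x + (k + 1), hk⟩ =
        partialSum (descentIncrements w d) ⟨x + k, by omega⟩ + _ at h2
      refine ⟨by omega, ?_⟩
      have h3 : descentIncrements w d ⟨x + k, by omega⟩ = 0 := by omega
      have h4 : (⟨x + k, by omega⟩ : Fin (n - 1)) ∉ descentSet w := fun h => by
        simp [descentIncrements, h] at h3
      rw [mem_descentSet, not_lt] at h4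
      exact h4.lt_of_ne fun e => (leftPos_lt_rightPos _).ne (w.injective e)
    induction k with
    | zero =>
      intro hk h
      exact (step 0 hk h).2
    | succ k ih =>
      intro hk h
      obtain ⟨h1, h2⟩ := step (k + 1) hk h
      exact (ih (by omega) h1).trans h2
  rw [Fin.lt_def] at hxy
  have e : (⟨x + ((y - x - 1 : ℕ) + 1), by omega⟩ : Fin n) = y := Fin.ext (by simp only; omega)
  have := key (y - x - 1) (by omega)
  rw [e] at this
  exact this h

lemma sort_sortedTuple : Tuple.sort (sortedTuple w d) = w := by
  rw [eq_comm, Tuple.eq_sort_iff, sortedTuple_comp]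
  refine ⟨partialSum_mono _, fun x y hxy h => ?_⟩
  rw [sortedTuple_apply, sortedTuple_apply] at h
  exact apply_lt_of_partialSum_eq w d hxy h

lemma mem_firstLetterLE (hn : 0 < n) {f : ℕ} {w : Perm (Fin n)} :
    w ∈ firstLetterLE n f ↔ (w ⟨0, hn⟩ : ℕ) < f := by
  simp only [firstLetterLE, Finset.mem_filter, Finset.mem_univ, true_and]
  constructor
  · exact fun h => h ⟨0, hn⟩ rfl
  · intro h k hk
    obtain rfl : k = ⟨0, hn⟩ := Fin.ext (by simpa using hk)
    exact h

/-- A tuple with an entry `0` among the first `f` is stably sorted by a unique `w`. As the stable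
sorting puts the first of the entries `0` in front, `w` lies in `S_n^{(f)}`; the increments of the
sorted tuple are arbitrary except that they are positive at the descents of `w`. -/
lemma bijective_sortedTuple (hn : 0 < n) (f : ℕ) :
    Function.Bijective (fun x : {w // w ∈ firstLetterLE n f} × (Fin (n - 1) → ℕ) =>
      (⟨sortedTuple x.1.1 x.2, x.1.1 ⟨0, hn⟩, (mem_firstLetterLE hn).1 x.1.2, by
        rw [sortedTuple_apply, partialSum_zero]⟩ :
        {a : Fin n → ℕ // ∃ i : Fin n, (i : ℕ) < f ∧ a i = 0})) := by
  constructor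
  · rintro ⟨⟨w, hw⟩, d⟩ ⟨⟨w', hw'⟩, d'⟩ h
    have h1 : sortedTuple w d = sortedTuple w' d' := congrArg Subtype.val h
    obtain rfl : w = w' := by rw [← sort_sortedTuple w d, h1, sort_sortedTuple]
    have h2 := congrArg (· ∘ w) h1
    simp only [sortedTuple_comp] at h2
    have : d = d' := by
      funext j
      have h3 := partialSum_rightPos (descentIncrements w d) j
      have h4 := partialSum_rightPos (descentIncrements w d') j
      rw [h2, h4] at h3
      simp only [descentIncrements] at h3
      omega
    rw [this]
  · rintro ⟨a, i, hi, hai⟩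
    obtain ⟨hmono, hstab⟩ := Tuple.eq_sort_iff.1 (rfl : Tuple.sort a = Tuple.sort a)
    set w := Tuple.sort a with hw
    have h0 : a (w ⟨0, hn⟩) = 0 := by
      have := hmono (show (⟨0, hn⟩ : Fin n) ≤ w⁻¹ i from Nat.zero_le _)
      simpa [hai] using this
    have hwf : w ∈ firstLetterLE n f := by
      rw [mem_firstLetterLE hn]
      rcases (show (⟨0, hn⟩ : Fin n) ≤ w⁻¹ i from Nat.zero_le _).eq_or_lt with h | h
      · simpa [h] using hi
      · have := hstab _ _ h (by simp [h0, hai])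
        rw [show w (w⁻¹ i) = i from w.apply_symm_apply i, Fin.lt_def] at this
        omega
    let d : Fin (n - 1) → ℕ := fun j =>
      a (w (rightPos j)) - a (w (leftPos j)) - if j ∈ descentSet w then 1 else 0
    refine ⟨⟨⟨w, hwf⟩, d⟩, Subtype.ext ?_⟩
    have h1 : a ∘ w = partialSum (descentIncrements w d) := by
      refine eq_partialSum hn h0 fun j => ?_
      have h2 : a (w (leftPos j)) ≤ a (w (rightPos j)) := hmono (leftPos_lt_rightPos j).le
      have h3 : j ∈ descentSet w → a (w (leftPos j)) ≠ a (w (rightPos j)) := fun h e =>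
        absurd (hstab _ _ (leftPos_lt_rightPos j) e) (not_lt.2 (mem_descentSet.1 h).le)
      simp only [Function.comp_apply, descentIncrements, d]
      split_ifs with h
      · have := h3 h
        omega
      · omega
    funext x
    have := congrFun h1 (w⁻¹ x)
    rw [Function.comp_apply, show w (w⁻¹ x) = x from w.apply_symm_apply x] at this
    exact this.symm

lemma sum_sortedTuple : ∑ i, sortedTuple w d i = ∑ j, (n - (j + 1)) * descentIncrements w d j := by
  rw [← sum_partialSum, ← Equiv.sum_comp w]
  simp

/-- The truncated differences in `gapExponent_gapSet` are smaller by one than those of the values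
exactly for the pairs of letters that are inverted by `w`. -/
lemma gapExponent_sortedTuple :
    gapExponent n 0 (gapSet (sortedTuple w d)) + coxeterLength w =
      ∑ j, (j + 1) * (n - (j + 1)) * descentIncrements w d j := by
  rw [gapExponent_gapSet, ← sum_partialSum_sub, coxeterLength_eq_card_inversions, inversions,
    Finset.card_filter, ← Finset.univ_product_univ, Finset.sum_product_right,
    ← Equiv.sum_comp w, ← Finset.sum_add_distrib]
  refine Finset.sum_congr rfl fun y _ => ?_
  rw [← Equiv.sum_comp w, ← Finset.sum_add_distrib]
  refine Finset.sum_congr rfl fun x _ => ?_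
  simp only [sortedTuple_apply]
  rcases lt_or_ge x y with hxy | hxy
  · have h1 := partialSum_mono (descentIncrements w d) hxy.le
    simp only [hxy, true_and]
    split_ifs with h
    · have : partialSum (descentIncrements w d) x ≠ partialSum (descentIncrements w d) y :=
        fun e => absurd (apply_lt_of_partialSum_eq w d hxy e) (not_lt.2 h.le)
      omega
    · omega
  · have h1 := partialSum_mono (descentIncrements w d) hxy
    simp only [not_lt.2 hxy, false_and, if_false]
    split_ifs <;> omega

/-- Let `B` be the sum of the increments. If `B > 0`, the largest element of
`gapSet (sortedTuple w d)` is `n (B - 1) + w (n - 1)` (letters and positions counted from `0`): the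
last position has the largest value, and among equal values the largest letter. -/
lemma forall_gapSet_sortedTuple_lt_iff {e f : ℕ} (hn : n = e * f) (hn0 : 0 < n) (k : ℕ) :
    (∀ h ∈ gapSet (sortedTuple w d), h < f * k) ↔
      e * ∑ j, descentIncrements w d j ≤ k + (n - 1 - w ⟨n - 1, by omega⟩) / f := by
  have hf : 0 < f := Nat.pos_of_ne_zero (by rintro rfl; omega)
  rw [← partialSum_last _ hn0]
  set B := partialSum (descentIncrements w d) ⟨n - 1, by omega⟩ with hB
  set l := w ⟨n - 1, by omega⟩ with hl
  have hle : ∀ x, partialSum (descentIncrements w d) x ≤ B := fun x =>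
    partialSum_mono _ (by rw [Fin.le_def]; have := x.2; simp only; omega)
  have h2 : (e * B ≤ k + (n - 1 - l) / f) ↔ n * B ≤ f * k + (n - 1 - l) := by
    rw [← Nat.sub_le_iff_le_add', Nat.le_div_iff_mul_le hf, Nat.sub_mul, Nat.sub_le_iff_le_add',
      mul_comm k f, mul_right_comm, ← hn]
  rw [h2]
  have hll := l.2
  rcases Nat.eq_zero_or_pos B with h0 | h0
  · rw [h0, mul_zero]
    refine iff_of_true (fun h hh => ?_) (Nat.zero_le _)
    obtain ⟨b, i, rfl⟩ := exists_eq_mul_add_fin hn0 h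
    have := hle (w⁻¹ i)
    rw [mem_gapSet, sortedTuple] at hh
    omega
  · have h3 : n * B = n * (B - 1) + n := by
      obtain ⟨c, hc⟩ := Nat.exists_eq_succ_of_ne_zero h0.ne'
      rw [hc, Nat.succ_sub_one, Nat.succ_eq_add_one, mul_add, mul_one]
    rw [h3]
    constructor
    · intro h
      have := h (n * (B - 1) + l) (by rw [mem_gapSet, hl, sortedTuple_apply]; omega)
      omega
    · intro hk h hh
      obtain ⟨b, i, rfl⟩ := exists_eq_mul_add_fin hn0 h
      obtain ⟨x, rfl⟩ := w.surjective i
      rw [mem_gapSet, sortedTuple_apply] at hh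
      have h4 := hle x
      have h5 := (w x).2
      rcases (show b + 1 ≤ B by omega).eq_or_lt with h6 | h6
      · have h7 : w x ≤ l := by
          rcases (show x ≤ ⟨n - 1, by omega⟩ by
            rw [Fin.le_def]; have := x.2; simp only; omega).eq_or_lt with h8 | h8
          · rw [hl, h8]
          · exact (apply_lt_of_partialSum_eq w d h8 (by omega)).le
        rw [Fin.le_def] at h7
        have : B - 1 = b := by omega
        rw [this] at hk
        omega
      · have := Nat.mul_le_mul_left n (show b + 1 ≤ B - 1 by omega)
        rw [mul_add] at this
        omega

/-- If all increments vanish then `w = 1`; otherwise the left side is at most `n / f = e`. -/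
lemma le_mul_sum_descentIncrements {e f : ℕ} (hn : n = e * f) (hn0 : 0 < n) :
    (n - 1 - w ⟨n - 1, by omega⟩) / f ≤ e * ∑ j, descentIncrements w d j := by
  have hf : 0 < f := Nat.pos_of_ne_zero (by rintro rfl; omega)
  by_cases h : ∑ j, descentIncrements w d j = 0
  · have : w = 1 := by
      refine eq_one_of_strictMono (strictMono_of_leftPos_lt_rightPos fun j => ?_)
      have h1 := Finset.sum_eq_zero_iff.1 h j (Finset.mem_univ j)
      have h2 : j ∉ descentSet w := fun h => by simp [descentIncrements, h] at h1
      rw [mem_descentSet, not_lt] at h2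
      exact h2.lt_of_ne fun e => (leftPos_lt_rightPos _).ne (w.injective e)
    simp [this]
  · have h1 : (n - 1 - w ⟨n - 1, by omega⟩) / f ≤ e := by
      rw [Nat.div_le_iff_le_mul_add_pred hf, mul_comm, ← hn]
      omega
    exact h1.trans (Nat.le_mul_of_pos_right _ (Nat.pos_of_ne_zero h))

end Sorting

/-! ### Sums over fibres -/

section Fiber

variable {X Y : Type*} (F : X → Y)

/-- Absolute convergence of `∑_x g (F x)` for a map `F` with finite fibres. -/
lemma summable_norm_comp_iff (hfin : ∀ y, Finite {x // F x = y}) (g : Y → ℂ) :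
    Summable (fun x => ‖g (F x)‖) ↔
      Summable fun y => (Nat.card {x // F x = y} : ℝ) * ‖g y‖ := by
  rw [← (Equiv.sigmaFiberEquiv F).summable_iff]
  refine (summable_sigma_of_nonneg (f := (fun x => ‖g (F x)‖) ∘ Equiv.sigmaFiberEquiv F)
    (fun x => norm_nonneg (g (F (Equiv.sigmaFiberEquiv F x))))).trans ?_
  have h : ∀ y, (fun z : {x // F x = y} =>
      ((fun x => ‖g (F x)‖) ∘ Equiv.sigmaFiberEquiv F) ⟨y, z⟩) = fun _ => ‖g y‖ := fun y => by
    funext z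
    change ‖g (F z.1)‖ = _
    rw [z.2]
  simp only [h, tsum_const, nsmul_eq_mul, and_iff_right_iff_imp]
  exact fun _ y => Summable.of_finite

lemma tsum_comp_eq (g : Y → ℂ) (hs : Summable fun x => ‖g (F x)‖) :
    ∑' x, g (F x) = ∑' y, (Nat.card {x // F x = y} : ℂ) * g y := by
  have hs' : Summable (fun x => g (F x)) := hs.of_norm
  rw [← (Equiv.sigmaFiberEquiv F).tsum_eq]
  refine (Summable.tsum_sigma (f := fun z => g (F (Equiv.sigmaFiberEquiv F z)))
    ((Equiv.sigmaFiberEquiv F).summable_iff.2 hs')).trans ?_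
  refine tsum_congr fun y => ?_
  rw [tsum_congr (fun z : {x // F x = y} => show g (F (Equiv.sigmaFiberEquiv F ⟨y, z⟩)) = g y from
    congrArg g z.2), tsum_const, nsmul_eq_mul]

lemma finite_fiber_of_summable (g : Y → ℂ) (hs : Summable fun x => ‖g (F x)‖) (y : Y)
    (hy : g y ≠ 0) : Finite {x // F x = y} := by
  by_contra h
  rw [not_finite_iff_infinite] at h
  have h1 : Summable fun _ : {x // F x = y} => ‖g y‖ :=
    (hs.comp_injective Subtype.val_injective).congr fun x => congrArg (fun z => ‖g z‖) x.2
  exact hy (norm_eq_zero.1 ((summable_const_iff _).1 h1))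

end Fiber

/-- The Dirichlet series counting the elements of `X` by a positive integer `ι x`. -/
lemma LSeries_card_fiber {X : Type*} (ι : X → ℕ) (hι : ∀ x, ι x ≠ 0) (s : ℂ)
    (hs : Summable fun x => ‖(ι x : ℂ) ^ (-s)‖) :
    (∀ m, m ≠ 0 → Finite {x // ι x = m}) ∧
    LSeriesSummable (fun m => (Nat.card {x // ι x = m} : ℂ)) s ∧
    LSeries (fun m => (Nat.card {x // ι x = m} : ℂ)) s = ∑' x, (ι x : ℂ) ^ (-s) := by
  have h0 : IsEmpty {x // ι x = 0} := ⟨fun x => hι _ x.2⟩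
  have hfin : ∀ m, Finite {x // ι x = m} := fun m => by
    rcases eq_or_ne m 0 with rfl | hm
    · infer_instance
    · refine finite_fiber_of_summable ι (fun m => (m : ℂ) ^ (-s)) hs m ?_
      rw [Ne, Complex.cpow_eq_zero_iff]
      simp [hm]
  have hterm : ∀ m, LSeries.term (fun m => (Nat.card {x // ι x = m} : ℂ)) s m =
      (Nat.card {x // ι x = m} : ℂ) * (m : ℂ) ^ (-s) := fun m =>
    LSeries.term_def₀ (by simp) s m
  refine ⟨fun m _ => hfin m, ?_, ?_⟩
  · have := (summable_norm_comp_iff ι hfin fun m => (m : ℂ) ^ (-s)).1 hs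
    refine Summable.of_norm ?_
    simpa only [hterm, norm_mul, Complex.norm_natCast] using this
  · rw [tsum_comp_eq ι (fun m => (m : ℂ) ^ (-s)) hs]
    exact tsum_congr hterm

/-- A finite product of absolutely convergent series as a sum over tuples. -/
lemma summable_and_tsum_pi {k : ℕ} (g : Fin k → ℕ → ℂ) (hg : ∀ i, Summable fun m => ‖g i m‖) :
    (Summable fun d : Fin k → ℕ => ‖∏ i, g i (d i)‖) ∧
      ∑' d : Fin k → ℕ, ∏ i, g i (d i) = ∏ i, ∑' m, g i m := by
  induction k with
  | zero =>
    refine ⟨Summable.of_finite, ?_⟩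
    rw [tsum_eq_single default (fun b hb => absurd (Subsingleton.elim b default) hb)]
    simp
  | succ k ih =>
    obtain ⟨h1, h2⟩ := ih (fun i => g i.succ) fun i => hg i.succ
    have e : ∀ x : ℕ × (Fin k → ℕ), ∏ i, g i ((Fin.consEquiv fun _ => ℕ) x i) =
        g 0 x.1 * ∏ i : Fin k, g i.succ (x.2 i) := fun x => by
      rw [Fin.prod_univ_succ]
      rfl
    constructor
    · rw [← (Fin.consEquiv fun _ => ℕ).summable_iff]
      refine (Summable.mul_norm (hg 0) h1).congr fun x => ?_
      rw [Function.comp_apply, e]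
    · rw [← (Fin.consEquiv fun _ => ℕ).tsum_eq, tsum_congr e, Fin.prod_univ_succ, ← h2,
        tsum_mul_tsum_of_summable_norm (hg 0) h1]

/-! ### The generating function of lattices by index and conductor -/

lemma natCast_cpow_mul_nat {p : ℕ} (z : ℂ) (m : ℕ) : (p : ℂ) ^ ((m : ℂ) * z) = ((p : ℂ) ^ z) ^ m :=
  Complex.cpow_nat_mul _ _ _

lemma cpow_sum_eq_prod {p : ℂ} (hp : p ≠ 0) {ι : Type*} (t : Finset ι) (z : ι → ℂ) :
    p ^ (∑ j ∈ t, z j) = ∏ j ∈ t, p ^ z j := by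
  simp only [Complex.cpow_def_of_ne_zero hp, Finset.mul_sum, Complex.exp_sum]

/-- The conductor exponent of a type with respect to the multiples of `f`: the least `k` such that
all elements of `gapSet a` are smaller than `f k`. -/
noncomputable def conductorExponent (f : ℕ) {n : ℕ} (a : Fin n → ℕ) : ℕ :=
  sInf {k | ∀ h ∈ gapSet a, h < f * k}

lemma conductorExponent_le_iff {f : ℕ} (hf : 0 < f) {n : ℕ} (a : Fin n → ℕ) (k : ℕ) :
    conductorExponent f a ≤ k ↔ ∀ h ∈ gapSet a, h < f * k := by
  have hne : {k | ∀ h ∈ gapSet a, h < f * k}.Nonempty := by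
    refine ⟨(gapSet a).sup id + 1, fun h hh => ?_⟩
    have : h ≤ (gapSet a).sup id := Finset.le_sup (f := id) hh
    nlinarith
  constructor
  · intro h i hi
    exact (Nat.sInf_mem hne i hi).trans_le (Nat.mul_le_mul_left f h)
  · exact fun h => Nat.sInf_le h

lemma sum_le_mul_conductorExponent {f : ℕ} (hf : 0 < f) {n : ℕ} (a : Fin n → ℕ) :
    ∑ i, a i ≤ f * conductorExponent f a := by
  rw [← card_gapSet]
  have : gapSet a ⊆ Finset.range (f * conductorExponent f a) := fun h hh =>
    Finset.mem_range.2 ((conductorExponent_le_iff hf a _).1 le_rfl h hh)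
  simpa using Finset.card_le_card this

/-- The contribution `|A : L|^{2n - s} p^{-2fks}` of a lattice `L` of type `a` and conductor
exponent `k`. -/
noncomputable def latticeTerm (p f : ℕ) {n : ℕ} (s : ℂ) (a : Fin n → ℕ) : ℂ :=
  (p : ℂ) ^ (((∑ i, a i : ℕ) : ℂ) * (2 * n - s) - 2 * f * conductorExponent f a * s)

namespace PeriodicFlag

variable {A : Type*} [AddCommGroup A] {p n : ℕ} (Φ : PeriodicFlag A p n)

lemma finite_latticeType_fiber (hp : p.Prime) (hn : 0 < n) (a : Fin n → ℕ) :
    Finite {L : {L : AddSubgroup A // L.FiniteIndex} // Φ.latticeType L.1 = a} := by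
  refine (Nat.card_ne_zero.1 ?_).2
  rw [Φ.card_latticeType_fiber hp hn]
  exact pow_ne_zero _ hp.ne_zero

/-- There are at most `p^{(n - 1) t}` lattices of each type of index `p^t`, so a sum over all
lattices converges if its terms decay faster than that. -/
lemma summable_of_norm_le (hp : p.Prime) (hn : 0 < n) (g : (Fin n → ℕ) → ℂ) (δ : ℝ)
    (hδ : (n : ℝ) - 1 < δ) (hg : ∀ a, ‖g a‖ ≤ (p : ℝ) ^ (-δ * (∑ i, a i : ℕ))) :
    Summable fun L : {L : AddSubgroup A // L.FiniteIndex} => ‖g (Φ.latticeType L.1)‖ := by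
  have hp0 : (0 : ℝ) < p := by exact_mod_cast hp.pos
  have hp1 : (1 : ℝ) < p := by exact_mod_cast hp.one_lt
  rw [summable_norm_comp_iff (fun L : {L : AddSubgroup A // L.FiniteIndex} => Φ.latticeType L.1)
    (Φ.finite_latticeType_fiber hp hn)]
  simp only [Φ.card_latticeType_fiber hp hn]
  -- the sum is dominated by `∑_a r^(a 1 + ⋯ + a n)`, a power of a geometric series
  set r : ℝ := (p : ℝ) ^ ((n : ℝ) - 1 - δ) with hr
  have hr0 : 0 < r := Real.rpow_pos_of_pos hp0 _
  have hr1 : r < 1 := Real.rpow_lt_one_of_one_lt_of_neg hp1 (by linarith)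
  have h1 := (summable_and_tsum_pi (k := n) (fun _ m => (r : ℂ) ^ m) fun _ => by
    simp only [norm_pow, Complex.norm_real, Real.norm_of_nonneg hr0.le]
    exact summable_geometric_of_lt_one hr0.le hr1).1
  refine Summable.of_nonneg_of_le (fun a => by positivity) (fun a => ?_) h1
  rw [Finset.prod_pow_eq_pow_sum, norm_pow, Complex.norm_real, Real.norm_of_nonneg hr0.le, hr,
    ← Real.rpow_mul_natCast hp0.le]
  calc ((p ^ gapExponent n 0 (gapSet a) : ℕ) : ℝ) * ‖g a‖
      ≤ (p : ℝ) ^ (((n : ℝ) - 1) * (∑ i, a i : ℕ)) * (p : ℝ) ^ (-δ * (∑ i, a i : ℕ)) := by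
        refine mul_le_mul ?_ (hg a) (norm_nonneg _) (by positivity)
        rw [Nat.cast_pow, ← Real.rpow_natCast]
        refine Real.rpow_le_rpow_of_exponent_le hp1.le ?_
        have h2 := gapExponent_gapSet_le a
        have h3 : ((n - 1 : ℕ) : ℝ) = n - 1 := by rw [Nat.cast_sub hn, Nat.cast_one]
        rw [← h3]
        exact_mod_cast h2
    _ = _ := by
        rw [← Real.rpow_add hp0]
        congr 1
        ring

end PeriodicFlag

section Terms

variable {p n e f : ℕ} {s : ℂ}

lemma norm_latticeTerm_le (hp : p.Prime) (hf : 0 < f) (hs : 0 ≤ s.re) (a : Fin n → ℕ) :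
    ‖latticeTerm p f s a‖ ≤ (p : ℝ) ^ (-(3 * s.re - 2 * n) * (∑ i, a i : ℕ)) := by
  rw [latticeTerm, Complex.norm_natCast_cpow_of_pos hp.pos]
  refine Real.rpow_le_rpow_of_exponent_le (by exact_mod_cast hp.one_lt.le) ?_
  have h1 : ((∑ i, a i : ℕ) : ℝ) ≤ f * conductorExponent f a := by
    exact_mod_cast sum_le_mul_conductorExponent hf a
  have h2 : (((∑ i, a i : ℕ) : ℂ) * (2 * n - s) - 2 * f * conductorExponent f a * s).re =
      ((∑ i, a i : ℕ) : ℝ) * (2 * n - s.re) - 2 * (f * conductorExponent f a) * s.re := by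
    have e1 : (((∑ i, a i : ℕ) : ℂ) * (2 * n - s) - 2 * f * conductorExponent f a * s) =
      ((((∑ i, a i : ℕ) : ℝ) : ℂ) * (((2 * n : ℝ) : ℂ) - s) -
        ((2 * (f * conductorExponent f a) : ℝ) : ℂ) * s) := by
      push_cast
      ring
    rw [e1, Complex.sub_re, Complex.re_ofReal_mul, Complex.re_ofReal_mul, Complex.sub_re,
      Complex.ofReal_re]
  rw [h2]
  nlinarith

lemma norm_numericalDatum_lt_one (hp : p.Prime) (hs : 2 * (n : ℝ) - 1 < s.re) {i : ℕ} (hi : 1 ≤ i)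
    (hin : i ≤ n - 1) : ‖numericalDatum p n s i‖ < 1 := by
  rw [numericalDatum, Complex.norm_natCast_cpow_of_pos hp.pos]
  refine Real.rpow_lt_one_of_one_lt_of_neg (by exact_mod_cast hp.one_lt) ?_
  have e1 : ((2 * (n : ℂ) + i) * ((n : ℂ) - i) - (3 * (n : ℂ) - i) * s) =
      (((2 * n + i) * (n - i) : ℝ) : ℂ) - ((3 * n - i : ℝ) : ℂ) * s := by push_cast; ring
  rw [e1, Complex.sub_re, Complex.re_ofReal_mul, Complex.ofReal_re]
  have h1 : (1 : ℝ) ≤ i := by exact_mod_cast hi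
  have h2 : (i : ℝ) + 1 ≤ n := by
    have : i + 1 ≤ n := by omega
    exact_mod_cast this
  have h3 : (0 : ℝ) < 3 * n - i := by linarith
  have h4 : (2 * n + i : ℝ) * (n - i) < (3 * n - i) * (2 * n - 1) := by nlinarith
  nlinarith

lemma norm_cpow_shift_lt_one (hp : p.Prime) (hf : 0 < f) (hn : 0 < n)
    (hs : 2 * (n : ℝ) - 1 < s.re) : ‖(p : ℂ) ^ ((f : ℂ) * (2 * (n : ℂ) - 3 * s))‖ < 1 := by
  rw [Complex.norm_natCast_cpow_of_pos hp.pos]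
  refine Real.rpow_lt_one_of_one_lt_of_neg (by exact_mod_cast hp.one_lt) ?_
  have e1 : ((f : ℂ) * (2 * (n : ℂ) - 3 * s)) =
      ((f : ℝ) : ℂ) * (((2 * n : ℝ) : ℂ) - ((3 : ℝ) : ℂ) * s) := by push_cast; ring
  rw [e1, Complex.re_ofReal_mul, Complex.sub_re, Complex.re_ofReal_mul, Complex.ofReal_re]
  have h1 : (1 : ℝ) ≤ n := by exact_mod_cast hn
  have h2 : (0 : ℝ) < f := by exact_mod_cast hf
  nlinarith

lemma one_sub_ne_zero_of_norm_lt_one {z : ℂ} (hz : ‖z‖ < 1) : 1 - z ≠ 0 := by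
  intro h
  rw [← sub_eq_zero.1 h] at hz
  simp at hz

lemma cancelledDenominator_eq (p n f : ℕ) (s : ℂ) : cancelledDenominator p n f s =
    (1 - (p : ℂ) ^ ((f : ℂ) * (2 * (n : ℂ) - 3 * s))) *
      ∏ j : Fin (n - 1), (1 - numericalDatum p n s (j + 1)) := by
  rw [cancelledDenominator,
    Fin.prod_univ_eq_prod_range (fun j => 1 - numericalDatum p n s (j + 1)) (n - 1),
    Finset.range_eq_Ico, Finset.prod_Ico_add' (fun j => 1 - numericalDatum p n s j)]
  congr 2

/-- The contribution of all lattices of the type `sortedTuple w d` to the sum of `latticeTerm`. Each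
statistic of the type is linear in the increments up to a correction that depends only on `w`:
`-ℓ(w)` for the number of lattices, `-⌊ℓ^{[n-2]}(w) / f⌋` for the conductor exponent. -/
lemma term_sortedTuple (hp : p.Prime) (hn : n = e * f) (hn0 : 0 < n) (w : Perm (Fin n))
    (d : Fin (n - 1) → ℕ) :
    ((p ^ gapExponent n 0 (gapSet (sortedTuple w d)) : ℕ) : ℂ) *
        latticeTerm p f s (sortedTuple w d) =
      (p : ℂ) ^ (-(coxeterLength w : ℂ)
        + 2 * (f : ℂ) * ((parabolicLength (initialIndices n) w / f : ℕ) : ℂ) * s) *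
      ∏ j : Fin (n - 1), numericalDatum p n s ((j : ℕ) + 1) ^ descentIncrements w d j := by
  have hp0 : (p : ℂ) ≠ 0 := by exact_mod_cast hp.ne_zero
  have hf : 0 < f := Nat.pos_of_ne_zero (by rintro rfl; omega)
  set D := descentIncrements w d with hD
  -- the conductor exponent of the sorted tuple
  have hk : conductorExponent f (sortedTuple w d) + parabolicLength (initialIndices n) w / f =
      e * ∑ j, D j := by
    rw [parabolicLength_initialIndices hn0]
    have h1 := le_mul_sum_descentIncrements w d hn hn0
    have h2 : ∀ k, conductorExponent f (sortedTuple w d) ≤ k ↔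
        e * ∑ j, D j - (n - 1 - w ⟨n - 1, by omega⟩) / f ≤ k := fun k => by
      rw [conductorExponent_le_iff hf, forall_gapSet_sortedTuple_lt_iff w d hn hn0,
        Nat.sub_le_iff_le_add]
    rw [eq_of_forall_ge_iff h2]
    exact Nat.sub_add_cancel h1
  have hE := gapExponent_sortedTuple w d
  have hS := sum_sortedTuple w d
  set E := gapExponent n 0 (gapSet (sortedTuple w d))
  set q := parabolicLength (initialIndices n) w / f
  set k := conductorExponent f (sortedTuple w d) with hkdef
  have hsub : ∀ j : Fin (n - 1), ((n - ((j : ℕ) + 1) : ℕ) : ℂ) = n - (((j : ℕ) + 1 : ℕ) : ℂ) :=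
    fun j => by rw [Nat.cast_sub (by omega)]
  have hE' : (E : ℂ) + coxeterLength w =
      ∑ j : Fin (n - 1), (((j : ℕ) + 1 : ℕ) : ℂ) * (n - (((j : ℕ) + 1 : ℕ) : ℂ)) * D j := by
    simp only [← hsub]
    exact_mod_cast hE
  have hS' : ((∑ i, sortedTuple w d i : ℕ) : ℂ) =
      ∑ j : Fin (n - 1), (n - (((j : ℕ) + 1 : ℕ) : ℂ)) * D j := by
    simp only [← hsub]
    exact_mod_cast hS
  have hk' : (k : ℂ) + q = e * ∑ j, (D j : ℂ) := by exact_mod_cast hk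
  have hn' : (n : ℂ) = e * f := by exact_mod_cast hn
  have hx : ∏ j : Fin (n - 1), numericalDatum p n s ((j : ℕ) + 1) ^ D j =
      (p : ℂ) ^ ∑ j : Fin (n - 1), (D j : ℂ) * ((2 * (n : ℂ) + ((j : ℕ) + 1 : ℕ)) *
        ((n : ℂ) - ((j : ℕ) + 1 : ℕ)) - (3 * (n : ℂ) - ((j : ℕ) + 1 : ℕ)) * s) := by
    rw [cpow_sum_eq_prod hp0]
    refine Finset.prod_congr rfl fun j _ => ?_
    rw [natCast_cpow_mul_nat]
    rfl
  have hsum : ∑ j : Fin (n - 1), (D j : ℂ) * ((2 * (n : ℂ) + ((j : ℕ) + 1 : ℕ)) *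
        ((n : ℂ) - ((j : ℕ) + 1 : ℕ)) - (3 * (n : ℂ) - ((j : ℕ) + 1 : ℕ)) * s) =
      (E + coxeterLength w) + ((∑ i, sortedTuple w d i : ℕ) : ℂ) * (2 * n - s) -
        2 * n * s * ∑ j, (D j : ℂ) := by
    rw [hE', hS', Finset.sum_mul, Finset.mul_sum, ← Finset.sum_add_distrib,
      ← Finset.sum_sub_distrib]
    refine Finset.sum_congr rfl fun j _ => ?_
    ring
  have hpE : ((p ^ E : ℕ) : ℂ) = (p : ℂ) ^ (E : ℂ) := by
    rw [Complex.cpow_natCast, Nat.cast_pow]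
  rw [hx, hsum, hpE, latticeTerm, ← Complex.cpow_add _ _ hp0, ← Complex.cpow_add _ _ hp0, ← hkdef]
  congr 1
  linear_combination (-2 * f * s) * hk' + 2 * s * (∑ j, (D j : ℂ)) * hn'

/-- The sum over the increments is a product of geometric series. -/
lemma tsum_increments (hp : p.Prime) (hs : 2 * (n : ℝ) - 1 < s.re) (w : Perm (Fin n)) :
    (Summable fun d : Fin (n - 1) → ℕ => ‖∏ j : Fin (n - 1),
      numericalDatum p n s ((j : ℕ) + 1) ^ descentIncrements w d j‖) ∧
    ∑' d : Fin (n - 1) → ℕ, ∏ j : Fin (n - 1),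
      numericalDatum p n s ((j : ℕ) + 1) ^ descentIncrements w d j =
    (∏ j ∈ descentSet w, numericalDatum p n s ((j : ℕ) + 1)) /
      ∏ j : Fin (n - 1), (1 - numericalDatum p n s (j + 1)) := by
  classical
  have hx : ∀ j : Fin (n - 1), ‖numericalDatum p n s (j + 1)‖ < 1 := fun j =>
    norm_numericalDatum_lt_one hp hs (by omega) (by omega)
  have h := summable_and_tsum_pi (fun (j : Fin (n - 1)) m => numericalDatum p n s (j + 1) ^ m)
    fun j => by
      simp only [norm_pow]
      exact summable_geometric_of_lt_one (norm_nonneg _) (hx j)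
  have e1 : ∀ d : Fin (n - 1) → ℕ, ∏ j : Fin (n - 1),
      numericalDatum p n s ((j : ℕ) + 1) ^ descentIncrements w d j =
      (∏ j ∈ descentSet w, numericalDatum p n s ((j : ℕ) + 1)) *
        ∏ j : Fin (n - 1), numericalDatum p n s ((j : ℕ) + 1) ^ d j := fun d => by
    have e2 : ∏ j ∈ descentSet w, numericalDatum p n s ((j : ℕ) + 1) =
        ∏ j : Fin (n - 1), numericalDatum p n s ((j : ℕ) + 1) ^
          (if j ∈ descentSet w then 1 else 0) := by
      simp only [pow_ite, pow_one, pow_zero, Finset.prod_ite_mem, Finset.univ_inter]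
    rw [e2, ← Finset.prod_mul_distrib]
    refine Finset.prod_congr rfl fun j _ => ?_
    rw [descentIncrements, pow_add, mul_comm]
  simp only [e1]
  refine ⟨?_, ?_⟩
  · simp only [norm_mul]
    exact h.1.mul_left _
  · rw [tsum_mul_left, h.2, div_eq_mul_inv, ← Finset.prod_inv_distrib]
    congr 1
    exact Finset.prod_congr rfl fun j _ => tsum_geometric_of_norm_lt_one (hx j)

/-- The sum over the types with an entry `0` among the first `f`. -/
lemma tsum_types (hp : p.Prime) (hn : n = e * f) (hn0 : 0 < n) (hs : 2 * (n : ℝ) - 1 < s.re) :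
    ∑' a : {a : Fin n → ℕ // ∃ i : Fin n, (i : ℕ) < f ∧ a i = 0},
      ((p ^ gapExponent n 0 (gapSet a.1) : ℕ) : ℂ) * latticeTerm p f s a.1 =
    cancelledNumerator p n f s / ∏ j : Fin (n - 1), (1 - numericalDatum p n s (j + 1)) := by
  rw [← (Equiv.ofBijective _ (bijective_sortedTuple hn0 f)).tsum_eq]
  set c : Perm (Fin n) → ℂ := fun w => (p : ℂ) ^ (-(coxeterLength w : ℂ)
    + 2 * (f : ℂ) * ((parabolicLength (initialIndices n) w / f : ℕ) : ℂ) * s) with hc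
  set G : Perm (Fin n) → (Fin (n - 1) → ℕ) → ℂ := fun w d =>
    ∏ j : Fin (n - 1), numericalDatum p n s ((j : ℕ) + 1) ^ descentIncrements w d j with hG
  have h1 : ∀ w, Summable fun d => ‖c w * G w d‖ := fun w => by
    simp only [norm_mul]
    exact (tsum_increments hp hs w).1.mul_left _
  have h2 : Summable fun x : {w // w ∈ firstLetterLE n f} × (Fin (n - 1) → ℕ) =>
      ‖c x.1.1 * G x.1.1 x.2‖ :=
    (summable_prod_of_nonneg fun _ => norm_nonneg _).2 ⟨fun w => h1 w.1, Summable.of_finite⟩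
  have h3 : ∀ w, ∑' d, c w * G w d = c w * (∏ j ∈ descentSet w, numericalDatum p n s (j + 1)) /
      ∏ j : Fin (n - 1), (1 - numericalDatum p n s (j + 1)) := fun w => by
    rw [tsum_mul_left, (tsum_increments hp hs w).2, mul_div_assoc]
  calc _ = ∑' x : {w // w ∈ firstLetterLE n f} × (Fin (n - 1) → ℕ), c x.1.1 * G x.1.1 x.2 :=
        tsum_congr fun x => term_sortedTuple hp hn hn0 x.1.1 x.2
    _ = ∑ w : {w // w ∈ firstLetterLE n f}, ∑' d, c w.1 * G w.1 d := by
        rw [h2.of_norm.tsum_prod' fun w => (h1 w.1).of_norm, tsum_fintype]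
    _ = _ := by
        rw [cancelledNumerator, Finset.sum_div, ← Finset.sum_coe_sort (firstLetterLE n f)]
        exact Finset.sum_congr rfl fun w _ => h3 w.1

end Terms

namespace PeriodicFlag

variable {A : Type*} [AddCommGroup A] {p n e f : ℕ} (Φ : PeriodicFlag A p n) {s : ℂ}

lemma index_F (m : ℕ) : (Φ.F m).index = p ^ m := by
  induction m with
  | zero => simp [Φ.zero]
  | succ m ih => rw [← AddSubgroup.relIndex_mul_index (Φ.succ_le m), ih, Φ.relIndex_succ, pow_succ']

lemma conductorExponent_latticeType_le_iff (hp : p.Prime) (hn : 0 < n) (hf : 0 < f)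
    {L : AddSubgroup A} (hL : L.FiniteIndex) (k : ℕ) :
    conductorExponent f (Φ.latticeType L) ≤ k ↔ Φ.F (f * k) ≤ L := by
  rw [conductorExponent_le_iff hf, Φ.F_le_iff hp hn hL]

/-- The lattices not contained in `F f` are those whose type has an entry `0` among the first
`f`. -/
lemma not_le_F_iff (hp : p.Prime) (hn : 0 < n) (hfn : f ≤ n) {L : AddSubgroup A}
    (hL : L.FiniteIndex) :
    ¬ L ≤ Φ.F f ↔ ∃ i : Fin n, (i : ℕ) < f ∧ Φ.latticeType L i = 0 := by
  rw [Φ.le_F_iff hp hn hL]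
  push Not
  have key : ∀ i : Fin n, (i : ℕ) ∉ gapSet (Φ.latticeType L) ↔ Φ.latticeType L i = 0 := fun i => by
    have := mem_gapSet (Φ.latticeType L) 0 i
    rw [mul_zero, zero_add] at this
    rw [this]
    omega
  constructor
  · rintro ⟨h, hh, hG⟩
    exact ⟨⟨h, hh.trans_le hfn⟩, hh, (key _).1 hG⟩
  · rintro ⟨i, hi, h0⟩
    exact ⟨i, hi, (key i).2 h0⟩

lemma range_shift (φ : A →+ A)
    (hφF : ∀ k, Φ.F (f * (k + 1)) = (Φ.F (f * k)).map φ) : φ.range = Φ.F f := by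
  have := hφF 0
  rw [mul_zero, Φ.zero, zero_add, mul_one, ← AddMonoidHom.range_eq_map] at this
  exact this.symm

lemma index_map_shift (φ : A →+ A) (hφ : Function.Injective φ)
    (hφF : ∀ k, Φ.F (f * (k + 1)) = (Φ.F (f * k)).map φ) (L : AddSubgroup A) :
    (L.map φ).index = L.index * p ^ f := by
  rw [AddSubgroup.index_map_of_injective _ hφ, Φ.range_shift φ hφF, Φ.index_F]

/-- The map `L ↦ φ(L)` from all lattices to those contained in `φ(A)`. -/
noncomputable def shiftEquiv (φ : A →+ A) (hφ : Function.Injective φ)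
    (hφF : ∀ k, Φ.F (f * (k + 1)) = (Φ.F (f * k)).map φ) (hp : p.Prime) :
    {L : AddSubgroup A // L.FiniteIndex} ≃
      {L : {L : AddSubgroup A // L.FiniteIndex} // L.1 ≤ Φ.F f} :=
  Equiv.ofBijective (fun L => ⟨⟨L.1.map φ, ⟨by
      rw [Φ.index_map_shift φ hφ hφF]
      exact mul_ne_zero L.2.index_ne_zero (pow_ne_zero _ hp.ne_zero)⟩⟩, by
      rw [← Φ.range_shift φ hφF]
      exact AddSubgroup.map_le_range φ L.1⟩) <| by
    constructor
    · rintro L L' h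
      exact Subtype.ext (AddSubgroup.map_injective hφ (congrArg (fun x => x.1.1) h))
    · rintro ⟨⟨L, hL⟩, hLF⟩
      rw [← Φ.range_shift φ hφF] at hLF
      have h1 : (L.comap φ).map φ = L := AddSubgroup.map_comap_eq_self hLF
      refine ⟨⟨L.comap φ, ⟨fun h0 => ?_⟩⟩, Subtype.ext (Subtype.ext h1)⟩
      apply hL.index_ne_zero
      rw [← h1, Φ.index_map_shift φ hφ hφF, h0, zero_mul]

/-- Applying `φ` multiplies the index by `p^f` and raises the conductor exponent by one, so it
multiplies the contribution of a lattice by `p^{f(2n - 3s)}`. -/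
lemma latticeTerm_map_shift (φ : A →+ A) (hφ : Function.Injective φ)
    (hφF : ∀ k, Φ.F (f * (k + 1)) = (Φ.F (f * k)).map φ) (hp : p.Prime) (hn : 0 < n)
    (hf : 0 < f) (s : ℂ) {L : AddSubgroup A} (hL : L.FiniteIndex) :
    latticeTerm p f s (Φ.latticeType (L.map φ)) =
      (p : ℂ) ^ ((f : ℂ) * (2 * (n : ℂ) - 3 * s)) * latticeTerm p f s (Φ.latticeType L) := by
  have hp0 : (p : ℂ) ≠ 0 := by exact_mod_cast hp.ne_zero
  have hi := Φ.index_map_shift φ hφ hφF L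
  have hL' : (L.map φ).FiniteIndex :=
    ⟨hi ▸ mul_ne_zero hL.index_ne_zero (pow_ne_zero _ hp.ne_zero)⟩
  rw [Φ.index_eq_pow hp hn hL, Φ.index_eq_pow hp hn hL', ← pow_add] at hi
  have ht := Nat.pow_right_injective hp.two_le hi
  have hk : conductorExponent f (Φ.latticeType (L.map φ)) =
      conductorExponent f (Φ.latticeType L) + 1 := by
    refine eq_of_forall_ge_iff fun k => ?_
    rw [Φ.conductorExponent_latticeType_le_iff hp hn hf hL']
    cases k with
    | zero =>
      rw [mul_zero, Φ.zero, top_le_iff, ← AddSubgroup.index_eq_one, Φ.index_map_shift φ hφ hφF]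
      have h1 : 1 < p ^ f := Nat.one_lt_pow hf.ne' hp.one_lt
      have h2 := hL.index_ne_zero
      refine iff_of_false (fun h => ?_) (by omega)
      have := Nat.eq_one_of_mul_eq_one_left h
      omega
    | succ k =>
      rw [hφF, AddSubgroup.map_le_map_iff_of_injective hφ, Nat.add_le_add_iff_right,
        Φ.conductorExponent_latticeType_le_iff hp hn hf hL]
  rw [latticeTerm, latticeTerm, ht, hk, ← Complex.cpow_add _ _ hp0]
  congr 1
  push_cast
  ring

/-- The zeta function `∑_L |A : L|^{2n - s} p^{-2fk(L)s}`. Multiplication by `φ` turns the sum over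
all lattices into the sum over the lattices in `φ(A)`, so only the lattices not contained in `φ(A)`
have to be counted. -/
theorem tsum_latticeTerm (φ : A →+ A) (hφ : Function.Injective φ)
    (hφF : ∀ k, Φ.F (f * (k + 1)) = (Φ.F (f * k)).map φ) (hp : p.Prime) (hn : n = e * f)
    (hn0 : 0 < n) (hs : 2 * (n : ℝ) - 1 < s.re) :
    (Summable fun L : {L : AddSubgroup A // L.FiniteIndex} =>
      ‖latticeTerm p f s (Φ.latticeType L.1)‖) ∧
    cancelledDenominator p n f s ≠ 0 ∧
    ∑' L : {L : AddSubgroup A // L.FiniteIndex}, latticeTerm p f s (Φ.latticeType L.1) =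
      cancelledNumerator p n f s / cancelledDenominator p n f s := by
  classical
  have hf : 0 < f := Nat.pos_of_ne_zero (by rintro rfl; omega)
  have he : 0 < e := Nat.pos_of_ne_zero (by rintro rfl; omega)
  have hfn : f ≤ n := hn ▸ Nat.le_mul_of_pos_left f he
  have hn1 : (1 : ℝ) ≤ n := by exact_mod_cast hn0
  set q := (p : ℂ) ^ ((f : ℂ) * (2 * (n : ℂ) - 3 * s)) with hq
  have hq1 : 1 - q ≠ 0 := one_sub_ne_zero_of_norm_lt_one (norm_cpow_shift_lt_one hp hf hn0 hs)
  have hx1 : ∏ j : Fin (n - 1), (1 - numericalDatum p n s (j + 1)) ≠ 0 :=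
    Finset.prod_ne_zero_iff.2 fun j _ => one_sub_ne_zero_of_norm_lt_one
      (norm_numericalDatum_lt_one hp hs (by omega) (by omega))
  have hsum := Φ.summable_of_norm_le hp hn0 (latticeTerm p f s) (3 * s.re - 2 * n) (by linarith)
    (norm_latticeTerm_le hp hf (by linarith))
  refine ⟨hsum, ?_, ?_⟩
  · rw [cancelledDenominator_eq]
    exact mul_ne_zero hq1 hx1
  set W := fun L : {L : AddSubgroup A // L.FiniteIndex} => latticeTerm p f s (Φ.latticeType L.1)
    with hW
  have hsplit := (hsum.of_norm : Summable W).tsum_subtype_add_tsum_subtype_compl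
    {L | L.1 ≤ Φ.F f}
  have h1 : ∑' L : {L : {L : AddSubgroup A // L.FiniteIndex} // L.1 ≤ Φ.F f}, W L.1 =
      q * ∑' L, W L := by
    rw [← (Φ.shiftEquiv φ hφ hφF hp).tsum_eq, ← tsum_mul_left]
    exact tsum_congr fun L => Φ.latticeTerm_map_shift φ hφ hφF hp hn0 hf s L.2
  set S : Set (Fin n → ℕ) := {a | ∃ i : Fin n, (i : ℕ) < f ∧ a i = 0} with hS
  have h2 : ∑' L : ({L | L.1 ≤ Φ.F f}ᶜ : Set {L : AddSubgroup A // L.FiniteIndex}), W L.1 =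
      ∑' a : S, ((p ^ gapExponent n 0 (gapSet a.1) : ℕ) : ℂ) * latticeTerm p f s a.1 := by
    rw [tsum_subtype {L : {L : AddSubgroup A // L.FiniteIndex} | L.1 ≤ Φ.F f}ᶜ W,
      tsum_subtype S fun a => ((p ^ gapExponent n 0 (gapSet a) : ℕ) : ℂ) * latticeTerm p f s a]
    have e1 : ∀ L, Set.indicator {L : {L : AddSubgroup A // L.FiniteIndex} | L.1 ≤ Φ.F f}ᶜ W L =
        S.indicator (latticeTerm p f s) (Φ.latticeType L.1) := fun L => by
      have := Φ.not_le_F_iff hp hn0 hfn L.2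
      simp only [Set.indicator, Set.mem_compl_iff, hS]
      exact if_congr this rfl rfl
    rw [tsum_congr e1, tsum_comp_eq
      (fun L : {L : AddSubgroup A // L.FiniteIndex} => Φ.latticeType L.1)
      (S.indicator (latticeTerm p f s))]
    · refine tsum_congr fun a => ?_
      rw [Φ.card_latticeType_fiber hp hn0]
      by_cases ha : a ∈ S
      · simp [ha]
      · simp [ha]
    · refine Summable.of_nonneg_of_le (fun _ => norm_nonneg _) (fun L => ?_) hsum
      exact norm_indicator_le_norm_self _ _
  -- the functional equation of the sum `Z` over all lattices: `Z = q Z + Z'`, with `Z'` the sum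
  -- over the lattices not contained in `φ(A)`
  have h3 : ∑' L, W L = q * ∑' L, W L +
      cancelledNumerator p n f s / ∏ j : Fin (n - 1), (1 - numericalDatum p n s (j + 1)) := by
    rw [← tsum_types hp hn hn0 hs]
    refine hsplit.symm.trans (congrArg₂ (· + ·) h1 h2)
  rw [cancelledDenominator_eq, ← hq, eq_div_iff (mul_ne_zero hq1 hx1)]
  rw [← sub_eq_iff_eq_add', eq_div_iff hx1] at h3
  rw [← h3]
  ring

end PeriodicFlag

/-! ### Construction of periodic flags -/

section Chain

variable {A : Type*} [AddCommGroup A] {p : ℕ}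

/-- A subgroup of index `p^f` is the end of a chain with steps of index `p`. -/
lemma exists_chain (hp : p.Prime) (f : ℕ) (K : AddSubgroup A) (hK : K.index = p ^ f) :
    ∃ H : ℕ → AddSubgroup A, H 0 = ⊤ ∧ H f = K ∧
      ∀ i < f, H (i + 1) ≤ H i ∧ (H (i + 1)).relIndex (H i) = p := by
  induction f generalizing K with
  | zero => exact ⟨fun _ => ⊤, rfl, (AddSubgroup.index_eq_one.1 (by simpa using hK)).symm, by simp⟩
  | succ f ih =>
    have : Fact p.Prime := ⟨hp⟩
    have : Finite (A ⧸ K) := by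
      refine (Nat.card_ne_zero.1 ?_).2
      rw [← AddSubgroup.index_eq_card, hK]
      exact pow_ne_zero _ hp.ne_zero
    obtain ⟨x, hx⟩ := exists_prime_addOrderOf_dvd_card' (G := A ⧸ K) p
      (show p ∣ K.index from hK ▸ dvd_pow_self p (Nat.succ_ne_zero f))
    set K' := (AddSubgroup.zmultiples x).comap (QuotientAddGroup.mk' K) with hK'
    have hKK' : K ≤ K' := fun y hy => by
      rw [hK', AddSubgroup.mem_comap, QuotientAddGroup.mk'_apply,
        (QuotientAddGroup.eq_zero_iff y).2 hy]
      exact zero_mem _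
    have hrel : K.relIndex K' = p := by
      conv_lhs => rw [← QuotientAddGroup.ker_mk' K, ← AddMonoidHom.comap_bot,
        AddSubgroup.relIndex_comap, hK',
        AddSubgroup.map_comap_eq_self_of_surjective (QuotientAddGroup.mk'_surjective K),
        AddSubgroup.relIndex_bot_left, Nat.card_zmultiples, hx]
    have hind : K'.index = p ^ f := by
      have h := AddSubgroup.relIndex_mul_index hKK'
      rw [hrel, hK, pow_succ'] at h
      exact Nat.eq_of_mul_eq_mul_left hp.pos h
    obtain ⟨H, h0, hf, hH⟩ := ih K' hind
    refine ⟨fun i => if i ≤ f then H i else K, by simpa using h0, by simp, fun i hi => ?_⟩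
    rcases (Nat.lt_succ_iff.1 hi).eq_or_lt with rfl | hi
    · simp [hf, hKK', hrel]
    · simpa [hi.le, Nat.succ_le_of_lt hi] using hH i hi

/-- The periodic extension of a chain `H 0, …, H n` by an endomorphism `φ`. -/
def extendChain (φ : A →+ A) (n : ℕ) (H : ℕ → AddSubgroup A) (m : ℕ) : AddSubgroup A :=
  (AddSubgroup.map φ)^[m / n] (H (m % n))

variable {φ : A →+ A} {n : ℕ} {H : ℕ → AddSubgroup A}

lemma extendChain_add (hn : 0 < n) (m : ℕ) :
    extendChain φ n H (m + n) = (extendChain φ n H m).map φ := by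
  rw [extendChain, extendChain, Nat.add_mod_right, Nat.add_div_right _ hn,
    Function.iterate_succ_apply']

lemma extendChain_of_le (hn : 0 < n) (h0 : H 0 = ⊤) (hlast : H n = φ.range) {m : ℕ} (hm : m ≤ n) :
    extendChain φ n H m = H m := by
  rcases hm.eq_or_lt with rfl | hm
  · have h := extendChain_add (φ := φ) (H := H) hn 0
    rw [zero_add] at h
    rw [h, hlast, AddMonoidHom.range_eq_map]
    simp [extendChain, h0]
  · simp [extendChain, Nat.mod_eq_of_lt hm, Nat.div_eq_of_lt hm]

lemma extendChain_step (hn : 0 < n) (h0 : H 0 = ⊤) (hlast : H n = φ.range)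
    (hφ : Function.Injective φ)
    (hH : ∀ i < n, H (i + 1) ≤ H i ∧ (H (i + 1)).relIndex (H i) = p) (m : ℕ) :
    extendChain φ n H (m + 1) ≤ extendChain φ n H m ∧
      (extendChain φ n H (m + 1)).relIndex (extendChain φ n H m) = p := by
  induction m using Nat.strong_induction_on with
  | _ m ih =>
    rcases lt_or_ge m n with hm | hm
    · rw [extendChain_of_le hn h0 hlast hm.le, extendChain_of_le hn h0 hlast hm]
      exact hH m hm
    · obtain ⟨k, rfl⟩ := Nat.exists_eq_add_of_le' hm
      obtain ⟨h1, h2⟩ := ih k (by omega)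
      rw [show k + n + 1 = k + 1 + n by omega, extendChain_add hn, extendChain_add hn,
        AddSubgroup.relIndex_map_map_of_injective _ _ hφ]
      exact ⟨AddSubgroup.map_mono h1, h2⟩

/-- The periodic flag extending a chain from `A` to `p • A`. -/
def PeriodicFlag.ofChain (hn : 0 < n) (h0 : H 0 = ⊤)
    (hlast : H n = (nsmulAddMonoidHom (α := A) p).range)
    (hinj : Function.Injective (nsmulAddMonoidHom (α := A) p))
    (hH : ∀ i < n, H (i + 1) ≤ H i ∧ (H (i + 1)).relIndex (H i) = p)
    (hcof : ∀ L : AddSubgroup A, L.FiniteIndex → ∃ k, ∀ x, p ^ k • x ∈ L) :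
    PeriodicFlag A p n where
  F := extendChain (nsmulAddMonoidHom p) n H
  zero := by rw [extendChain_of_le hn h0 hlast (Nat.zero_le _), h0]
  succ_le m := (extendChain_step hn h0 hlast hinj hH m).1
  relIndex_succ m := (extendChain_step hn h0 hlast hinj hH m).2
  period := extendChain_add hn
  nsmul_injective := hinj
  cofinal L hL := by
    obtain ⟨k, hk⟩ := hcof L hL
    have h : ∀ k x, x ∈ extendChain (nsmulAddMonoidHom p) n H (k * n) → ∃ y, x = p ^ k • y := by
      intro k
      induction k with
      | zero => exact fun x _ => ⟨x, by simp⟩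
      | succ k ih =>
        intro x hx
        rw [add_mul, one_mul, extendChain_add hn] at hx
        obtain ⟨z, hz, rfl⟩ := hx
        obtain ⟨y, rfl⟩ := ih z hz
        exact ⟨y, by rw [pow_succ', mul_smul]; rfl⟩
    refine ⟨k * n, fun x hx => ?_⟩
    obtain ⟨y, rfl⟩ := h k x hx
    exact hk y

end Chain

section PadicModule

variable {p : ℕ} [hp : Fact p.Prime] {A : Type*} [AddCommGroup A] [Module ℤ_[p] A]

/-- If `N A ≤ L` for some `N ≠ 0`, then `p^k A ≤ L` for some `k`, because `N` is a power of `p`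
times a unit of `ℤ_p`. -/
lemma exists_pow_smul_mem {L : AddSubgroup A} {N : ℕ} (hN : N ≠ 0) (h : ∀ x, N • x ∈ L) :
    ∃ k, ∀ x, p ^ k • x ∈ L := by
  have hN' : (N : ℤ_[p]) ≠ 0 := by exact_mod_cast hN
  refine ⟨(N : ℤ_[p]).valuation, fun x => ?_⟩
  have h1 := h ((↑(PadicInt.unitCoeff hN')⁻¹ : ℤ_[p]) • x)
  rw [← Nat.cast_smul_eq_nsmul ℤ_[p], smul_smul] at h1
  conv at h1 => enter [2, 1, 1]; rw [PadicInt.unitCoeff_spec hN']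
  rw [mul_right_comm, Units.mul_inv, one_mul] at h1
  rw [← Nat.cast_smul_eq_nsmul ℤ_[p], Nat.cast_pow]
  exact h1

lemma exists_pow_smul_mem_of_finiteIndex (L : AddSubgroup A) (hL : L.FiniteIndex) :
    ∃ k, ∀ x, p ^ k • x ∈ L :=
  exists_pow_smul_mem hL.index_ne_zero fun x => L.nsmul_index_mem x

lemma nsmul_injective_of_isTorsionFree [Module.IsTorsionFree ℤ_[p] A] :
    Function.Injective (nsmulAddMonoidHom (α := A) p) := by
  intro x y h
  have h : p • x = p • y := h
  rw [← Nat.cast_smul_eq_nsmul ℤ_[p], ← Nat.cast_smul_eq_nsmul ℤ_[p]] at h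
  exact smul_right_injective A (r := (p : ℤ_[p])) (by exact_mod_cast hp.1.ne_zero) h

variable (p) in
lemma toAddSubgroup_maximalIdeal_padicInt :
    (IsLocalRing.maximalIdeal ℤ_[p]).toAddSubgroup = (nsmulAddMonoidHom (α := ℤ_[p]) p).range := by
  ext x
  rw [PadicInt.maximalIdeal_eq_span_p, Submodule.mem_toAddSubgroup, Ideal.mem_span_singleton']
  simp [mul_comm]

variable (p) in
lemma card_quotient_maximalIdeal_padicInt :
    Nat.card (ℤ_[p] ⧸ IsLocalRing.maximalIdeal ℤ_[p]) = p :=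
  (Nat.card_congr (PadicInt.residueField (p := p)).toEquiv).trans (Nat.card_zmod p)

variable (p A) in
lemma index_range_nsmul [Module.Free ℤ_[p] A] [Module.Finite ℤ_[p] A] :
    (nsmulAddMonoidHom (α := A) p).range.index = p ^ Module.finrank ℤ_[p] A := by
  let e := (Module.finBasis ℤ_[p] A).equivFun.toAddEquiv
  have h1 : (nsmulAddMonoidHom (α := A) p).range.map
      (e : A →+ (Fin (Module.finrank ℤ_[p] A) → ℤ_[p])) =
      AddSubgroup.pi Set.univ fun _ => (IsLocalRing.maximalIdeal ℤ_[p]).toAddSubgroup := by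
    ext x
    rw [toAddSubgroup_maximalIdeal_padicInt, AddSubgroup.mem_pi]
    constructor
    · rintro ⟨_, ⟨y, rfl⟩, rfl⟩ i -
      exact ⟨e y i, by simp⟩
    · intro h
      choose y hy using fun i => h i (Set.mem_univ i)
      refine ⟨p • e.symm y, ⟨_, rfl⟩, ?_⟩
      funext i
      rw [← hy i]
      simp
  rw [← AddSubgroup.index_map_equiv _ e, h1, AddSubgroup.index_pi, Finset.prod_const,
    Finset.card_univ, Fintype.card_fin]
  congr 1
  exact card_quotient_maximalIdeal_padicInt p

/-- A finitely generated free `ℤ_p`-module of positive rank has a periodic flag. -/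
lemma exists_periodicFlag [Module.Free ℤ_[p] A] [Module.Finite ℤ_[p] A] {n : ℕ} (hn : 0 < n)
    (h : Module.finrank ℤ_[p] A = n) : Nonempty (PeriodicFlag A p n) := by
  obtain ⟨H, h0, hlast, hH⟩ := exists_chain hp.1 n _ (h ▸ index_range_nsmul p A)
  exact ⟨PeriodicFlag.ofChain hn h0 hlast nsmul_injective_of_isTorsionFree hH
    exists_pow_smul_mem_of_finiteIndex⟩

end PadicModule

section Ring

variable {p : ℕ} [hp : Fact p.Prime] {R : Type*} [CommRing R]

lemma map_mulLeft_toAddSubgroup (x : R) (I : Ideal R) :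
    I.toAddSubgroup.map (AddMonoidHom.mulLeft x) = (Ideal.span {x} * I).toAddSubgroup := by
  ext y
  simp [Ideal.mem_span_singleton_mul]

lemma nsmulAddMonoidHom_eq_mulLeft (p : ℕ) :
    nsmulAddMonoidHom (α := R) p = AddMonoidHom.mulLeft (p : R) := by
  ext x
  simp

variable [IsDomain R] [IsDiscreteValuationRing R] [Algebra ℤ_[p] R]

open IsLocalRing

variable (p R) in
lemma isTorsionFree_of_charZero [CharZero R] : Module.IsTorsionFree ℤ_[p] R := by
  refine Module.isTorsionFree_iff_faithfulSMul.2 ?_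
  rw [faithfulSMul_iff_algebraMap_injective, injective_iff_map_eq_zero]
  intro x hx
  by_contra h0
  rw [PadicInt.unitCoeff_spec h0, map_mul, map_pow, map_natCast] at hx
  have h1 : IsUnit (algebraMap ℤ_[p] R (PadicInt.unitCoeff h0)) :=
    (PadicInt.unitCoeff h0).isUnit.map _
  rcases mul_eq_zero.1 hx with h | h
  · exact h1.ne_zero h
  · exact hp.1.ne_zero (by exact_mod_cast eq_zero_of_pow_eq_zero h)

variable [Module.Finite ℤ_[p] R]

variable (p R) in
lemma liesOver_maximalIdeal : (maximalIdeal R).LiesOver (maximalIdeal ℤ_[p]) :=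
  ⟨((Ideal.isMaximal_comap_of_isIntegral_of_isMaximal (R := ℤ_[p]) (maximalIdeal R)) |>
    IsLocalRing.eq_maximalIdeal).symm⟩

/-- The residue field has `p^f` elements. -/
lemma index_maximalIdeal {f : ℕ} (hf : (maximalIdeal R).inertiaDeg ℤ_[p] = f) :
    (maximalIdeal R).toAddSubgroup.index = p ^ f := by
  have := liesOver_maximalIdeal p R
  rw [Ideal.inertiaDeg_eq_of_isMaximal (maximalIdeal ℤ_[p]) (maximalIdeal R)] at hf
  let : Field (ℤ_[p] ⧸ maximalIdeal ℤ_[p]) := Ideal.Quotient.field _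
  have h := Module.natCard_eq_pow_finrank (K := ℤ_[p] ⧸ maximalIdeal ℤ_[p])
    (V := R ⧸ maximalIdeal R)
  rw [card_quotient_maximalIdeal_padicInt] at h
  rw [← hf]
  exact h

variable {e f n : ℕ}

lemma degree_pos (he : Ideal.span {(p : R)} = maximalIdeal R ^ e)
    (hf : (maximalIdeal R).inertiaDeg ℤ_[p] = f) (hn : n = e * f) :
    0 < f ∧ 0 < n := by
  have hf0 : 0 < f := hf ▸ Ideal.inertiaDeg_pos (maximalIdeal R) ℤ_[p]
  refine ⟨hf0, hn ▸ Nat.mul_pos (Nat.pos_of_ne_zero ?_) hf0⟩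
  rintro rfl
  have := liesOver_maximalIdeal p R
  have h1 : (p : ℤ_[p]) ∈ maximalIdeal ℤ_[p] := by
    rw [PadicInt.maximalIdeal_eq_span_p]
    exact Ideal.mem_span_singleton_self _
  rw [Ideal.mem_of_liesOver (maximalIdeal R) (maximalIdeal ℤ_[p]), map_natCast] at h1
  rw [pow_zero, Ideal.one_eq_top, Ideal.span_singleton_eq_top] at he
  exact h1 he

/-- The periodic flag of `R`: it refines the chain of the powers of the maximal ideal. -/
lemma exists_periodicFlag_ring [CharZero R]
    (he : Ideal.span {(p : R)} = maximalIdeal R ^ e)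
    (hf : (maximalIdeal R).inertiaDeg ℤ_[p] = f) (hn : n = e * f) :
    ∃ Φ : PeriodicFlag R p n,
    ∀ k, Φ.F (f * k) = (maximalIdeal R ^ k).toAddSubgroup := by
  obtain ⟨hf0, hn0⟩ := degree_pos he hf hn
  have := isTorsionFree_of_charZero p R
  obtain ⟨π, hπ⟩ := IsDiscreteValuationRing.exists_irreducible R
  have hm : maximalIdeal R = Ideal.span {π} := hπ.maximalIdeal_eq
  obtain ⟨H, h0, hlast, hH⟩ := exists_chain hp.1 f _ (index_maximalIdeal hf)
  have hlast' : H f = (AddMonoidHom.mulLeft π).range := by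
    rw [hlast, hm, AddMonoidHom.range_eq_map, ← Ideal.mul_top (Ideal.span {π}),
      ← map_mulLeft_toAddSubgroup, Submodule.top_toAddSubgroup]
  have hinj : Function.Injective (AddMonoidHom.mulLeft π) := mul_right_injective₀ hπ.ne_zero
  set H' := extendChain (AddMonoidHom.mulLeft π) f H with hH'
  have hpow : ∀ k, H' (f * k) = (maximalIdeal R ^ k).toAddSubgroup := by
    intro k
    induction k with
    | zero =>
      rw [mul_zero, pow_zero, Ideal.one_eq_top, Submodule.top_toAddSubgroup, hH',
        extendChain_of_le hf0 h0 hlast' (Nat.zero_le _), h0]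
    | succ k ih =>
      rw [mul_add, mul_one, hH', extendChain_add hf0, ← hH', ih, map_mulLeft_toAddSubgroup, ← hm,
        pow_succ']
  have h0' : H' 0 = ⊤ := by simpa using hpow 0
  have hlast'' : H' n = (nsmulAddMonoidHom (α := R) p).range := by
    rw [hn, mul_comm, hpow, nsmulAddMonoidHom_eq_mulLeft, AddMonoidHom.range_eq_map, ← he,
      ← Submodule.top_toAddSubgroup (R := R), map_mulLeft_toAddSubgroup, Ideal.mul_top]
  refine ⟨PeriodicFlag.ofChain hn0 h0' hlast'' nsmul_injective_of_isTorsionFree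
    (fun i _ => extendChain_step hf0 h0 hlast' hinj hH i) exists_pow_smul_mem_of_finiteIndex,
    fun k => ?_⟩
  change extendChain _ n H' (f * k) = _
  induction k using Nat.strong_induction_on with
  | _ k ih =>
    rcases le_or_gt k e with hk | hk
    · rw [extendChain_of_le hn0 h0' hlast'' (by rw [hn, mul_comm]; exact Nat.mul_le_mul_right f hk),
        hpow]
    · obtain ⟨j, rfl⟩ := Nat.exists_eq_add_of_le' hk.le
      have he0 : 0 < e := Nat.pos_of_ne_zero (by rintro rfl; omega)
      rw [mul_add, mul_comm f e, ← hn, extendChain_add hn0, ih j (by omega),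
        nsmulAddMonoidHom_eq_mulLeft, map_mulLeft_toAddSubgroup, he, ← pow_add, add_comm]

/-- Both sides compute the index of `p R`. -/
lemma finrank_eq [CharZero R] (he : Ideal.span {(p : R)} = maximalIdeal R ^ e)
    (hf : (maximalIdeal R).inertiaDeg ℤ_[p] = f) (hn : n = e * f) :
    Module.finrank ℤ_[p] R = n := by
  obtain ⟨Φ, -⟩ := exists_periodicFlag_ring he hf hn
  have := isTorsionFree_of_charZero p R
  have h1 := Φ.index_F (0 + n)
  rw [Φ.period, Φ.zero, ← AddMonoidHom.range_eq_map, index_range_nsmul, zero_add] at h1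
  exact Nat.pow_right_injective hp.1.two_le h1

end Ring

/-! ### Normal subgroups of the Heisenberg group -/

namespace Heisenberg

variable {R : Type*} [CommRing R]

/-- The element `(a, b, c)` of the Heisenberg group, with product
`(a, b, c) (a', b', c') = (a + a', b + b', c + c' + a b')`. -/
def mk (a b c : R) : heisenbergGroup R :=
  ⟨⟨!![1, a, c; 0, 1, b; 0, 0, 1], by simp [Matrix.det_fin_three]⟩, a, b, c, rfl⟩

/-- The coordinate `a` of `(a, b, c)`. -/
def fst (g : heisenbergGroup R) : R := g.1.1 0 1

/-- The coordinate `b` of `(a, b, c)`. -/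
def snd (g : heisenbergGroup R) : R := g.1.1 1 2

/-- The coordinate `c` of `(a, b, c)`. -/
def ctr (g : heisenbergGroup R) : R := g.1.1 0 2

@[simp] lemma fst_mk (a b c : R) : fst (mk a b c) = a := by simp [fst, mk]
@[simp] lemma snd_mk (a b c : R) : snd (mk a b c) = b := by simp [snd, mk]
@[simp] lemma ctr_mk (a b c : R) : ctr (mk a b c) = c := by simp [ctr, mk]

@[simp]
lemma mk_coords (g : heisenbergGroup R) : mk (fst g) (snd g) (ctr g) = g := by
  obtain ⟨g, a, b, c, hg⟩ := g
  apply Subtype.ext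
  apply Subtype.ext
  simp only [mk, fst, snd, ctr, hg]
  simp

@[ext]
lemma ext {g h : heisenbergGroup R} (h1 : fst g = fst h) (h2 : snd g = snd h)
    (h3 : ctr g = ctr h) : g = h := by
  rw [← mk_coords g, ← mk_coords h, h1, h2, h3]

@[simp]
lemma mk_mul_mk (a b c a' b' c' : R) :
    mk a b c * mk a' b' c' = mk (a + a') (b + b') (c + c' + a * b') := by
  apply Subtype.ext
  apply Subtype.ext
  change !![1, a, c; 0, 1, b; 0, 0, 1] * !![1, a', c'; 0, 1, b'; 0, 0, 1] = _
  ext i j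
  fin_cases i <;> fin_cases j <;>
    simp [mk, Matrix.mul_apply, Fin.sum_univ_three] <;> ring

lemma one_eq : (1 : heisenbergGroup R) = mk 0 0 0 := by
  have h : mk (0 : R) 0 0 * mk 0 0 0 = mk 0 0 0 := by simp
  exact (mul_eq_left.1 h).symm

@[simp]
lemma mk_inv (a b c : R) : (mk a b c)⁻¹ = mk (-a) (-b) (a * b - c) := by
  rw [inv_eq_iff_mul_eq_one, mk_mul_mk, one_eq]
  congr 1 <;> ring

/-- The projection `(a, b, c) ↦ (a, b)` onto the abelianization. -/
def proj : heisenbergGroup R →* Multiplicative (R × R) :=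
  MonoidHom.mk' (fun g => Multiplicative.ofAdd (fst g, snd g)) fun g h => by
    rw [← mk_coords g, ← mk_coords h, mk_mul_mk]
    simp [← ofAdd_add]

/-- The embedding `c ↦ (0, 0, c)` of the centre. -/
def central : Multiplicative R →* heisenbergGroup R :=
  MonoidHom.mk' (fun c => mk 0 0 c.toAdd) fun c d => by simp

/-- The image of a subgroup in `R × R`. -/
def image (N : Subgroup (heisenbergGroup R)) : AddSubgroup (R × R) :=
  AddSubgroup.toSubgroup.symm (N.map proj)

/-- The intersection of a subgroup with the centre, as a subgroup of `R`. -/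
def centre (N : Subgroup (heisenbergGroup R)) : AddSubgroup R :=
  AddSubgroup.toSubgroup.symm (N.comap central)

lemma mem_image {N : Subgroup (heisenbergGroup R)} {x : R × R} :
    x ∈ image N ↔ ∃ c, mk x.1 x.2 c ∈ N := by
  constructor
  · rintro ⟨g, hg, h⟩
    have h : (fst g, snd g) = x := h
    refine ⟨ctr g, ?_⟩
    rw [← h]
    simpa using hg
  · rintro ⟨c, hc⟩
    exact ⟨_, hc, by simp [proj]; rfl⟩

lemma mem_centre {N : Subgroup (heisenbergGroup R)} {c : R} : c ∈ centre N ↔ mk 0 0 c ∈ N :=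
  Iff.rfl

lemma ker_proj : (proj (R := R)).ker = (central (R := R)).range := by
  ext g
  rw [MonoidHom.mem_ker, MonoidHom.mem_range]
  constructor
  · intro h
    have h : (fst g, snd g) = (0, 0) := h
    rw [Prod.ext_iff] at h
    exact ⟨Multiplicative.ofAdd (ctr g), ext (by simpa [central] using h.1.symm)
      (by simpa [central] using h.2.symm) (by simp [central])⟩
  · rintro ⟨c, rfl⟩
    simp [central, proj]

lemma index_eq (N : Subgroup (heisenbergGroup R)) [N.Normal] :
    N.index = (centre N).index * (image N).index := by
  have h1 : (image N).index = (N.map proj).index := by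
    rw [← AddSubgroup.index_toSubgroup, image, OrderIso.apply_symm_apply]
  have h2 : (centre N).index = (N.comap central).index := by
    rw [← AddSubgroup.index_toSubgroup, centre, OrderIso.apply_symm_apply]
  have h3 : (proj (R := R)).range = ⊤ := MonoidHom.range_eq_top.2 fun x =>
    ⟨mk x.toAdd.1 x.toAdd.2 0, by simp [proj]⟩
  rw [h1, h2, Subgroup.index_map, h3, Subgroup.index_top, mul_one, Subgroup.index_comap,
    ← ker_proj, ← Subgroup.relIndex_sup_right (proj (R := R)).ker N, sup_comm,
    Subgroup.relIndex_mul_index le_sup_left]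

/-- The ideal generated by the coordinates of the image of a normal subgroup is contained in the
intersection with the centre, by taking commutators with `(0, -r, 0)` and `(r, 0, 0)`. -/
lemma mul_mem_centre {N : Subgroup (heisenbergGroup R)} [hN : N.Normal] {x : R × R}
    (hx : x ∈ image N) (r : R) : r * x.1 ∈ centre N ∧ r * x.2 ∈ centre N := by
  obtain ⟨c, hc⟩ := mem_image.1 hx
  have h1 := N.mul_mem (N.inv_mem hc) (hN.conj_mem _ hc (mk 0 (-r) 0))
  have h2 := N.mul_mem (N.inv_mem hc) (hN.conj_mem _ hc (mk r 0 0))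
  simp only [mk_mul_mk, mk_inv] at h1 h2
  rw [mem_centre, mem_centre]
  constructor
  · convert h1 using 1
    congr 1 <;> ring
  · convert h2 using 1
    congr 1 <;> ring

section Graph

variable (L : AddSubgroup R) (M : AddSubgroup (R × R))

/-- The normal subgroup attached to `L`, `M` and a homomorphism `φ : M → R / L`: the elements
`(a, b, c)` with `(a, b) ∈ M` and `c ∈ φ (a, b)`. It is a subgroup because `a b' ∈ L`
for `(a, b), (a', b') ∈ M`. -/
def graph (hM : ∀ x ∈ M, ∀ r : R, r * x.1 ∈ L) (φ : M →+ R ⧸ L) :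
    Subgroup (heisenbergGroup R) where
  carrier := {g | ∃ h : (fst g, snd g) ∈ M, φ ⟨_, h⟩ = ((ctr g : R) : R ⧸ L)}
  one_mem' := by
    rw [one_eq]
    simp only [Set.mem_ofPred_eq, fst_mk, snd_mk, ctr_mk]
    exact ⟨zero_mem M, φ.map_zero⟩
  mul_mem' := by
    intro g h
    rw [← mk_coords g, ← mk_coords h]
    simp only [Set.mem_ofPred_eq, mk_mul_mk, fst_mk, snd_mk, ctr_mk]
    rintro ⟨h1, h2⟩ ⟨h3, h4⟩
    refine ⟨add_mem h1 h3, ?_⟩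
    have h5 : ((fst g * snd h : R) : R ⧸ L) = 0 := by
      rw [QuotientAddGroup.eq_zero_iff, mul_comm]
      exact hM _ h1 _
    have h6 := φ.map_add ⟨_, h1⟩ ⟨_, h3⟩
    rw [h2, h4] at h6
    rw [QuotientAddGroup.mk_add, h5, add_zero, QuotientAddGroup.mk_add, ← h6]
    rfl
  inv_mem' := by
    intro g
    rw [← mk_coords g]
    simp only [Set.mem_ofPred_eq, mk_inv, fst_mk, snd_mk, ctr_mk]
    rintro ⟨h1, h2⟩
    refine ⟨neg_mem h1, ?_⟩
    have h5 : ((fst g * snd g : R) : R ⧸ L) = 0 := by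
      rw [QuotientAddGroup.eq_zero_iff, mul_comm]
      exact hM _ h1 _
    have h6 := φ.map_neg ⟨_, h1⟩
    rw [h2] at h6
    rw [QuotientAddGroup.mk_sub, h5, zero_sub, ← h6]
    rfl

variable {L M}

lemma mk_mem_graph {hM : ∀ x ∈ M, ∀ r : R, r * x.1 ∈ L} {φ : M →+ R ⧸ L} {a b c : R} :
    mk a b c ∈ graph L M hM φ ↔ ∃ h : (a, b) ∈ M, φ ⟨_, h⟩ = (c : R ⧸ L) := by
  change (∃ h : (fst (mk a b c), snd (mk a b c)) ∈ M, φ ⟨_, h⟩ = ((ctr (mk a b c) : R) : R ⧸ L)) ↔ _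
  simp only [fst_mk, snd_mk, ctr_mk]

lemma graph_normal (hM : ∀ x ∈ M, ∀ r : R, r * x.1 ∈ L) (hM' : ∀ x ∈ M, ∀ r : R, r * x.2 ∈ L)
    (φ : M →+ R ⧸ L) : (graph L M hM φ).Normal := by
  refine ⟨fun g hg h => ?_⟩
  rw [← mk_coords g] at hg ⊢
  rw [← mk_coords h]
  simp only [mk_mul_mk, mk_inv, mk_mem_graph] at hg ⊢
  obtain ⟨h1, h2⟩ := hg
  have e : (fst h + fst g + -fst h, snd h + snd g + -snd h) = (fst g, snd g) := by
    ext <;> simp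
  simp only [e]
  refine ⟨h1, ?_⟩
  rw [h2, QuotientAddGroup.eq]
  have h3 := sub_mem (hM' _ h1 (fst h)) (hM _ h1 (snd h))
  convert h3 using 1
  ring

lemma image_graph (hM : ∀ x ∈ M, ∀ r : R, r * x.1 ∈ L) (φ : M →+ R ⧸ L) :
    image (graph L M hM φ) = M := by
  ext x
  rw [mem_image]
  simp only [mk_mem_graph]
  constructor
  · rintro ⟨c, h, -⟩
    exact h
  · intro h
    obtain ⟨c, hc⟩ := QuotientAddGroup.mk_surjective (φ ⟨x, h⟩)
    exact ⟨c, h, hc.symm⟩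

lemma centre_graph (hM : ∀ x ∈ M, ∀ r : R, r * x.1 ∈ L) (φ : M →+ R ⧸ L) :
    centre (graph L M hM φ) = L := by
  ext c
  rw [mem_centre, mk_mem_graph]
  have h0 : φ ⟨(0, 0), zero_mem M⟩ = 0 := φ.map_zero
  constructor
  · rintro ⟨h, hc⟩
    rw [h0, eq_comm, QuotientAddGroup.eq_zero_iff] at hc
    exact hc
  · intro h
    refine ⟨zero_mem M, ?_⟩
    rw [h0, eq_comm, QuotientAddGroup.eq_zero_iff]
    exact h

/-- The normal subgroups with image `M` and intersection `L` with the centre correspond to the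
homomorphisms `M → R / L`, provided that `L` contains the ideal generated by the coordinates
of `M`. -/
lemma card_normal_subgroups (hM : ∀ x ∈ M, ∀ r : R, r * x.1 ∈ L)
    (hM' : ∀ x ∈ M, ∀ r : R, r * x.2 ∈ L) :
    Nat.card {N : Subgroup (heisenbergGroup R) // N.Normal ∧ centre N = L ∧ image N = M} =
      Nat.card (M →+ R ⧸ L) := by
  refine (Nat.card_congr (Equiv.ofBijective (fun φ => ⟨graph L M hM φ, graph_normal hM hM' φ,
    centre_graph hM φ, image_graph hM φ⟩) ⟨fun φ ψ h => ?_, ?_⟩)).symm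
  · have h : graph L M hM φ = graph L M hM ψ := congrArg Subtype.val h
    ext ⟨⟨a, b⟩, hab⟩
    obtain ⟨c, hc⟩ := QuotientAddGroup.mk_surjective (φ ⟨(a, b), hab⟩)
    have h1 : mk a b c ∈ graph L M hM φ := mk_mem_graph.2 ⟨hab, hc.symm⟩
    rw [h] at h1
    obtain ⟨h2, h3⟩ := mk_mem_graph.1 h1
    rw [h3, hc]
  · rintro ⟨N, hN, rfl, rfl⟩
    choose c hc using fun x : image N => mem_image.1 x.2
    have key : ∀ (x : image N) (d : R), mk x.1.1 x.1.2 d ∈ N → (d : R ⧸ centre N) = c x := by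
      intro x d hd
      rw [QuotientAddGroup.eq, mem_centre]
      convert N.mul_mem (N.inv_mem hd) (hc x) using 1
      rw [mk_inv, mk_mul_mk]
      congr 1 <;> ring
    let φ : image N →+ R ⧸ centre N := AddMonoidHom.mk' (fun x => (c x : R ⧸ centre N)) (by
      intro x y
      have h1 := N.mul_mem (hc x) (hc y)
      rw [mk_mul_mk] at h1
      have h2 := key (x + y) _ h1
      have h5 : ((x.1.1 * y.1.2 : R) : R ⧸ centre N) = 0 := by
        rw [QuotientAddGroup.eq_zero_iff, mul_comm]
        exact hM _ x.2 _
      rw [← h2, QuotientAddGroup.mk_add, h5, add_zero, QuotientAddGroup.mk_add])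
    refine ⟨φ, Subtype.ext ?_⟩
    ext g
    rw [← mk_coords g]
    change mk _ _ _ ∈ graph _ _ hM φ ↔ _
    rw [mk_mem_graph]
    constructor
    · rintro ⟨h, hφ⟩
      have hφ : (c ⟨_, h⟩ : R ⧸ centre N) = ((ctr g : R) : R ⧸ centre N) := hφ
      rw [QuotientAddGroup.eq, mem_centre] at hφ
      have h1 := N.mul_mem (hc ⟨_, h⟩) hφ
      rw [mk_mul_mk] at h1
      convert h1 using 1
      congr 1 <;> simp
    · intro h
      have h1 : (fst g, snd g) ∈ image N := mem_image.2 ⟨_, h⟩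
      exact ⟨h1, (key ⟨_, h1⟩ _ h).symm⟩

end Graph

/-- A normal subgroup of index `m` contains all `(a, b, c)` with coordinates in `m R`. -/
lemma mem_of_index {N : Subgroup (heisenbergGroup R)} [N.Normal] {g : heisenbergGroup R}
    (h1 : (N.index : R) ∣ fst g) (h2 : (N.index : R) ∣ snd g) (h3 : (N.index : R) ∣ ctr g) :
    g ∈ N := by
  have hpow1 : ∀ (a : R) (m : ℕ), mk a 0 0 ^ m = mk (m * a) 0 0 := fun a m => by
    induction m with
    | zero => simp [one_eq]
    | succ m ih => rw [pow_succ, ih, mk_mul_mk]; congr 1 <;> push_cast <;> ring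
  have hpow2 : ∀ (a : R) (m : ℕ), mk 0 a 0 ^ m = mk 0 (m * a) 0 := fun a m => by
    induction m with
    | zero => simp [one_eq]
    | succ m ih => rw [pow_succ, ih, mk_mul_mk]; congr 1 <;> push_cast <;> ring
  have hpow3 : ∀ (a : R) (m : ℕ), mk 0 0 a ^ m = mk 0 0 (m * a) := fun a m => by
    induction m with
    | zero => simp [one_eq]
    | succ m ih => rw [pow_succ, ih, mk_mul_mk]; congr 1 <;> push_cast <;> ring
  obtain ⟨a, ha⟩ := h1
  obtain ⟨b, hb⟩ := h2
  obtain ⟨c, hc⟩ := h3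
  have e : g = mk a 0 0 ^ N.index * mk 0 b 0 ^ N.index *
      mk 0 0 (c - a * (N.index * b)) ^ N.index := by
    rw [hpow1, hpow2, hpow3, mk_mul_mk, mk_mul_mk, ← mk_coords g, ha, hb, hc]
    congr 1 <;> ring
  rw [e]
  exact N.mul_mem (N.mul_mem (N.pow_index_mem _) (N.pow_index_mem _)) (N.pow_index_mem _)

end Heisenberg

/-! ### Homomorphisms between `ℤ_p`-modules -/

section PadicHom

variable {p : ℕ} [hp : Fact p.Prime]

lemma exists_natCast_add_pow_mul (k : ℕ) (z : ℤ_[p]) :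
    ∃ (a : ℕ) (y : ℤ_[p]), z = a + ((p ^ k : ℕ) : ℤ_[p]) * y := by
  obtain ⟨y, hy⟩ := Ideal.mem_span_singleton'.1 (PadicInt.appr_spec k z)
  refine ⟨z.appr k, y, ?_⟩
  rw [Nat.cast_pow, mul_comm, hy]
  ring

variable {A B : Type*} [AddCommGroup A] [Module ℤ_[p] A] [AddCommGroup B] [Module ℤ_[p] B]

/-- A subgroup of finite index is a `ℤ_p`-submodule, as it contains some `p^k A` and `ℕ` is dense
in `ℤ_p`. -/
lemma exists_submodule_eq (L : AddSubgroup A) (hL : L.FiniteIndex) :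
    ∃ S : Submodule ℤ_[p] A, S.toAddSubgroup = L := by
  obtain ⟨k, hk⟩ := exists_pow_smul_mem_of_finiteIndex (p := p) L hL
  refine ⟨{ L with smul_mem' := fun z x hx => ?_ }, rfl⟩
  obtain ⟨a, y, rfl⟩ := exists_natCast_add_pow_mul k z
  rw [add_smul, mul_smul, Nat.cast_smul_eq_nsmul, Nat.cast_smul_eq_nsmul]
  exact L.add_mem (L.nsmul_mem hx a) (hk _)

/-- An additive map into a `ℤ_p`-module killed by `p^k` is linear. -/
lemma map_padic_smul {k : ℕ} (hk : ∀ x : B, p ^ k • x = 0) (φ : A →+ B) (z : ℤ_[p]) (x : A) :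
    φ (z • x) = z • φ x := by
  obtain ⟨a, y, rfl⟩ := exists_natCast_add_pow_mul k z
  simp only [add_smul, mul_smul, Nat.cast_smul_eq_nsmul, map_add, map_nsmul, hk]

/-- Additive maps into a module killed by `p^k` are linear, hence given by the values on a basis. -/
lemma card_addMonoidHom [Module.Free ℤ_[p] A] [Module.Finite ℤ_[p] A] {k : ℕ}
    (hk : ∀ x : B, p ^ k • x = 0) :
    Nat.card (A →+ B) = Nat.card B ^ Module.finrank ℤ_[p] A := by
  let e : (A →+ B) ≃ (A →ₗ[ℤ_[p]] B) :=
    { toFun := fun φ => { φ with map_smul' := fun z x => map_padic_smul hk φ z x }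
      invFun := fun φ => φ.toAddMonoidHom
      left_inv := fun _ => rfl
      right_inv := fun _ => rfl }
  rw [Nat.card_congr e,
    Nat.card_congr ((Module.finBasis ℤ_[p] A).constr ℕ (M' := B)).symm.toEquiv]
  simp [Nat.card_fun]

/-- The number of homomorphisms from a finite-index subgroup of a free `ℤ_p`-module to a finite
quotient of a `ℤ_p`-module. -/
lemma card_hom_quotient [Module.Free ℤ_[p] A] [Module.Finite ℤ_[p] A] (M : AddSubgroup A)
    (hM : M.FiniteIndex) (L : AddSubgroup B) (hL : L.FiniteIndex) :
    Nat.card (M →+ B ⧸ L) = L.index ^ Module.finrank ℤ_[p] A := by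
  obtain ⟨k, hk⟩ := exists_pow_smul_mem_of_finiteIndex (p := p) L hL
  obtain ⟨j, hj⟩ := exists_pow_smul_mem_of_finiteIndex (p := p) M hM
  obtain ⟨M, rfl⟩ := exists_submodule_eq (p := p) M hM
  obtain ⟨L, rfl⟩ := exists_submodule_eq (p := p) L hL
  have hrank : Module.finrank ℤ_[p] M = Module.finrank ℤ_[p] A := by
    refine le_antisymm (Submodule.finrank_le M) ?_
    let φ : A →ₗ[ℤ_[p]] M := LinearMap.codRestrict M (LinearMap.lsmul ℤ_[p] A ((p ^ j : ℕ) : ℤ_[p]))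
      fun x => by
        rw [LinearMap.lsmul_apply, Nat.cast_smul_eq_nsmul]
        exact hj x
    refine LinearMap.finrank_le_finrank_of_injective (f := φ) fun x y h => ?_
    have h : ((p ^ j : ℕ) : ℤ_[p]) • x = ((p ^ j : ℕ) : ℤ_[p]) • y := congrArg Subtype.val h
    exact smul_right_injective A (by exact_mod_cast pow_ne_zero j hp.1.ne_zero) h
  have hkill : ∀ x : B ⧸ L, p ^ k • x = 0 := fun x => by
    obtain ⟨b, rfl⟩ := Submodule.Quotient.mk_surjective L x
    rw [← Submodule.Quotient.mk_smul, Submodule.Quotient.mk_eq_zero]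
    exact hk b
  rw [← hrank]
  exact card_addMonoidHom (A := M) (B := B ⧸ L) hkill

end PadicHom

/-! ### Normal zeta functions as sums over normal subgroups -/

section NormalZeta

variable (G : Type*) [Group G]

/-- The normal subgroups of finite index. -/
abbrev FiniteIndexNormal : Type _ := {N : Subgroup G // N.Normal ∧ N.index ≠ 0}

variable {G} [TopologicalSpace G]

/-- If normal subgroups of finite index are open, the normal zeta function is the sum of
`|G : N|^{-s}` over them. -/
lemma normalZeta_eq_tsum (hopen : ∀ N : FiniteIndexNormal G, IsOpen (N.1 : Set G)) (s : ℂ)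
    (hs : Summable fun N : FiniteIndexNormal G => ‖(N.1.index : ℂ) ^ (-s)‖) :
    (∀ m, m ≠ 0 → Finite {N : OpenNormalSubgroup G // (N : Subgroup G).index = m}) ∧
    LSeriesSummable (normalZetaCoeff G) s ∧
    normalZeta G s = ∑' N : FiniteIndexNormal G, (N.1.index : ℂ) ^ (-s) := by
  have e : ∀ m, m ≠ 0 → Nonempty ({N : OpenNormalSubgroup G // (N : Subgroup G).index = m} ≃
      {N : FiniteIndexNormal G // N.1.index = m}) := fun m hm => ⟨
    { toFun := fun N => ⟨⟨N.1, N.1.isNormal', by rw [N.2]; exact hm⟩, N.2⟩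
      invFun := fun N => ⟨⟨⟨N.1.1, hopen N.1⟩, N.1.2.1⟩, N.2⟩
      left_inv := fun _ => rfl
      right_inv := fun _ => rfl }⟩
  obtain ⟨h1, h2, h3⟩ := LSeries_card_fiber (fun N : FiniteIndexNormal G => N.1.index)
    (fun N => N.2.2) s hs
  have h4 : ∀ {m : ℕ}, m ≠ 0 → normalZetaCoeff G m =
      (Nat.card {N : FiniteIndexNormal G // N.1.index = m} : ℂ) := fun {m} hm => by
    rw [normalZetaCoeff, openNormalCount, Nat.card_congr (e m hm).some]
  refine ⟨fun m hm => ?_, (LSeriesSummable_congr s h4).2 h2, (LSeries_congr h4 s).trans h3⟩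
  have := h1 m hm
  exact Finite.of_equiv _ (e m hm).some.symm

end NormalZeta

section Open

variable {p : ℕ} [hp : Fact p.Prime]

lemma isOpen_of_index_ne_zero_freeAbelianProP {d : ℕ}
    (N : FiniteIndexNormal (FreeAbelianProP p d)) :
    IsOpen (N.1 : Set (FreeAbelianProP p d)) := by
  obtain ⟨k, hk⟩ := exists_pow_smul_mem (p := p) (L := AddSubgroup.toSubgroup.symm N.1) N.2.2
    fun x => by
      have := N.2.1
      exact N.1.pow_index_mem (Multiplicative.ofAdd x)
  refine Subgroup.isOpen_of_mem_nhds (g := 1) _ ?_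
  have hp0 : (0 : ℝ) < (p : ℝ) ^ (-(k : ℤ)) := zpow_pos (by exact_mod_cast hp.1.pos) _
  refine Filter.mem_of_superset
    (show (Metric.ball (0 : Fin d → ℤ_[p]) ((p : ℝ) ^ (-(k : ℤ)))) ∈ nhds (0 : Fin d → ℤ_[p]) from
      Metric.ball_mem_nhds _ hp0) ?_
  intro x hx
  have h1 : ∀ i, ∃ y : ℤ_[p], x i = (p : ℤ_[p]) ^ k * y := fun i => by
    have h2 : ‖x i‖ ≤ (p : ℝ) ^ (-(k : ℤ)) :=
      (norm_le_pi_norm x i).trans (mem_ball_zero_iff.1 hx).le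
    rw [PadicInt.norm_le_pow_iff_mem_span_pow, Ideal.mem_span_singleton] at h2
    exact h2
  choose y hy using h1
  have h3 : x = p ^ k • y := by
    funext i
    rw [hy i]
    simp
  rw [h3]
  exact hk y

variable {R : Type*} [CommRing R] [IsDomain R] [IsDiscreteValuationRing R] [CharZero R]
  [TopologicalSpace R]

/-- The index `m` of `N` is non-zero in `R`, as `R` has characteristic zero. So `m R` is a
neighbourhood of `0`, and `N` contains all elements with entries in `m R`. -/
lemma isOpen_of_index_ne_zero_heisenbergGroup (hR : IsAdic (IsLocalRing.maximalIdeal R))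
    (N : FiniteIndexNormal (heisenbergGroup R)) : IsOpen (N.1 : Set (heisenbergGroup R)) := by
  have hring : IsTopologicalRing R := by
    have h : ‹TopologicalSpace R› = (IsLocalRing.maximalIdeal R).adicTopology := hR
    rw [h]
    exact (IsLocalRing.maximalIdeal R).nonarchimedean.toIsTopologicalRing
  have hN := N.2.1
  obtain ⟨π, hπ⟩ := IsDiscreteValuationRing.exists_irreducible R
  obtain ⟨k, hk⟩ := IsDiscreteValuationRing.ideal_eq_span_pow_irreducible
    (s := Ideal.span {(N.1.index : R)}) (by
      rw [Ne, Ideal.span_singleton_eq_bot]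
      exact_mod_cast N.2.2) hπ
  have hnhds : ((IsLocalRing.maximalIdeal R ^ k : Ideal R) : Set R) ∈ nhds (0 : R) :=
    hR.hasBasis_nhds_zero.mem_of_mem trivial
  have hmem : ∀ x ∈ IsLocalRing.maximalIdeal R ^ k, (N.1.index : R) ∣ x := fun x hx => by
    rw [hπ.maximalIdeal_eq, Ideal.span_singleton_pow, ← hk] at hx
    exact Ideal.mem_span_singleton.1 hx
  have hentry : ∀ i j : Fin 3, Continuous fun g : heisenbergGroup R => g.1.1 i j := fun i j =>
    (continuous_apply_apply i j).comp (continuous_induced_dom.comp continuous_subtype_val)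
  have hz : ∀ i j : Fin 3, i ≠ j →
      ∀ᶠ g in nhds (1 : heisenbergGroup R), g.1.1 i j ∈ IsLocalRing.maximalIdeal R ^ k :=
    fun i j hij => by
      have h0 : (1 : heisenbergGroup R).1.1 i j = 0 := by
        change (1 : Matrix (Fin 3) (Fin 3) R) i j = 0
        exact Matrix.one_apply_ne hij
      exact (hentry i j).continuousAt.preimage_mem_nhds (by rw [h0]; exact hnhds)
  refine Subgroup.isOpen_of_mem_nhds (g := 1) _ ?_
  filter_upwards [hz 0 1 (by decide), hz 1 2 (by decide), hz 0 2 (by decide)] with g h1 h2 h3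
  exact Heisenberg.mem_of_index (hmem _ h1) (hmem _ h2) (hmem _ h3)

end Open

/-! ### The zeta function of the Heisenberg group -/

section Abelian

variable {p : ℕ} [hp : Fact p.Prime] {A B : Type*} [AddCommGroup A] [AddCommGroup B]

lemma natCast_pow_cpow (p t : ℕ) (z : ℂ) : ((p ^ t : ℕ) : ℂ) ^ z = (p : ℂ) ^ ((t : ℂ) * z) := by
  rw [Complex.natCast_cpow_natCast_mul, Nat.cast_pow]

/-- The lattice zeta function `∑_L |A : L|^{-s}` of a group with a periodic flag of period `n`
converges for `Re s > n - 1`. -/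
lemma PeriodicFlag.summable_index {n : ℕ} (Φ : PeriodicFlag A p n) (hn : 0 < n) {s : ℂ}
    (hs : (n : ℝ) - 1 < s.re) :
    Summable fun L : {L : AddSubgroup A // L.FiniteIndex} => ‖(L.1.index : ℂ) ^ (-s)‖ := by
  refine (Φ.summable_of_norm_le hp.1 hn
    (fun a => (p : ℂ) ^ (((∑ i, a i : ℕ) : ℂ) * -s)) s.re hs fun a => ?_).congr fun L => ?_
  · rw [Complex.norm_natCast_cpow_of_pos hp.1.pos]
    refine le_of_eq (congrArg _ ?_)
    rw [mul_comm, ← Complex.ofReal_natCast, Complex.re_mul_ofReal, Complex.neg_re]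
  · rw [Φ.index_eq_pow hp.1 hn L.2, natCast_pow_cpow]

/-- Finite-index subgroups correspond under an isomorphism. -/
def finiteIndexEquiv (e : A ≃+ B) :
    {L : AddSubgroup A // L.FiniteIndex} ≃ {L : AddSubgroup B // L.FiniteIndex} :=
  e.mapAddSubgroup.toEquiv.subtypeEquiv fun L => by
    rw [AddSubgroup.finiteIndex_iff, AddSubgroup.finiteIndex_iff]
    exact (not_congr (by rw [← AddSubgroup.index_map_equiv L e]; rfl))

lemma index_finiteIndexEquiv (e : A ≃+ B) (L : {L : AddSubgroup A // L.FiniteIndex}) :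
    (finiteIndexEquiv e L).1.index = L.1.index :=
  AddSubgroup.index_map_equiv L.1 e

/-- Finite-index normal subgroups of an abelian group in multiplicative notation. -/
def finiteIndexNormalEquiv :
    FiniteIndexNormal (Multiplicative A) ≃ {L : AddSubgroup A // L.FiniteIndex} :=
  AddSubgroup.toSubgroup.symm.toEquiv.subtypeEquiv fun N => by
    rw [AddSubgroup.finiteIndex_iff]
    exact ⟨fun h => h.2, fun h => ⟨inferInstance, h⟩⟩

lemma index_finiteIndexNormalEquiv (N : FiniteIndexNormal (Multiplicative A)) :
    (finiteIndexNormalEquiv N).1.index = N.1.index := rfl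

end Abelian

section Heisenberg

open IsLocalRing

variable {R : Type*} [CommRing R]

/-- Multiplication by `x` on `R × R`. -/
def scale (x : R) : R × R →+ R × R := DistribSMul.toAddMonoidHom (R × R) x

@[simp]
lemma scale_apply (x : R) (y : R × R) : scale x y = (x * y.1, x * y.2) := rfl

lemma scale_injective [IsDomain R] {x : R} (hx : x ≠ 0) : Function.Injective (scale x) := by
  rintro ⟨a, b⟩ ⟨c, d⟩ h
  simpa [hx] using h

lemma range_scale (x : R) : (scale x).range =
    (Ideal.span {x}).toAddSubgroup.prod (Ideal.span {x}).toAddSubgroup := by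
  ext ⟨a, b⟩
  rw [AddSubgroup.mem_prod, Submodule.mem_toAddSubgroup, Submodule.mem_toAddSubgroup,
    Ideal.mem_span_singleton, Ideal.mem_span_singleton]
  constructor
  · rintro ⟨y, h⟩
    obtain ⟨rfl, rfl⟩ := Prod.ext_iff.1 h
    exact ⟨⟨_, rfl⟩, ⟨_, rfl⟩⟩
  · rintro ⟨⟨c, rfl⟩, ⟨d, rfl⟩⟩
    exact ⟨(c, d), rfl⟩

variable [IsDomain R] [IsDiscreteValuationRing R] {p f n : ℕ} (Φ : PeriodicFlag R p n)

lemma index_range_scale (hΦ : ∀ k, Φ.F (f * k) = (maximalIdeal R ^ k).toAddSubgroup)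
    {π : R} (hπ : Irreducible π) (k : ℕ) :
    (scale (π ^ k)).range.index = p ^ (2 * f * k) := by
  rw [range_scale, AddSubgroup.index_prod, ← Ideal.span_singleton_pow, ← hπ.maximalIdeal_eq, ← hΦ,
    Φ.index_F, ← pow_add]
  congr 1
  ring

/-- The ideal `𝔪^k`, with `k` the conductor exponent of `L`, is the largest ideal contained
in `L`. -/
lemma mem_pow_conductorExponent [hp : Fact p.Prime]
    (hΦ : ∀ k, Φ.F (f * k) = (maximalIdeal R ^ k).toAddSubgroup)
    (hn : 0 < n) (hf : 0 < f) {L : AddSubgroup R} (hL : L.FiniteIndex)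
    (x : R) : (∀ r : R, r * x ∈ L) ↔
      x ∈ maximalIdeal R ^ conductorExponent f (Φ.latticeType L) := by
  constructor
  · intro h
    by_cases hx : x = 0
    · rw [hx]
      exact zero_mem _
    obtain ⟨π, hπ⟩ := IsDiscreteValuationRing.exists_irreducible R
    obtain ⟨j, hj⟩ := IsDiscreteValuationRing.ideal_eq_span_pow_irreducible
      (s := Ideal.span {x}) (by rwa [Ne, Ideal.span_singleton_eq_bot]) hπ
    rw [← Ideal.span_singleton_pow, ← hπ.maximalIdeal_eq] at hj
    refine Ideal.pow_le_pow_right ?_ (hj ▸ Ideal.mem_span_singleton_self x)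
    rw [Φ.conductorExponent_latticeType_le_iff hp.1 hn hf hL, hΦ, ← hj]
    intro y hy
    obtain ⟨r, rfl⟩ := Ideal.mem_span_singleton'.1 hy
    exact h r
  · intro h r
    have h1 := (Φ.conductorExponent_latticeType_le_iff hp.1 hn hf hL _).1 le_rfl
    rw [hΦ] at h1
    exact h1 (Ideal.mul_mem_left _ r h)

/-- The image of `N` has coordinates in the largest ideal contained in `L`, that is in `π^k R`. -/
lemma image_le_range_scale [hp : Fact p.Prime]
    (hΦ : ∀ k, Φ.F (f * k) = (maximalIdeal R ^ k).toAddSubgroup)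
    (hn : 0 < n) (hf : 0 < f) {π : R} (hπ : Irreducible π)
    (N : Subgroup (heisenbergGroup R)) [N.Normal] (hL : (Heisenberg.centre N).FiniteIndex) :
    Heisenberg.image N ≤
      (scale (π ^ conductorExponent f (Φ.latticeType (Heisenberg.centre N)))).range := by
  intro x hx
  rw [range_scale, AddSubgroup.mem_prod, Submodule.mem_toAddSubgroup, Submodule.mem_toAddSubgroup,
    ← Ideal.span_singleton_pow, ← hπ.maximalIdeal_eq,
    ← mem_pow_conductorExponent Φ hΦ hn hf hL, ← mem_pow_conductorExponent Φ hΦ hn hf hL]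
  exact ⟨fun r => (Heisenberg.mul_mem_centre hx r).1, fun r => (Heisenberg.mul_mem_centre hx r).2⟩

/-- The pair `(L, M')` attached to a normal subgroup `N` with `L = N ∩ R` and image `π^k M'` in
`R × R`, where `k` is the conductor exponent of `L`. -/
noncomputable def latticePair (f : ℕ) (π : R) (N : FiniteIndexNormal (heisenbergGroup R)) :
    {L : AddSubgroup R // L.FiniteIndex} × {M : AddSubgroup (R × R) // M.FiniteIndex} :=
  have h : (Heisenberg.centre N.1).index ≠ 0 ∧ (Heisenberg.image N.1).index ≠ 0 := by
    have := N.2.1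
    have h := N.2.2
    rw [Heisenberg.index_eq] at h
    exact mul_ne_zero_iff.1 h
  (⟨Heisenberg.centre N.1, ⟨h.1⟩⟩, ⟨(Heisenberg.image N.1).comap
    (scale (π ^ conductorExponent f (Φ.latticeType (Heisenberg.centre N.1)))), ⟨by
      rw [AddSubgroup.index_comap]
      exact fun h0 => h.2 (by
        have := AddSubgroup.relIndex_dvd_index_of_normal (Heisenberg.image N.1)
          (scale (π ^ conductorExponent f (Φ.latticeType (Heisenberg.centre N.1)))).range
        rw [h0] at this
        exact zero_dvd_iff.1 this)⟩⟩)

variable [hp : Fact p.Prime]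

lemma map_comap_image (hΦ : ∀ k, Φ.F (f * k) = (maximalIdeal R ^ k).toAddSubgroup)
    (hn : 0 < n) (hf : 0 < f) {π : R} (hπ : Irreducible π)
    (N : FiniteIndexNormal (heisenbergGroup R)) :
    ((latticePair Φ f π N).2.1).map
      (scale (π ^ conductorExponent f (Φ.latticeType (latticePair Φ f π N).1.1))) =
      Heisenberg.image N.1 := by
  have := N.2.1
  exact AddSubgroup.map_comap_eq_self
    (image_le_range_scale Φ hΦ hn hf hπ N.1 (latticePair Φ f π N).1.2)

lemma index_eq_latticePair (hΦ : ∀ k, Φ.F (f * k) = (maximalIdeal R ^ k).toAddSubgroup)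
    (hn : 0 < n) (hf : 0 < f) {π : R} (hπ : Irreducible π)
    (N : FiniteIndexNormal (heisenbergGroup R)) :
    N.1.index = (latticePair Φ f π N).1.1.index *
      ((latticePair Φ f π N).2.1.index *
        p ^ (2 * f * conductorExponent f (Φ.latticeType (latticePair Φ f π N).1.1))) := by
  have := N.2.1
  rw [Heisenberg.index_eq, ← map_comap_image Φ hΦ hn hf hπ,
    AddSubgroup.index_map_of_injective _ (scale_injective (pow_ne_zero _ hπ.ne_zero)),
    index_range_scale Φ hΦ hπ]
  rfl

/-- The normal subgroups with the pair `(L, M')` correspond to the homomorphisms `π^k M' → R / L`,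
and `π^k M'` is a free `ℤ_p`-module of rank `2n`. -/
lemma card_latticePair_fiber [Algebra ℤ_[p] R] [Module.Free ℤ_[p] R] [Module.Finite ℤ_[p] R]
    (hrank : Module.finrank ℤ_[p] R = n)
    (hΦ : ∀ k, Φ.F (f * k) = (maximalIdeal R ^ k).toAddSubgroup)
    (hn : 0 < n) (hf : 0 < f) {π : R} (hπ : Irreducible π)
    (y : {L : AddSubgroup R // L.FiniteIndex} × {M : AddSubgroup (R × R) // M.FiniteIndex}) :
    Nat.card {N // latticePair Φ f π N = y} = y.1.1.index ^ (2 * n) := by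
  obtain ⟨⟨L, hL⟩, ⟨M, hM⟩⟩ := y
  set k := conductorExponent f (Φ.latticeType L) with hk
  have hinj : Function.Injective (scale (π ^ k)) := scale_injective (pow_ne_zero _ hπ.ne_zero)
  have hmem : ∀ x ∈ M.map (scale (π ^ k)), (∀ r : R, r * x.1 ∈ L) ∧ ∀ r : R, r * x.2 ∈ L := by
    rintro _ ⟨x, -, rfl⟩
    have h1 : π ^ k ∈ maximalIdeal R ^ k := by
      rw [hπ.maximalIdeal_eq, Ideal.span_singleton_pow]
      exact Ideal.mem_span_singleton_self _
    exact ⟨(mem_pow_conductorExponent Φ hΦ hn hf hL _).2 (Ideal.mul_mem_right _ _ h1),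
      (mem_pow_conductorExponent Φ hΦ hn hf hL _).2 (Ideal.mul_mem_right _ _ h1)⟩
  have hindex : (M.map (scale (π ^ k))).index ≠ 0 := by
    rw [AddSubgroup.index_map_of_injective _ hinj, index_range_scale Φ hΦ hπ]
    exact mul_ne_zero hM.index_ne_zero (pow_ne_zero _ hp.1.ne_zero)
  have h2n : Module.finrank ℤ_[p] (R × R) = 2 * n := by
    rw [Module.finrank_prod, hrank, two_mul]
  rw [← h2n, ← card_hom_quotient (p := p) (M.map (scale (π ^ k))) ⟨hindex⟩ L hL,
    ← Heisenberg.card_normal_subgroups (fun x hx => (hmem x hx).1) fun x hx => (hmem x hx).2]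
  refine Nat.card_congr ((Equiv.subtypeSubtypeEquivSubtypeExists _ _).trans
    (Equiv.subtypeEquivRight fun N => ?_))
  constructor
  · rintro ⟨hN, h⟩
    obtain rfl : Heisenberg.centre N = L := congrArg (fun y => y.1.1) h
    refine ⟨hN.1, rfl, ?_⟩
    rw [← map_comap_image Φ hΦ hn hf hπ ⟨N, hN⟩, h]
  · rintro ⟨hN, rfl, h⟩
    refine ⟨⟨hN, ?_⟩, ?_⟩
    · rw [Heisenberg.index_eq, h]
      exact mul_ne_zero hL.index_ne_zero hindex
    · refine Prod.ext rfl (Subtype.ext ?_)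
      change (Heisenberg.image N).comap (scale (π ^ k)) = M
      exact (congrArg (AddSubgroup.comap (scale (π ^ k))) h).trans
        (AddSubgroup.comap_map_eq_self_of_injective hinj M)

/-- The sum over the normal subgroups of the Heisenberg group, computed along `N ↦ (L, M')`:
a pair `(L, M')` with `L` of index `p^t` and conductor exponent `k` contributes
`|R : L|^{2n} (|R : L| |R² : M'| p^{2fk})^{-s}`. -/
lemma tsum_heisenberg [Algebra ℤ_[p] R] [Module.Free ℤ_[p] R] [Module.Finite ℤ_[p] R]
    (hrank : Module.finrank ℤ_[p] R = n)
    (hΦ : ∀ k, Φ.F (f * k) = (maximalIdeal R ^ k).toAddSubgroup)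
    (hn : 0 < n) (hf : 0 < f) (s : ℂ)
    (h1 : Summable fun L : {L : AddSubgroup R // L.FiniteIndex} =>
      ‖latticeTerm p f s (Φ.latticeType L.1)‖)
    (h2 : Summable fun M : {M : AddSubgroup (R × R) // M.FiniteIndex} =>
      ‖(M.1.index : ℂ) ^ (-s)‖) :
    (Summable fun N : FiniteIndexNormal (heisenbergGroup R) => ‖(N.1.index : ℂ) ^ (-s)‖) ∧
    ∑' N : FiniteIndexNormal (heisenbergGroup R), (N.1.index : ℂ) ^ (-s) =
      (∑' L : {L : AddSubgroup R // L.FiniteIndex}, latticeTerm p f s (Φ.latticeType L.1)) *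
        ∑' M : {M : AddSubgroup (R × R) // M.FiniteIndex}, (M.1.index : ℂ) ^ (-s) := by
  obtain ⟨π, hπ⟩ := IsDiscreteValuationRing.exists_irreducible R
  have hp0 : (p : ℂ) ≠ 0 := by exact_mod_cast hp.1.ne_zero
  set g : {L : AddSubgroup R // L.FiniteIndex} × {M : AddSubgroup (R × R) // M.FiniteIndex} → ℂ :=
    fun y => ((y.1.1.index * (y.2.1.index *
      p ^ (2 * f * conductorExponent f (Φ.latticeType y.1.1))) : ℕ) : ℂ) ^ (-s) with hg
  have hgN : ∀ N : FiniteIndexNormal (heisenbergGroup R),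
      (N.1.index : ℂ) ^ (-s) = g (latticePair Φ f π N) := fun N => by
    rw [index_eq_latticePair Φ hΦ hn hf hπ N]
  have hcard := card_latticePair_fiber Φ hrank hΦ hn hf hπ
  have hfin : ∀ y, Finite {N // latticePair Φ f π N = y} := fun y => by
    refine (Nat.card_ne_zero.1 ?_).2
    rw [hcard]
    exact pow_ne_zero _ y.1.2.index_ne_zero
  have hterm : ∀ y, (Nat.card {N // latticePair Φ f π N = y} : ℂ) * g y =
      latticeTerm p f s (Φ.latticeType y.1.1) * (y.2.1.index : ℂ) ^ (-s) := fun y => by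
    rw [hcard, hg]
    simp only [Φ.index_eq_pow hp.1 hn y.1.2]
    set t := ∑ i, Φ.latticeType y.1.1 i
    have hsplit : latticeTerm p f s (Φ.latticeType y.1.1) = ((p ^ t : ℕ) : ℂ) ^ (2 * n) *
        ((p : ℂ) ^ ((t : ℂ) * -s) * (p : ℂ) ^
          (((2 * f * conductorExponent f (Φ.latticeType y.1.1) : ℕ) : ℂ) * -s)) := by
      rw [← Complex.cpow_natCast, natCast_pow_cpow, ← Complex.cpow_add _ _ hp0,
        ← Complex.cpow_add _ _ hp0]
      change (p : ℂ) ^ ((t : ℂ) * _ - _) = _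
      congr 1
      push_cast
      ring
    rw [hsplit, Nat.cast_pow, Nat.cast_mul, Complex.natCast_mul_natCast_cpow, Nat.cast_mul,
      Complex.natCast_mul_natCast_cpow, natCast_pow_cpow, natCast_pow_cpow]
    ring
  have hsummable : Summable fun N : FiniteIndexNormal (heisenbergGroup R) =>
      ‖g (latticePair Φ f π N)‖ := by
    rw [summable_norm_comp_iff _ hfin]
    refine (Summable.mul_norm h1 h2).congr fun y => ?_
    rw [← hterm, norm_mul, Complex.norm_natCast]
  simp only [hgN]
  refine ⟨hsummable, ?_⟩
  rw [tsum_comp_eq _ _ hsummable, tsum_congr hterm, tsum_mul_tsum_of_summable_norm h1 h2]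

end Heisenberg

theorem mainTheorem3 (p : ℕ) [Fact p.Prime]
    (R : Type*) [CommRing R] [IsDomain R] [IsDiscreteValuationRing R] [CharZero R]
    [Algebra ℤ_[p] R] [Module.Finite ℤ_[p] R]
    [TopologicalSpace R] (hR : IsAdic (IsLocalRing.maximalIdeal R))
    (e f n : ℕ)
    (he : Ideal.span {(p : R)} = IsLocalRing.maximalIdeal R ^ e)
    (hf : (IsLocalRing.maximalIdeal R).inertiaDeg ℤ_[p] = f)
    (hn : n = e * f) :
    (∀ m : ℕ, m ≠ 0 →
      Finite {N : OpenNormalSubgroup (heisenbergGroup R) //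
        (N : Subgroup (heisenbergGroup R)).index = m} ∧
      Finite {N : OpenNormalSubgroup (FreeAbelianProP p (2 * n)) //
        (N : Subgroup (FreeAbelianProP p (2 * n))).index = m}) ∧
    ∀ s : ℂ, 2 * (n : ℝ) - 1 < s.re →
      LSeriesSummable (normalZetaCoeff (heisenbergGroup R)) s ∧
      LSeriesSummable (normalZetaCoeff (FreeAbelianProP p (2 * n))) s ∧
      cancelledDenominator p n f s ≠ 0 ∧
      normalZeta (heisenbergGroup R) s =
        normalZeta (FreeAbelianProP p (2 * n)) s
          * (cancelledNumerator p n f s / cancelledDenominator p n f s) := by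
  have hp : p.Prime := Fact.out
  have := isTorsionFree_of_charZero p R
  obtain ⟨hf0, hn0⟩ := degree_pos he hf hn
  obtain ⟨Φ, hΦ⟩ := exists_periodicFlag_ring he hf hn
  have hrank := finrank_eq he hf hn
  have h2n : Module.finrank ℤ_[p] (R × R) = 2 * n := by
    rw [Module.finrank_prod, hrank, two_mul]
  obtain ⟨Ψ⟩ := exists_periodicFlag (p := p) (A := R × R) (Nat.mul_pos two_pos hn0) h2n
  obtain ⟨π, hπ⟩ := IsDiscreteValuationRing.exists_irreducible R
  -- identifies the subgroups of `ℤ_p^{2n}` with those of `R × R`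
  let ε : R × R ≃+ (Fin (2 * n) → ℤ_[p]) :=
    (Module.finBasisOfFinrankEq ℤ_[p] (R × R) h2n).equivFun.toAddEquiv
  have key : ∀ s : ℂ, 2 * (n : ℝ) - 1 < s.re →
      ((∀ m, m ≠ 0 → Finite {N : OpenNormalSubgroup (heisenbergGroup R) //
          (N : Subgroup (heisenbergGroup R)).index = m}) ∧
        LSeriesSummable (normalZetaCoeff (heisenbergGroup R)) s ∧
        normalZeta (heisenbergGroup R) s =
          (∑' M : {M : AddSubgroup (R × R) // M.FiniteIndex}, (M.1.index : ℂ) ^ (-s)) *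
            (cancelledNumerator p n f s / cancelledDenominator p n f s)) ∧
      ((∀ m, m ≠ 0 → Finite {N : OpenNormalSubgroup (FreeAbelianProP p (2 * n)) //
          (N : Subgroup (FreeAbelianProP p (2 * n))).index = m}) ∧
        LSeriesSummable (normalZetaCoeff (FreeAbelianProP p (2 * n))) s ∧
        normalZeta (FreeAbelianProP p (2 * n)) s =
          ∑' M : {M : AddSubgroup (R × R) // M.FiniteIndex}, (M.1.index : ℂ) ^ (-s)) ∧
      cancelledDenominator p n f s ≠ 0 := by
    intro s hs
    obtain ⟨h1, h2, h3⟩ := Φ.tsum_latticeTerm (AddMonoidHom.mulLeft π)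
      (mul_right_injective₀ hπ.ne_zero) (fun k => by
        rw [hΦ, hΦ, map_mulLeft_toAddSubgroup, ← hπ.maximalIdeal_eq, pow_succ']) hp hn hn0 hs
    have h4 := Ψ.summable_index (Nat.mul_pos two_pos hn0) (s := s) (by push_cast; exact hs)
    obtain ⟨h5, h6⟩ := tsum_heisenberg Φ hrank hΦ hn0 hf0 s h1 h4
    refine ⟨?_, ?_, h2⟩
    · rw [← h3, mul_comm, ← h6]
      exact normalZeta_eq_tsum (isOpen_of_index_ne_zero_heisenbergGroup hR) s h5
    · let E : FiniteIndexNormal (FreeAbelianProP p (2 * n)) ≃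
          {M : AddSubgroup (R × R) // M.FiniteIndex} :=
        finiteIndexNormalEquiv.trans (finiteIndexEquiv ε.symm)
      have hE : ∀ N, (E N).1.index = N.1.index := fun N =>
        (index_finiteIndexEquiv ε.symm _).trans (index_finiteIndexNormalEquiv N)
      rw [← E.tsum_eq]
      simp only [hE]
      refine normalZeta_eq_tsum isOpen_of_index_ne_zero_freeAbelianProP s ?_
      refine (E.summable_iff.2 h4).congr fun N => ?_
      rw [Function.comp_apply, hE]
  refine ⟨fun m hm => ?_, fun s hs => ?_⟩
  -- finiteness of the coefficients follows from convergence at one point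
  · obtain ⟨⟨h1, -⟩, ⟨h2, -⟩, -⟩ := key ((2 * n : ℝ) : ℂ) (by rw [Complex.ofReal_re]; linarith)
    exact ⟨h1 m hm, h2 m hm⟩
  · obtain ⟨⟨-, h1, h2⟩, ⟨-, h3, h4⟩, h5⟩ := key s hs
    exact ⟨h1, h3, h5, by rw [h2, h4]⟩
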